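/- Let $\mathcal Q$ be a set of words on the alphabet $\{\bullet,\blacklozenge,\blacktriangle\}$. A word $w_1\cdots w_k\in\mathcal Q$ is identified with a clockwise oriented necklace that carries one $\square$-pearl followed by the pearls $w_1,\dots,w_k$. Put $Q(v,w,u)=\sum_{s\in\mathcal Q}v^{|s|_\bullet}w^{|s|_\blacklozenge}u^{|s|_\blacktriangle}$. All trees below are finite plane trees whose vertices are copies of necklaces of $\mathcal Q$ and whose edges join pearls, each pearl being incident to at most one edge; they are considered up to isomorphism. A pearl incident to no edge is *free*, and the size $|\tau|$ is the number of vertices. * A *rooted $\mathcal Q$-tree* is such a tree with a distinguished root $\square$-pearl, in which every edge joins a $\bullet$- or a $\blacklozenge$-pearl to a $\square$-pearl, and whose free pearls are exactly the root and the $\blacktriangle$-pearls. The subtree $\tau_x$ at a pearl $x$ consists of $x$ and everything on the other side of $x$ with respect to the root; the excess of $x$ is $|\tau_x|_\blacktriangle-|\tau_x|_\blacklozenge$. The tree is *non-negative* if the excess of every pearl is non-negative; its excess is that of its root. Let $\mathcal F_0$ be the class of non-negative $\mathcal Q$-trees with excess $0$, $\mathcal F_0^{\circ}$ the class of such trees with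 a marked necklace (vertex), and $f=\sum_{\tau\in\mathcal F_0}t^{|\tau|}$. * A *rooted $\mathcal Q$-companion tree* is such a tree with a distinguished root pearl (of any kind), in which every edge joins a $\bullet$- to a $\square$-pearl or a $\blacklozenge$- to a $\blacktriangle$-pearl, the root is free, and no non-root $\bullet$- or $\blacklozenge$-pearl is free. An *unrooted $\mathcal Q$-companion tree* is such a tree with the same two types of edges, without root pearl and without free $\bullet$- or $\blacklozenge$-pearl. *Defects* are free non-root $\blacktriangle$-pearls. For $x\in\{\square,\bullet,\blacklozenge,\blacktriangle\}$ let $\mathbf C_x$ be the class of rooted $\mathcal Q$-companion trees without defects with root pearl of kind $x$, and $C_x=\sum_{\tau\in\mathbf C_x}t^{|\tau|}$. Let $\mathbf C^{\circ}$ be the class of unrooted $\mathcal Q$-companion trees without defects with a marked necklace. * $(\square+\square\!-\!\mathbf C_\bullet)\times\mathcal Q(\bullet\!-\!\mathbf C_\square,\blacklozenge\!-\!\mathbf C_\blacktriangle,\blacktriangle\!-\!\mathbf C_\blacklozenge)$ denotes the class of pairs consisting of (i) a $\square$-pearl carrying either nothing or a tree of $\mathbf C_\bullet$, and (ii) a necklace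 $s\in\mathcal Q$ with a tree of $\mathbf C_\square$, $\mathbf C_\blacktriangle$, $\mathbf C_\blacklozenge$ attached to each of its $\bullet$-, $\blacklozenge$-, $\blacktriangle$-pearls respectively; the marked necklace of the pair is $s$. Then there are bijections $$\mathcal F_0^{\circ}\equiv\mathbf C^{\circ}\equiv(\square+\square\!-\!\mathbf C_\bullet)\times\mathcal Q(\bullet\!-\!\mathbf C_\square,\blacklozenge\!-\!\mathbf C_\blacktriangle,\blacktriangle\!-\!\mathbf C_\blacklozenge)$$ that preserve the multiset of necklaces and the type of the marked necklace. Moreover, $\mathcal F_0$, $\mathcal F_0^\circ$ and the classes $\mathbf C_x$ have finitely many elements of each size, the substitution of $C_\square,C_\blacktriangle,C_\blacklozenge$ into $Q$ is well defined, and the derivative of $f$, which satisfies $t\frac{df}{dt}=\sum_{\tau\in\mathcal F_0^\circ}t^{|\tau|}$, is given by $$\frac{df}{dt}=(1+C_\bullet)\cdot Q(C_\square,C_\blacktriangle,C_\blacklozenge).$$ -/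

import Mathlib

namespace Necklace

/-- The letters of the words that encode necklaces: `bullet` is `●`, `diamond` is `♦`,
`triangle` is `▲`. -/
inductive Letter
  | bullet
  | diamond
  | triangle
  deriving DecidableEq

/-- The four kinds of pearls: `none` is the square pearl `□`, `some x` is a letter. -/
abbrev Kind := Option Letter

/-- The pearls carried by a family of necklaces indexed by `V`. The necklace of the word
`w₁ ⋯ w_k` carries one `□`-pearl (position `none`), followed clockwise by the pearls
`w₁, …, w_k`. -/
abbrev Pearl {V : Type} (word : V → List Letter) : Type :=
  Σ v : V, Option (Fin (word v).length)

/-- A graph whose vertices are copies of necklaces, and whose edges join pearls, each pearl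
being incident to at most one edge. `mate p` is the other endpoint of the edge at `p`, and
`mate p = p` means that `p` is free. For a tree, the cyclic orders of the pearls on the
necklaces are precisely the plane structure. -/
structure Graph (V : Type) where
  word : V → List Letter
  mate : Pearl word → Pearl word
  mate_mate : ∀ p, mate (mate p) = p

namespace Graph

variable {V : Type} (G : Graph V)

/-- The kind (`□`, `●`, `♦` or `▲`) of a pearl. -/
def kind (p : Pearl G.word) : Kind := p.2.map (G.word p.1).get

/-- The pearl `p` is incident to no edge. -/
def Free (p : Pearl G.word) : Prop := G.mate p = p

/-- The simple graph whose nodes are the necklaces and the pearls, in which each necklace is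
joined to its pearls and each pearl to its mate. It is a tree exactly when the multigraph that
has the necklaces as vertices is connected and without cycle (loops and multiple edges
included). -/
def incidence : SimpleGraph (V ⊕ Pearl G.word) :=
  SimpleGraph.fromRel fun a b =>
    match a, b with
    | .inl v, .inr p => p.1 = v
    | .inr p, .inr q => G.mate p = q
    | _, _ => False

/-- Every edge joins a pearl of kind `a` to a pearl of kind `b`, for some pair `(a, b)` in the
list `l`, in one of the two directions. -/
def EdgesOfType (l : List (Kind × Kind)) : Prop :=
  ∀ p, ¬ G.Free p →
    (G.kind p, G.kind (G.mate p)) ∈ l ∨ (G.kind (G.mate p), G.kind p) ∈ l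

/-- Rooted `Q`-tree with root pearl `r`: a `□`-rooted tree with edges `●–□` (black) and `♦–□`
(red), in which exactly the root and the `▲`-pearls are free. -/
structure IsQTree (Q : Set (List Letter)) (r : Pearl G.word) : Prop where
  tree : G.incidence.IsTree
  word_mem : ∀ v, G.word v ∈ Q
  edges : G.EdgesOfType [(some .bullet, none), (some .diamond, none)]
  root_kind : G.kind r = none
  free_iff : ∀ p, G.Free p ↔ (p = r ∨ G.kind p = some .triangle)

/-- The set of pearls of the subtree at the pearl `x` of a tree rooted at the pearl `r`: those
on the other side of `x` with respect to the root, `x` included. -/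
def subtree (r x : Pearl G.word) : Set (Pearl G.word) :=
  {y | ∀ w : G.incidence.Walk (.inr r) (.inr y), .inr x ∈ w.support}

/-- The excess of the pearl `x` in the tree rooted at `r`: the number of `▲`-pearls minus the
number of `♦`-pearls in the subtree at `x`. -/
noncomputable def excess (r x : Pearl G.word) : ℤ :=
  ({y ∈ G.subtree r x | G.kind y = some .triangle}.ncard : ℤ) -
    ({y ∈ G.subtree r x | G.kind y = some .diamond}.ncard : ℤ)

/-- Non-negative `Q`-tree: the excess is non-negative at each pearl. -/
def IsNonnegQTree (Q : Set (List Letter)) (r : Pearl G.word) : Prop :=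
  G.IsQTree Q r ∧ ∀ x, 0 ≤ G.excess r x

/-- The conditions on vertices and edges shared by all `Q`-companion trees: a tree with
necklaces in `Q` and edges `●–□` (black) and `♦–▲` (blue). -/
structure IsCompanion (Q : Set (List Letter)) : Prop where
  tree : G.incidence.IsTree
  word_mem : ∀ v, G.word v ∈ Q
  edges : G.EdgesOfType [(some .bullet, none), (some .diamond, some .triangle)]

/-- Rooted `Q`-companion tree with root pearl `r`: the root is free, and no other `●`- or
`♦`-pearl is free. -/
structure IsRootedCompanion (Q : Set (List Letter)) (r : Pearl G.word) : Prop
    extends G.IsCompanion Q where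
  root_free : G.Free r
  free_kind : ∀ p, G.Free p → p ≠ r →
    G.kind p ≠ some .bullet ∧ G.kind p ≠ some .diamond

/-- Unrooted `Q`-companion tree: no `●`- or `♦`-pearl is free. -/
structure IsUnrootedCompanion (Q : Set (List Letter)) : Prop
    extends G.IsCompanion Q where
  free_kind : ∀ p, G.Free p → G.kind p ≠ some .bullet ∧ G.kind p ≠ some .diamond

/-- A defect is a free `▲`-pearl other than the root pearl (if there is one). -/
def IsDefect (root : Option (Pearl G.word)) (p : Pearl G.word) : Prop :=
  G.Free p ∧ G.kind p = some .triangle ∧ root ≠ some p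

variable {G}
variable {W : Type} {H : Graph W}

/-- The map on pearls induced by a map of necklaces that preserves words. -/
def mapPearl (σ : V → W) (hσ : ∀ v, H.word (σ v) = G.word v) (p : Pearl G.word) :
    Pearl H.word :=
  ⟨σ p.1, p.2.map (Fin.cast (congrArg List.length (hσ p.1).symm))⟩

theorem mapPearl_id (h : ∀ v, G.word (id v) = G.word v) (p : Pearl G.word) :
    mapPearl (H := G) id h p = p := by
  rcases p with ⟨v, _ | i⟩ <;> rfl

theorem mapPearl_comp {U : Type} {K : Graph U} (σ : V → W) (τ : W → U)
    (hσ : ∀ v, H.word (σ v) = G.word v) (hτ : ∀ v, K.word (τ v) = H.word v)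
    (hc : ∀ v, K.word ((τ ∘ σ) v) = G.word v) (p : Pearl G.word) :
    mapPearl (τ ∘ σ) hc p = mapPearl τ hτ (mapPearl σ hσ p) := by
  rcases p with ⟨v, _ | i⟩ <;> rfl

end Graph

/-- A finite necklace graph with possibly a root pearl and possibly a marked necklace. -/
structure Decorated where
  size : ℕ
  graph : Graph (Fin size)
  root : Option (Pearl graph.word)
  mark : Option (Fin size)

namespace Decorated

/-- Two decorated necklace graphs are isomorphic if a bijection between their necklaces preserves
the words, the edges between pearls, the root pearl and the marked necklace. -/
def Iso (A B : Decorated) : Prop :=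
  ∃ (σ : Fin A.size ≃ Fin B.size) (hσ : ∀ v, B.graph.word (σ v) = A.graph.word v),
    (∀ p, Graph.mapPearl σ hσ (A.graph.mate p) = B.graph.mate (Graph.mapPearl σ hσ p)) ∧
    A.root.map (Graph.mapPearl σ hσ) = B.root ∧
    A.mark.map σ = B.mark

theorem Iso.refl (A : Decorated) : A.Iso A := by
  have h : Graph.mapPearl (G := A.graph) (H := A.graph) id (fun _ => rfl) = id :=
    funext (Graph.mapPearl_id _)
  refine ⟨Equiv.refl _, fun _ => rfl, fun p => ?_, ?_, ?_⟩
  · exact (congrFun h _).trans (congrArg A.graph.mate (congrFun h p).symm)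
  · exact (congrArg (fun f => A.root.map f) h).trans (Option.map_id_fun' ▸ rfl)
  · exact congrFun Option.map_id A.mark

theorem Iso.symm {A B : Decorated} (h : A.Iso B) : B.Iso A := by
  obtain ⟨σ, hσ, hm, hr, hk⟩ := h
  have hτ : ∀ v, A.graph.word (σ.symm v) = B.graph.word v := fun v => by
    rw [← hσ, Equiv.apply_symm_apply]
  have h1 : ∀ p, Graph.mapPearl σ.symm hτ (Graph.mapPearl σ hσ p) = p := fun p => by
    have e : (σ.symm ∘ σ : Fin A.size → Fin A.size) = id := by ext; simp
    have hc : ∀ v, A.graph.word ((σ.symm ∘ σ) v) = A.graph.word v := fun v => by simp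
    rw [← Graph.mapPearl_comp σ σ.symm hσ hτ hc]
    generalize (σ.symm ∘ σ : Fin A.size → Fin A.size) = f at e hc
    subst e
    exact Graph.mapPearl_id _ p
  have h2 : ∀ p, Graph.mapPearl σ hσ (Graph.mapPearl σ.symm hτ p) = p := fun p => by
    have e : (σ ∘ σ.symm : Fin B.size → Fin B.size) = id := by ext; simp
    have hc : ∀ v, B.graph.word ((σ ∘ σ.symm) v) = B.graph.word v := fun v => by simp
    rw [← Graph.mapPearl_comp σ.symm σ hτ hσ hc]
    generalize (σ ∘ σ.symm : Fin B.size → Fin B.size) = f at e hc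
    subst e
    exact Graph.mapPearl_id _ p
  refine ⟨σ.symm, hτ, fun p => ?_, ?_, ?_⟩
  · rw [← h1 (A.graph.mate _), hm, h2]
  · rw [← hr, Option.map_map]
    have : Graph.mapPearl σ.symm hτ ∘ Graph.mapPearl σ hσ = id := funext h1
    rw [this, Option.map_id, id]
  · rw [← hk, Option.map_map]
    simp

theorem Iso.trans {A B C : Decorated} (h : A.Iso B) (h' : B.Iso C) : A.Iso C := by
  obtain ⟨σ, hσ, hm, hr, hk⟩ := h
  obtain ⟨τ, hτ, hm', hr', hk'⟩ := h'
  have hc : ∀ v, C.graph.word ((τ ∘ σ) v) = A.graph.word v := fun v => by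
    rw [Function.comp, hτ, hσ]
  have key : ∀ p, Graph.mapPearl (τ ∘ σ) hc p =
      Graph.mapPearl τ hτ (Graph.mapPearl σ hσ p) :=
    Graph.mapPearl_comp σ τ hσ hτ hc
  refine ⟨σ.trans τ, hc, fun p => ?_, ?_, ?_⟩
  · exact (key _).trans (((congrArg _ (hm p)).trans (hm' _)).trans
      (congrArg _ (key p).symm))
  · rw [← hr', ← hr, Option.map_map]
    exact congrArg (fun f => A.root.map f) (funext key)
  · rw [← hk', ← hk, Option.map_map]
    rfl

instance setoid : Setoid Decorated where
  r := Iso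
  iseqv := ⟨Iso.refl, Iso.symm, Iso.trans⟩

/-- The multiset of the necklaces of a decorated necklace graph. -/
def necklaces (A : Decorated) : Multiset (List Letter) :=
  Finset.univ.val.map A.graph.word

/-- The type of the marked necklace, if there is one. -/
def markedNecklace (A : Decorated) : Option (List Letter) := A.mark.map A.graph.word

theorem Iso.size_eq {A B : Decorated} (h : A.Iso B) : A.size = B.size := by
  obtain ⟨σ, -⟩ := h
  simpa using Fintype.card_congr σ

theorem Iso.necklaces_eq {A B : Decorated} (h : A.Iso B) : A.necklaces = B.necklaces := by
  obtain ⟨σ, hσ, -⟩ := h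
  have e : A.graph.word = B.graph.word ∘ σ := funext fun v => (hσ v).symm
  rw [necklaces, necklaces, e, ← Multiset.map_map]
  congr 1
  simp

theorem Iso.markedNecklace_eq {A B : Decorated} (h : A.Iso B) :
    A.markedNecklace = B.markedNecklace := by
  obtain ⟨σ, hσ, -, -, hk⟩ := h
  have e : A.graph.word = B.graph.word ∘ σ := funext fun v => (hσ v).symm
  rw [markedNecklace, markedNecklace, ← hk, Option.map_map, e]

end Decorated

/-- The isomorphism classes of the decorated necklace graphs that satisfy `P`. -/
def IsoClass (P : Decorated → Prop) : Type :=
  Quotient (Decorated.setoid.comap (Subtype.val : {A : Decorated // P A} → Decorated))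

namespace IsoClass

variable {P : Decorated → Prop}

/-- The number of necklaces. -/
def size (c : IsoClass P) : ℕ :=
  Quotient.lift (fun A : {A : Decorated // P A} => A.1.size)
    (fun _ _ h => Decorated.Iso.size_eq h) c

/-- The multiset of necklaces. -/
def necklaces (c : IsoClass P) : Multiset (List Letter) :=
  Quotient.lift (fun A : {A : Decorated // P A} => A.1.necklaces)
    (fun _ _ h => Decorated.Iso.necklaces_eq h) c

/-- The type of the marked necklace, if there is one. -/
def markedNecklace (c : IsoClass P) : Option (List Letter) :=
  Quotient.lift (fun A : {A : Decorated // P A} => A.1.markedNecklace)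
    (fun _ _ h => Decorated.Iso.markedNecklace_eq h) c

/-- The generating function by the number of necklaces. -/
noncomputable def gf (P : Decorated → Prop) : PowerSeries ℤ :=
  PowerSeries.mk fun n => (Nat.card {c : IsoClass P // c.size = n} : ℤ)

end IsoClass

/-- Non-negative `Q`-trees with excess `0`. -/
def IsF0 (Q : Set (List Letter)) (A : Decorated) : Prop :=
  A.mark = none ∧ ∃ r, A.root = some r ∧ A.graph.IsNonnegQTree Q r ∧ A.graph.excess r r = 0

/-- Non-negative `Q`-trees with excess `0` and with a marked necklace. -/
def IsMarkedF0 (Q : Set (List Letter)) (A : Decorated) : Prop :=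
  A.mark ≠ none ∧ ∃ r, A.root = some r ∧ A.graph.IsNonnegQTree Q r ∧ A.graph.excess r r = 0

/-- Rooted `Q`-companion trees without defects, with a root pearl of kind `x`. -/
def IsC (Q : Set (List Letter)) (x : Kind) (A : Decorated) : Prop :=
  A.mark = none ∧ (∀ p, ¬ A.graph.IsDefect A.root p) ∧
    ∃ r, A.root = some r ∧ A.graph.kind r = x ∧ A.graph.IsRootedCompanion Q r

/-- Unrooted `Q`-companion trees without defects and with a marked necklace. -/
def IsMarkedC (Q : Set (List Letter)) (A : Decorated) : Prop :=
  A.mark ≠ none ∧ A.root = none ∧ (∀ p, ¬ A.graph.IsDefect none p) ∧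
    A.graph.IsUnrootedCompanion Q

/-- The class of rooted `Q`-companion trees without defects whose root has kind `x`. -/
abbrev C (Q : Set (List Letter)) (x : Kind) : Type := IsoClass (IsC Q x)

/-- The kind of pearl to which a pearl is attached by an edge `●–□`, `♦–▲` or `▲–♦`. -/
def Letter.partner : Letter → Kind
  | .bullet => none
  | .diamond => some .triangle
  | .triangle => some .diamond

/-- The class `Q(●–C_□, ♦–C_▲, ▲–C_♦)`: a necklace `s` of `Q`, together with a tree of `C_□`
attached to each `●`-pearl of `s`, a tree of `C_▲` attached to each `♦`-pearl, and a tree of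
`C_♦` attached to each `▲`-pearl. -/
def Attached (Q : Set (List Letter)) : Type :=
  Σ s : Q, ∀ i : Fin s.1.length, C Q (s.1.get i).partner

/-- The class `(□ + □–C_●) × Q(●–C_□, ♦–C_▲, ▲–C_♦)`, where `none` is the bare `□`-pearl and
`some τ` is a `□`-pearl that carries the tree `τ`. -/
abbrev Pairs (Q : Set (List Letter)) : Type := Option (C Q (some .bullet)) × Attached Q

/-- The multiset of all the necklaces of an element of `Pairs Q`: those of the tree carried by
the `□`-pearl, the necklace `s`, and those of the trees attached to the letters of `s`. -/
def Pairs.necklaces {Q : Set (List Letter)} (x : Pairs Q) : Multiset (List Letter) :=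
  x.1.elim 0 IsoClass.necklaces + (x.2.1.1 ::ₘ ∑ i, (x.2.2 i).necklaces)

/-- The generating function `Q(v, w, u) = ∑_{s ∈ Q} v^{|s|_●} w^{|s|_♦} u^{|s|_▲}`, the
variables `v, w, u` being indexed by the letters `●, ♦, ▲`. -/
noncomputable def vertexGF (Q : Set (List Letter)) : MvPowerSeries Letter ℤ :=
  fun m => (Nat.card {s : Q // ∀ x, s.1.count x = m x} : ℤ)

/-- The series `(v, w, u) = (C_□, C_▲, C_♦)`. -/
noncomputable def companionSeries (Q : Set (List Letter)) (x : Letter) : PowerSeries ℤ :=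
  IsoClass.gf (IsC Q x.partner)

end Necklace

/-!
Isomorphism classes of plane trees of necklaces correspond to the elements of a recursive type
`Tree`, so both bijections reduce to an equality of finite cardinalities: for each multiset `M` of
necklaces and each necklace `s`, the marked trees of both kinds with multiset `M` and marked
necklace `s` are equinumerous.

To count them, give each necklace `s` its own variable `x_s`, truncated so that the `x_s` generate
a nilpotent ideal, and write `Q(v, w, u) = ∑_s x_s v^{|s|_●} w^{|s|_♦} u^{|s|_▲}`. The non-negative
`Q`-trees, with the excess recorded by `u`, satisfy the catalytic equation
`F(u) = Q(F(u), (F(u) - F(0)) / u, u)`. Without defects, the companion trees satisfy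
`C_□ = Q(V, W, U)`, `1 + C_● = P`, `C_♦ = P · ∂_w Q(V, W, U)` and `C_▲ = P · ∂_u Q(V, W, U)`, where
`V = C_□`, `W = C_▲`, `U = C_♦` and `P = 1 + P · ∂_v Q(V, W, U)`. The kernel method identifies the
two sets of equations: at the unique `u = U` where the kernel of the catalytic equation vanishes,
`F(U)` and `(F(U) - F(0)) / U` solve the companion system, whose solution is unique. Applying a
derivation `D` of the coefficients to the catalytic equation at `U`, where the unknown `D F`
cancels, gives `D (F(0)) = P · (D Q)(V, W, U)`. For `D = x_s ∂/∂x_s` the two sides count the trees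
of excess `0` with a marked copy of `s` and the companion trees with marked necklace `s`.
-/

/-! ### The kernel method -/

instance Necklace.Letter.instFintype : Fintype Necklace.Letter where
  elems := {.bullet, .diamond, .triangle}
  complete z := by cases z <;> decide

theorem Necklace.Letter.sum_univ {M : Type*} [AddCommMonoid M] (g : Letter → M) :
    ∑ z, g z = g .bullet + g .diamond + g .triangle := by
  change ∑ z ∈ {.bullet, .diamond, .triangle}, g z = _
  rw [Finset.sum_insert (by decide), Finset.sum_pair (by decide), add_assoc]

namespace KernelMethod

open Necklace (Letter)

section Contraction

open MvPolynomial

variable {σ R : Type*} [CommRing R] {I : Ideal R} {q : MvPolynomial σ R}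

theorem eval_sub_eval_mem_mul (hq : q ∈ I.map C) {J : Ideal R} {y z : σ → R}
    (hyz : ∀ i, y i - z i ∈ J) : eval y q - eval z q ∈ I * J := by
  have mk_eq : ∀ i, Ideal.Quotient.mk J (y i) = Ideal.Quotient.mk J (z i) :=
    fun i => Ideal.Quotient.eq.2 (hyz i)
  simp only [eval_eq, ← Finset.sum_sub_distrib, ← mul_sub]
  refine Ideal.sum_mem _ fun m _ => Ideal.mul_mem_mul (mem_map_C_iff.1 hq m) ?_
  rw [← Ideal.Quotient.eq]
  simp only [map_prod, map_pow, mk_eq]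

theorem eval_mem_of_mem_map_C (hq : q ∈ I.map C) (y : σ → R) : eval y q ∈ I := by
  rw [eval_eq]
  exact Ideal.sum_mem _ fun m _ => Ideal.mul_mem_right _ _ (mem_map_C_iff.1 hq m)

theorem pderiv_mem_map_C (hq : q ∈ I.map C) (i : σ) : pderiv i q ∈ I.map C := by
  refine mem_map_C_iff.2 fun m => ?_
  rw [coeff_pderiv]
  exact Ideal.mul_mem_right _ _ (mem_map_C_iff.1 hq _)

theorem exists_eval_eq_self {p : Polynomial R} (hI : IsNilpotent I)
    (hp : p ∈ I.map Polynomial.C) : ∃ u, p.eval u = u := by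
  obtain ⟨N, hN⟩ := hI
  have contract : ∀ n y z, y - z ∈ I ^ n → p.eval y - p.eval z ∈ I ^ (n + 1) := by
    intro n y z hyz
    simp only [Polynomial.eval_eq_sum_range, ← Finset.sum_sub_distrib, ← mul_sub, pow_succ' I]
    refine Ideal.sum_mem _ fun i _ => Ideal.mul_mem_mul (Ideal.mem_map_C_iff.1 hp i) ?_
    exact Ideal.mem_of_dvd _ (sub_dvd_pow_sub_pow y z i) hyz
  have approx : ∀ n, p.eval ((p.eval ·)^[n] 0) - (p.eval ·)^[n] 0 ∈ I ^ n := by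
    intro n
    induction n with
    | zero => simp
    | succ n ih => simpa only [Function.iterate_succ_apply'] using contract n _ _ ih
  exact ⟨_, sub_eq_zero.1 (by simpa only [hN, Ideal.zero_eq_bot, Ideal.mem_bot] using approx N)⟩

end Contraction

section ChainRule

open MvPolynomial

variable {σ k R : Type*} [CommRing k] [CommRing R] [Algebra k R]

/-- The derivation `D` applied to each coefficient of a polynomial in several variables. -/
noncomputable def coeffwise (D : Derivation k R R) (q : MvPolynomial σ R) : MvPolynomial σ R :=
  AddMonoidAlgebra.map (D : R →+ R) q

variable (D : Derivation k R R)

@[simp]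
theorem coeff_coeffwise (q : MvPolynomial σ R) (m : σ →₀ ℕ) :
    coeff m (coeffwise D q) = D (coeff m q) := rfl

theorem coeffwise_add (p q : MvPolynomial σ R) :
    coeffwise D (p + q) = coeffwise D p + coeffwise D q := by
  ext m; simp

theorem coeffwise_sum {ι : Type*} (S : Finset ι) (q : ι → MvPolynomial σ R) :
    coeffwise D (∑ s ∈ S, q s) = ∑ s ∈ S, coeffwise D (q s) := by
  ext m; simp [coeff_sum]

theorem coeffwise_C (a : R) : coeffwise D (C a : MvPolynomial σ R) = C (D a) := by
  classical
  ext m; simp [coeff_C, apply_ite D]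

theorem coeffwise_mul_X (q : MvPolynomial σ R) (i : σ) :
    coeffwise D (q * X i) = coeffwise D q * X i := by
  classical
  ext m; simp [coeff_mul_X', apply_ite D]

theorem coeffwise_mul_prod_X {κ : Type*} (q : MvPolynomial σ R) (T : Finset κ) (l : κ → σ) :
    coeffwise D (q * ∏ i ∈ T, X (l i)) = coeffwise D q * ∏ i ∈ T, X (l i) := by
  classical
  induction T using Finset.induction_on with
  | empty => simp
  | insert i T hi ih =>
    rw [Finset.prod_insert hi, mul_comm (X (l i)), ← mul_assoc, coeffwise_mul_X, ih, mul_assoc]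

theorem derivation_eval [Fintype σ] (q : MvPolynomial σ R) (y : σ → R) :
    D (eval y q) = eval y (coeffwise D q) + ∑ i, eval y (pderiv i q) * D (y i) := by
  classical
  induction q using MvPolynomial.induction_on with
  | C a => simp [coeffwise_C]
  | add p q hp hq =>
    simp only [map_add, hp, hq, coeffwise_add, add_mul, Finset.sum_add_distrib]
    ring
  | mul_X p j hp =>
    have pderiv_term : ∀ i, eval y (pderiv i (p * X j)) * D (y i) =
        y j * (eval y (pderiv i p) * D (y i)) + if i = j then eval y p * D (y i) else 0 := by
      intro i
      rcases eq_or_ne i j with rfl | hij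
      · simp [Derivation.leibniz]; ring
      · simp [Derivation.leibniz, hij.symm, hij, pderiv_X]; ring
    rw [Finset.sum_congr rfl fun i _ => pderiv_term i, Finset.sum_add_distrib, ← Finset.mul_sum,
      Finset.sum_ite_eq' Finset.univ, if_pos (Finset.mem_univ j), coeffwise_mul_X, map_mul, eval_X,
      D.leibniz, hp, map_mul, eval_X, smul_eq_mul, smul_eq_mul]
    ring

/-- The derivation `D` applied to each coefficient of a polynomial in one variable. -/
noncomputable def coeffDerivation : Derivation k (Polynomial R) (Polynomial R) :=
  (PolynomialModule.equivPolynomialSelf (R := R)).toLinearMap.compDer D.mapCoeffs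

@[simp]
theorem coeff_coeffDerivation (p : Polynomial R) (n : ℕ) :
    (coeffDerivation D p).coeff n = D (p.coeff n) := rfl

theorem coeffDerivation_C (a : R) :
    coeffDerivation D (Polynomial.C a) = Polynomial.C (D a) := by
  ext n; simp [Polynomial.coeff_C, apply_ite D]

theorem coeffDerivation_X : coeffDerivation D Polynomial.X = 0 := by
  ext n; simp [Polynomial.coeff_X, apply_ite D]

theorem coeffwise_coeffDerivation_map_C (q : MvPolynomial σ R) :
    coeffwise (coeffDerivation D) (map Polynomial.C q) = map Polynomial.C (coeffwise D q) := by
  ext m : 1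
  rw [coeff_coeffwise, coeff_map, coeffDerivation_C, coeff_map, coeff_coeffwise]

theorem coeffwise_derivative_map_C (q : MvPolynomial σ R) :
    coeffwise Polynomial.derivative' (map Polynomial.C q) = 0 := by
  ext m : 1
  simp only [coeff_coeffwise, coeff_map, Polynomial.derivative'_apply, Polynomial.derivative_C,
    coeff_zero]

end ChainRule

section CompanionSystem

open MvPolynomial

variable {R : Type*} [CommRing R] {I : Ideal R} {q : MvPolynomial Letter R}

/-- The equations between the generating functions of companion trees whose necklaces are counted
by `q`: here `P = 1 + C_●` and `y ● = C_□`, `y ♦ = C_▲`, `y ▲ = C_♦`, the series of the trees that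
may be attached to a letter. -/
structure IsCompanionSystem (q : MvPolynomial Letter R) (P : R) (y : Letter → R) : Prop where
  eq_P : P = 1 + P * eval y (pderiv .bullet q)
  eq_bullet : y .bullet = eval y q
  eq_diamond : y .diamond = P * eval y (pderiv .triangle q)
  eq_triangle : y .triangle = P * eval y (pderiv .diamond q)

theorem IsCompanionSystem.unique (hI : IsNilpotent I) (hq : q ∈ I.map C) {P P' : R}
    {y y' : Letter → R} (h : IsCompanionSystem q P y) (h' : IsCompanionSystem q P' y') :
    P = P' ∧ y = y' := by
  obtain ⟨N, hN⟩ := hI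
  have approx : ∀ n, P - P' ∈ I ^ n ∧ ∀ z, y z - y' z ∈ I ^ n := by
    intro n
    induction n with
    | zero => simp
    | succ n ih =>
      obtain ⟨hP, hy⟩ := ih
      have mul_pderiv : ∀ z,
          P * eval y (pderiv z q) - P' * eval y' (pderiv z q) ∈ I ^ (n + 1) := by
        intro z
        rw [show P * eval y (pderiv z q) - P' * eval y' (pderiv z q) =
          P * (eval y (pderiv z q) - eval y' (pderiv z q)) +
            (P - P') * eval y' (pderiv z q) by ring]
        exact Ideal.add_mem _
          (Ideal.mul_mem_left _ _ (pow_succ' I n ▸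
            eval_sub_eval_mem_mul (pderiv_mem_map_C hq z) hy))
          (pow_succ I n ▸ Ideal.mul_mem_mul hP
            (eval_mem_of_mem_map_C (pderiv_mem_map_C hq z) y'))
      refine ⟨?_, fun z => ?_⟩
      · rw [h.eq_P, h'.eq_P, add_sub_add_left_eq_sub]
        exact mul_pderiv .bullet
      · cases z with
        | bullet =>
          rw [h.eq_bullet, h'.eq_bullet, pow_succ']
          exact eval_sub_eval_mem_mul hq hy
        | diamond => simpa only [h.eq_diamond, h'.eq_diamond] using mul_pderiv .triangle
        | triangle => simpa only [h.eq_triangle, h'.eq_triangle] using mul_pderiv .diamond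
  have limit := approx N
  simp only [hN, Ideal.zero_eq_bot, Ideal.mem_bot, sub_eq_zero] at limit
  exact ⟨limit.1, funext limit.2⟩

end CompanionSystem

section Kernel

open MvPolynomial

variable {k R : Type*} [CommRing k] [CommRing R] [Algebra k R] {I : Ideal R}
  {q : MvPolynomial Letter R}

/-- The arguments `F(u)`, `(F(u) - F(0)) / u` and `u` that the letters of a necklace contribute to
the catalytic equation of non-negative trees. -/
noncomputable def catalyticPoint (F : Polynomial R) : Letter → Polynomial R
  | .bullet => F
  | .diamond => F.divX
  | .triangle => Polynomial.X

/-- The catalytic equation `F(u) = q(F(u), (F(u) - F(0)) / u, u)`. -/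
def IsCatalyticSolution (q : MvPolynomial Letter R) (F : Polynomial R) : Prop :=
  F = eval (catalyticPoint F) (map Polynomial.C q)

theorem eval_eval_map_C {σ : Type*} (u : R) (y : σ → Polynomial R) (q : MvPolynomial σ R) :
    (eval y (map Polynomial.C q)).eval u = eval (fun i => (y i).eval u) q := by
  induction q using MvPolynomial.induction_on with
  | C a => simp
  | add p q hp hq => simp only [map_add, Polynomial.eval_add, hp, hq]
  | mul_X p i hp => simp only [map_mul, map_X, eval_X, Polynomial.eval_mul, hp]

variable {F : Polynomial R} {u P : R} {y : Letter → R}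

/-- The value of `u` that cancels the kernel `u - q_w(F, ΔF, u) - u q_v(F, ΔF, u)`. -/
theorem exists_kernel_root (hI : IsNilpotent I) (hq : q ∈ I.map C) (F : Polynomial R) :
    ∃ u, eval (fun z => (catalyticPoint F z).eval u) (pderiv .diamond q) +
      u * eval (fun z => (catalyticPoint F z).eval u) (pderiv .bullet q) = u := by
  have mem : ∀ z, eval (catalyticPoint F) (map Polynomial.C (pderiv z q)) ∈
      I.map Polynomial.C := by
    refine fun z => eval_mem_of_mem_map_C (mem_map_C_iff.2 fun m => ?_) _
    rw [coeff_map]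
    exact Ideal.mem_map_of_mem _ (mem_map_C_iff.1 (pderiv_mem_map_C hq z) m)
  obtain ⟨u, hu⟩ := exists_eval_eq_self hI
    (Ideal.add_mem _ (mem .diamond) (Ideal.mul_mem_left _ Polynomial.X (mem .bullet)))
  rw [Polynomial.eval_add, Polynomial.eval_mul, Polynomial.eval_X, eval_eval_map_C,
    eval_eval_map_C] at hu
  exact ⟨u, hu⟩

theorem eval_derivation_divX (Δ : Derivation k (Polynomial R) (Polynomial R)) (F : Polynomial R)
    (u : R) : (Δ F).eval u = u * (Δ F.divX).eval u + F.divX.eval u * (Δ Polynomial.X).eval u +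
      (Δ (Polynomial.C (F.coeff 0))).eval u := by
  conv_lhs => rw [← Polynomial.divX_mul_X_add F]
  simp only [map_add, Derivation.leibniz, smul_eq_mul, Polynomial.eval_add, Polynomial.eval_mul,
    Polynomial.eval_X]
  ring

/-- Applying a derivation to the catalytic equation, the unknown derivative of `F` is multiplied by
the kernel, which vanishes at `u`. -/
theorem eval_derivation_of_kernel (hF : IsCatalyticSolution q F)
    (hy : ∀ z, (catalyticPoint F z).eval u = y z)
    (hP : P = 1 + P * eval y (pderiv .bullet q)) (hu : u = P * eval y (pderiv .diamond q))
    (Δ : Derivation k (Polynomial R) (Polynomial R)) :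
    (Δ F).eval u = P * (eval (catalyticPoint F) (coeffwise Δ (map Polynomial.C q))).eval u +
      u * (Δ F.divX).eval u + P * eval y (pderiv .triangle q) * (Δ Polynomial.X).eval u := by
  have chain : (Δ F).eval u = _ :=
    congrArg (Polynomial.eval u) ((congrArg Δ hF).trans (derivation_eval Δ _ _))
  simp only [Letter.sum_univ, pderiv_map, Polynomial.eval_add, Polynomial.eval_mul,
    eval_eval_map_C, hy] at chain
  simp only [catalyticPoint] at chain ⊢
  linear_combination P * chain - (Δ F).eval u * hP - (Δ F.divX).eval u * hu

theorem isCompanionSystem_of_kernel (hF : IsCatalyticSolution q F)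
    (hy : ∀ z, (catalyticPoint F z).eval u = y z)
    (hP : P = 1 + P * eval y (pderiv .bullet q)) (hu : u = P * eval y (pderiv .diamond q)) :
    IsCompanionSystem q P y where
  eq_P := hP
  eq_bullet := by
    rw [← funext hy, ← eval_eval_map_C, ← hF]
    rfl
  eq_diamond := by
    have kernel := eval_derivation_of_kernel hF hy hP hu Polynomial.derivative'
    rw [eval_derivation_divX, coeffwise_derivative_map_C,
      show F.divX.eval u = y .diamond from hy .diamond] at kernel
    simp only [Polynomial.derivative'_apply, Polynomial.derivative_X, Polynomial.derivative_C,
      Polynomial.eval_one, Polynomial.eval_zero, map_zero] at kernel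
    linear_combination kernel
  eq_triangle := by
    rw [← hu, ← hy .triangle]
    exact Polynomial.eval_X

theorem derivation_coeff_zero_of_kernel (hF : IsCatalyticSolution q F)
    (hy : ∀ z, (catalyticPoint F z).eval u = y z)
    (hP : P = 1 + P * eval y (pderiv .bullet q)) (hu : u = P * eval y (pderiv .diamond q))
    (D : Derivation k R R) : D (F.coeff 0) = P * eval y (coeffwise D q) := by
  have kernel := eval_derivation_of_kernel hF hy hP hu (coeffDerivation D)
  rw [eval_derivation_divX, coeffwise_coeffDerivation_map_C, eval_eval_map_C, funext hy,
    coeffDerivation_X, coeffDerivation_C, Polynomial.eval_zero, Polynomial.eval_C] at kernel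
  linear_combination kernel

theorem IsCompanionSystem.derivation_coeff_zero (hI : IsNilpotent I) (hq : q ∈ I.map C)
    (h : IsCompanionSystem q P y) (hF : IsCatalyticSolution q F) (D : Derivation k R R) :
    D (F.coeff 0) = P * eval y (coeffwise D q) := by
  obtain ⟨u, hu⟩ := exists_kernel_root hI hq F
  set y' : Letter → R := fun z => (catalyticPoint F z).eval u
  have nilpotent : IsNilpotent (eval y' (pderiv .bullet q)) := by
    obtain ⟨N, hN⟩ := hI
    refine ⟨N, ?_⟩
    simpa [hN] using Ideal.pow_mem_pow (eval_mem_of_mem_map_C (pderiv_mem_map_C hq .bullet) y') N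
  obtain ⟨P', hP'⟩ := nilpotent.isUnit_one_sub.exists_left_inv
  have eq_P : P' = 1 + P' * eval y' (pderiv .bullet q) := by linear_combination hP'
  have eq_u : u = P' * eval y' (pderiv .diamond q) := by linear_combination (-P') * hu - u * hP'
  obtain ⟨rfl, rfl⟩ := h.unique hI hq (isCompanionSystem_of_kernel hF (fun _ => rfl) eq_P eq_u)
  exact derivation_coeff_zero_of_kernel hF (fun _ => rfl) eq_P eq_u D

end Kernel

end KernelMethod

/-! ### Recursive trees of necklaces -/

namespace Necklace

namespace Graph
variable {V : Type} (G : Graph V)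

@[simp]
theorem incidence_inl_inl (v w : V) : ¬ G.incidence.Adj (.inl v) (.inl w) := by
  simp [incidence]

@[simp]
theorem incidence_inl_inr {v : V} {p : Pearl G.word} :
    G.incidence.Adj (.inl v) (.inr p) ↔ p.1 = v := by
  simp [incidence]

@[simp]
theorem incidence_inr_inl {v : V} {p : Pearl G.word} :
    G.incidence.Adj (.inr p) (.inl v) ↔ p.1 = v := by
  simp [incidence]

@[simp]
theorem incidence_inr_inr {p q : Pearl G.word} :
    G.incidence.Adj (.inr p) (.inr q) ↔ p ≠ q ∧ G.mate p = q := by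
  simp only [incidence, SimpleGraph.fromRel_adj, ne_eq, Sum.inr.injEq, and_congr_right_iff]
  refine fun _ => ⟨?_, Or.inl⟩
  rintro (h | h)
  · exact h
  · rw [← h, G.mate_mate]

end Graph

/-- The positions of the pearls on the necklace of a word, `none` being that of the `□`-pearl. -/
abbrev Pos (s : List Letter) : Type := Option (Fin s.length)

/-- The kind of the pearl at a position. -/
def posKind (s : List Letter) (q : Pos s) : Kind := q.map s.get

/-- Recursive description of a tree of necklaces. `leaf` stands for nothing attached, and
`node s p ch` for a necklace `s` with the root pearl at position `p` (no root pearl if `p = none`)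
and the tree `ch q` attached to the pearl at `q`. -/
inductive Tree : Type
  | leaf
  | node (s : List Letter) (p : Option (Pos s)) (ch : Pos s → Tree)

namespace Tree

/-- The necklaces of a tree. -/
def Vtx : Tree → Type
  | leaf => Empty
  | node s _ ch => Option (Σ q : Pos s, (ch q).Vtx)

/-- The word of a necklace of a tree. -/
def word : ∀ t : Tree, t.Vtx → List Letter
  | leaf, x => x.elim
  | node s _ _, none => s
  | node _ _ ch, some x => (ch x.1).word x.2

/-- The root pearl of a tree. -/
def root : ∀ t : Tree, Option (Pearl t.word)
  | leaf => none
  | node _ p _ => p.map fun q => ⟨none, q⟩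

/-- A pearl of the tree attached at position `q` as a pearl of the whole tree. -/
def lift {s : List Letter} {p : Option (Pos s)} {ch : Pos s → Tree} (q : Pos s)
    (y : Pearl (ch q).word) : Pearl (node s p ch).word := ⟨some ⟨q, y.1⟩, y.2⟩

/-- A pearl of the necklace at the top of a tree. -/
def top {s : List Letter} {p : Option (Pos s)} {ch : Pos s → Tree} (q : Pos s) :
    Pearl (node s p ch).word := ⟨none, q⟩

open Classical in
/-- The other endpoint of the edge at a pearl of the tree `node s p ch`, given the other endpoints
of the edges of the attached trees. -/
noncomputable def nodeMate {s : List Letter} {p : Option (Pos s)} {ch : Pos s → Tree}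
    (m : ∀ q, Pearl (ch q).word → Pearl (ch q).word) :
    Pearl (node s p ch).word → Pearl (node s p ch).word
  | ⟨none, q⟩ => (ch q).root.elim (top q) (lift q)
  | ⟨some ⟨q, v⟩, i⟩ =>
    if (ch q).root = some ⟨v, i⟩ then top q else lift q (m q ⟨v, i⟩)

/-- The other endpoint of the edge at a pearl of a tree. -/
noncomputable def mate : ∀ t : Tree, Pearl t.word → Pearl t.word
  | leaf => id
  | node _ _ ch => nodeMate fun q => (ch q).mate

/-- Well-formed trees: nothing is attached to root pearls, and everything attached has a root
pearl. -/
def WF : Tree → Prop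
  | leaf => True
  | node _ p ch => (∀ q, p = some q → ch q = leaf) ∧
      ∀ q, ch q = leaf ∨ (ch q).root ≠ none ∧ (ch q).WF

section
variable {s : List Letter} {p : Option (Pos s)} {ch : Pos s → Tree}

theorem lift_injective (q : Pos s) : Function.Injective (lift (p := p) (ch := ch) q) := by
  rintro ⟨v, i⟩ ⟨w, j⟩ h
  obtain ⟨h1, h2⟩ := Sigma.mk.inj_iff.1 h
  cases h1
  cases h2
  rfl

theorem lift_ne_top (q q' : Pos s) (y) : lift (p := p) (ch := ch) q y ≠ top q' := by
  intro h
  injection h with h1 _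
  cases h1

theorem top_inj {q q' : Pos s} : top (p := p) (ch := ch) q = top q' ↔ q = q' := by
  constructor
  · intro h
    injection h
  · rintro rfl; rfl

@[elab_as_elim]
theorem pearl_cases {P : Pearl (node s p ch).word → Prop} (top : ∀ q, P (top q))
    (lift : ∀ q y, P (lift q y)) : ∀ y, P y
  | ⟨none, q⟩ => top q
  | ⟨some ⟨q, v⟩, i⟩ => lift q ⟨v, i⟩

theorem mate_top (q : Pos s) :
    (node s p ch).mate (top q) = (ch q).root.elim (top q) (lift q) := rfl

theorem mate_top_none {q : Pos s} (h : (ch q).root = none) :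
    (node s p ch).mate (top q) = top q := by
  rw [mate_top, h]; rfl

theorem mate_top_some {q : Pos s} {y} (h : (ch q).root = some y) :
    (node s p ch).mate (top q) = lift q y := by
  rw [mate_top, h]; rfl

theorem mate_lift_root {q : Pos s} {y} (h : (ch q).root = some y) :
    (node s p ch).mate (lift q y) = top q := by
  obtain ⟨v, i⟩ := y
  exact if_pos h

theorem mate_lift {q : Pos s} {y} (h : (ch q).root ≠ some y) :
    (node s p ch).mate (lift q y) = lift q ((ch q).mate y) := by
  obtain ⟨v, i⟩ := y
  exact if_neg h

theorem WF.child (h : (node s p ch).WF) (q : Pos s) : (ch q).WF := by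
  rcases h.2 q with h | h
  · rw [h]; trivial
  · exact h.2

theorem WF.root_ne_none (h : (node s p ch).WF) (q : Pos s) (hq : ch q ≠ leaf) :
    (ch q).root ≠ none := ((h.2 q).resolve_left hq).1

theorem WF.exists_root (h : (node s p ch).WF) (q : Pos s) (v : (ch q).Vtx) :
    ∃ y, (ch q).root = some y := by
  rw [← Option.ne_none_iff_exists']
  refine h.root_ne_none q fun e => ?_
  rw [e] at v
  exact v.elim

end

theorem root_free : ∀ {t : Tree}, t.WF → ∀ {y}, t.root = some y → t.mate y = y
  | node s p ch, h, y, hy => by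
    cases p with
    | none => cases hy
    | some q =>
      cases hy
      exact mate_top_none (by rw [h.1 q rfl]; rfl)

theorem mate_ne_root {t : Tree} (h : t.WF) (hm : ∀ y, t.mate (t.mate y) = y) {y}
    (hy : t.root ≠ some y) : t.root ≠ some (t.mate y) := fun h' => by
  have := root_free h h'
  rw [hm] at this
  exact hy (by rw [h', ← this])

theorem mate_mate : ∀ {t : Tree}, t.WF → ∀ y, t.mate (t.mate y) = y
  | leaf, _, _ => rfl
  | node s p ch, h, y => by
    induction y using pearl_cases with
    | top q =>
      cases hr : (ch q).root with
      | none => rw [mate_top_none hr, mate_top_none hr]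
      | some y => rw [mate_top_some hr, mate_lift_root hr]
    | lift q y =>
      by_cases hr : (ch q).root = some y
      · rw [mate_lift_root hr, mate_top_some hr]
      · have involutive := mate_mate (h.child q)
        rw [mate_lift hr, mate_lift (mate_ne_root (h.child q) involutive hr), involutive]

/-- The necklace graph of a tree. -/
noncomputable abbrev graph (t : Tree) (h : t.WF) : Graph t.Vtx where
  word := t.word
  mate := t.mate
  mate_mate := mate_mate h

instance finite_vtx : ∀ t : Tree, Finite t.Vtx
  | leaf => inferInstanceAs (Finite Empty)
  | node s _ ch =>
    have := fun q => finite_vtx (ch q)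
    inferInstanceAs (Finite (Option (Σ q : Pos s, (ch q).Vtx)))

/-- The multiset of the necklaces of a tree. -/
def necklaces : Tree → Multiset (List Letter)
  | leaf => 0
  | node s _ ch => s ::ₘ ∑ q, (ch q).necklaces

section
variable {s : List Letter} {p : Option (Pos s)} {ch : Pos s → Tree}

/-- The inclusion of the incidence graph of an attached tree. -/
def liftHom (h : (node s p ch).WF) (q : Pos s) :
    ((ch q).graph (h.child q)).incidence →g ((node s p ch).graph h).incidence where
  toFun := Sum.map (fun v => some ⟨q, v⟩) (lift q)
  map_rel' := by
    rintro (v | y) (w | z) hyz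
    · exact absurd hyz (Graph.incidence_inl_inl _ _ _)
    · rw [Graph.incidence_inl_inr] at hyz
      exact (Graph.incidence_inl_inr _).2 (by rw [← hyz]; rfl)
    · rw [Graph.incidence_inr_inl] at hyz
      exact (Graph.incidence_inr_inl _).2 (by rw [← hyz]; rfl)
    · rw [Graph.incidence_inr_inr] at hyz
      refine (Graph.incidence_inr_inr _).2 ⟨fun e => hyz.1 (lift_injective q e), ?_⟩
      have hr : (ch q).root ≠ some y := fun hr => hyz.1 (by
        rw [← hyz.2]; exact (root_free (h.child q) hr).symm)
      exact (mate_lift hr).trans (congrArg _ hyz.2)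

theorem adj_top (h : (node s p ch).WF) (q : Pos s) :
    ((node s p ch).graph h).incidence.Adj (.inl none) (.inr (top q)) :=
  (Graph.incidence_inl_inr _).2 rfl

theorem adj_top_lift (h : (node s p ch).WF) {q : Pos s} {y} (hy : (ch q).root = some y) :
    ((node s p ch).graph h).incidence.Adj (.inr (top q)) (.inr (lift q y)) :=
  (Graph.incidence_inr_inr _).2 ⟨(lift_ne_top _ _ _).symm, mate_top_some hy⟩

@[elab_as_elim]
theorem node_cases {P : (node s p ch).Vtx ⊕ Pearl (node s p ch).word → Prop}
    (necklace : P (.inl none)) (top : ∀ q, P (.inr (top q)))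
    (lift : ∀ q x, P (Sum.map (fun v => some ⟨q, v⟩) (lift q) x)) : ∀ x, P x
  | .inl none => necklace
  | .inl (some ⟨q, v⟩) => lift q (.inl v)
  | .inr ⟨none, q⟩ => top q
  | .inr ⟨some ⟨q, v⟩, i⟩ => lift q (.inr ⟨v, i⟩)

theorem adj_cases (h : (node s p ch).WF)
    {P : (node s p ch).Vtx ⊕ Pearl (node s p ch).word →
      (node s p ch).Vtx ⊕ Pearl (node s p ch).word → Prop}
    (symm : ∀ x y, P x y → P y x)
    (top : ∀ q, P (.inl none) (.inr (top q)))
    (attach : ∀ q y, (ch q).root = some y → P (.inr (Tree.top q)) (.inr (lift q y)))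
    (lift : ∀ q x y, ((ch q).graph (h.child q)).incidence.Adj x y →
      P (liftHom h q x) (liftHom h q y)) :
    ∀ x y, ((node s p ch).graph h).incidence.Adj x y → P x y := by
  have necklace_pearl : ∀ v (y : Pearl (node s p ch).word), y.1 = v → P (.inl v) (.inr y) := by
    rintro _ y rfl
    induction y using pearl_cases with
    | top q => exact top q
    | lift q y => exact lift q (.inl y.1) (.inr y) ((Graph.incidence_inl_inr _).2 rfl)
  rintro (v | y) (w | z) hyz
  · exact absurd hyz (Graph.incidence_inl_inl _ _ _)
  · exact necklace_pearl _ _ ((Graph.incidence_inl_inr _).1 hyz)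
  · exact symm _ _ (necklace_pearl _ _ ((Graph.incidence_inr_inl _).1 hyz))
  · obtain ⟨hne, rfl : (node s p ch).mate y = z⟩ := (Graph.incidence_inr_inr _).1 hyz
    induction y using pearl_cases with
    | top q =>
      cases hr : (ch q).root with
      | none => exact absurd (mate_top_none hr).symm hne
      | some y => exact mate_top_some hr ▸ attach q y hr
    | lift q y =>
      by_cases hr : (ch q).root = some y
      · exact mate_lift_root hr ▸ symm _ _ (attach q y hr)
      · refine mate_lift hr ▸ lift q (.inr y) (.inr ((ch q).mate y)) ?_
        exact (Graph.incidence_inr_inr _).2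
          ⟨fun e => hne ((congrArg _ e).trans (mate_lift hr).symm), rfl⟩

end

theorem preconnected : ∀ {t : Tree} (h : t.WF), (t.graph h).incidence.Preconnected
  | leaf, _ => fun x => x.elim (fun v => v.elim) fun y => y.1.elim
  | node s p ch, h => by
    have reachable : ∀ x, ((node s p ch).graph h).incidence.Reachable (.inl none) x := by
      intro x
      induction x using node_cases with
      | necklace => rfl
      | top q => exact (adj_top h q).reachable
      | lift q x =>
        obtain ⟨y, hy⟩ := h.exists_root q (x.elim id fun y => y.1)
        refine ((adj_top h q).reachable.trans (adj_top_lift h hy).reachable).trans ?_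
        exact (preconnected (h.child q) (.inr y) x).map (liftHom h q)
    exact fun x y => (reachable x).symm.trans (reachable y)

/-- The node of the incidence graph from which the tree grows: the root pearl, or the necklace at
the top if there is no root pearl. -/
def rootNode : ∀ t : Tree, Option (t.Vtx ⊕ Pearl t.word)
  | leaf => none
  | node _ p _ => some (p.elim (.inl none) fun q => .inr (top q))

theorem rootNode_eq {t : Tree} {y} (h : t.root = some y) : t.rootNode = some (.inr y) := by
  cases t with
  | leaf => cases h
  | node s p ch =>
    cases p with
    | none => cases h
    | some q => cases h; rfl

theorem rootNode_ne_lift {s : List Letter} {p : Option (Pos s)} {ch : Pos s → Tree} (q : Pos s)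
    (x : (ch q).Vtx ⊕ Pearl (ch q).word) :
    (node s p ch).rootNode ≠ some (Sum.map (fun v => some ⟨q, v⟩) (lift q) x) := by
  intro e
  have e := Option.some.inj e
  rcases p with _ | q' <;> rcases x with v | y
  · cases Sum.inl.inj e
  · cases e
  · cases e
  · exact lift_ne_top _ _ _ (Sum.inr.inj e).symm

open Classical in
/-- The edge of the incidence graph that leads from a node other than the root towards the root. -/
noncomputable def edgeToRoot :
    ∀ t : Tree, t.Vtx ⊕ Pearl t.word → Sym2 (t.Vtx ⊕ Pearl t.word)
  | leaf, x => s(x, x)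
  | node _ p _, .inl none => s(.inl none, p.elim (.inl none) fun q => .inr (top q))
  | node _ _ _, .inr ⟨none, q⟩ => s(.inl none, .inr (top q))
  | node _ _ ch, .inl (some ⟨q, v⟩) =>
    ((ch q).edgeToRoot (.inl v)).map (Sum.map (fun v => some ⟨q, v⟩) (lift q))
  | node _ _ ch, .inr ⟨some ⟨q, v⟩, i⟩ =>
    if (ch q).root = some ⟨v, i⟩ then s(.inr (top q), .inr (lift q ⟨v, i⟩))
    else ((ch q).edgeToRoot (.inr ⟨v, i⟩)).map (Sum.map (fun v => some ⟨q, v⟩) (lift q))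

theorem exists_edgeToRoot_eq : ∀ {t : Tree} (h : t.WF) (x y : t.Vtx ⊕ Pearl t.word),
    (t.graph h).incidence.Adj x y → ∃ z, t.rootNode ≠ some z ∧ t.edgeToRoot z = s(x, y)
  | leaf, _ => fun x => x.elim (fun v => v.elim) fun y => y.1.elim
  | node s p ch, h => by
    refine adj_cases h (fun x y hxy => by rwa [Sym2.eq_swap]) (fun q => ?_) ?_ ?_
    · by_cases hp : p = some q
      · subst hp
        exact ⟨.inl none, nofun, rfl⟩
      · refine ⟨.inr (top q), fun e => hp ?_, rfl⟩
        rcases p with _ | q'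
        · cases Option.some.inj e
        · exact congrArg some (top_inj.1 (Sum.inr.inj (Option.some.inj e)))
    · exact fun q y hy => ⟨.inr (lift q y), rootNode_ne_lift q (.inr y), if_pos hy⟩
    · intro q x y hxy
      obtain ⟨z, hz, e⟩ := exists_edgeToRoot_eq (h.child q) x y hxy
      refine ⟨liftHom h q z, rootNode_ne_lift q z, ?_⟩
      rcases z with v | z
      · exact congrArg _ e
      · exact (if_neg fun hr => hz (rootNode_eq hr)).trans (congrArg _ e)

theorem isTree {s : List Letter} {p : Option (Pos s)} {ch : Pos s → Tree} (h : (node s p ch).WF) :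
    ((node s p ch).graph h).incidence.IsTree := by
  have : Nonempty ((node s p ch).Vtx ⊕ Pearl (node s p ch).word) := ⟨.inl none⟩
  have connected : ((node s p ch).graph h).incidence.Connected := ⟨preconnected h⟩
  rw [SimpleGraph.isTree_iff_connected_and_card]
  refine ⟨connected, le_antisymm ?_ connected.card_vert_le_card_edgeSet_add_one⟩
  set r := p.elim (Sum.inl none) fun q => Sum.inr (top (p := p) (ch := ch) q)
  have edgeSet_subset : ((node s p ch).graph h).incidence.edgeSet ⊆
      (node s p ch).edgeToRoot '' {r}ᶜ := by
    intro e
    induction e with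
    | h x y =>
      intro hxy
      obtain ⟨z, hz, e⟩ := exists_edgeToRoot_eq h x y hxy
      exact ⟨z, fun hzr => hz (by rw [hzr]; rfl), e⟩
  have card_edgeSet_le := (Set.ncard_le_ncard edgeSet_subset (Set.toFinite _)).trans
    (Set.ncard_image_le (Set.toFinite {r}ᶜ))
  have card_compl := Set.ncard_add_ncard_compl {r}
  rw [Set.ncard_singleton] at card_compl
  rw [← Nat.card_coe_set_eq] at card_edgeSet_le
  exact (Nat.add_le_add_right card_edgeSet_le 1).trans ((add_comm _ _).trans card_compl).le

end Tree
end Necklace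

/-! ### Isomorphisms and branches of necklace graphs -/

namespace Necklace

namespace Graph

variable {V W : Type} {G : Graph V} {H : Graph W}

theorem heq_map_cast {m n : ℕ} (e : m = n) (q : Option (Fin m)) : q.map (Fin.cast e) ≍ q := by
  subst e
  cases q <;> rfl

theorem mapPearl_ext {σ : V → W} {hσ : ∀ v, H.word (σ v) = G.word v} {p : Pearl G.word}
    {q : Pearl H.word} (h : σ p.1 = q.1) (h' : p.2 ≍ q.2) : mapPearl σ hσ p = q :=
  Sigma.ext h ((heq_map_cast _ _).trans h')

theorem kind_mapPearl (σ : V → W) (hσ : ∀ v, H.word (σ v) = G.word v) (p : Pearl G.word) :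
    H.kind (mapPearl σ hσ p) = G.kind p := by
  rcases p with ⟨v, _ | i⟩
  · rfl
  · simp only [kind, mapPearl, Option.map_some, Option.some.injEq, List.get_eq_getElem,
      Fin.val_cast]
    exact List.getElem_of_eq (hσ v) _

theorem mapPearl_inj (σ : V → W) (hσ : ∀ v, H.word (σ v) = G.word v) {p q : Pearl G.word}
    (h : σ p.1 = σ q.1 → p.1 = q.1) (hpq : mapPearl (H := H) σ hσ p = mapPearl σ hσ q) : p = q := by
  obtain ⟨v, i⟩ := p
  obtain ⟨w, j⟩ := q
  obtain ⟨fst_eq, snd_heq⟩ := Sigma.mk.inj_iff.1 hpq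
  cases h fst_eq
  exact Sigma.ext rfl
    (heq_of_eq (Option.map_injective (Fin.cast_injective _) (eq_of_heq snd_heq)))

theorem mapPearl_injective {σ : V → W} (h : Function.Injective σ)
    (hσ : ∀ v, H.word (σ v) = G.word v) : Function.Injective (mapPearl (H := H) σ hσ) :=
  fun _ _ => mapPearl_inj σ hσ (fun e => h e)

theorem exists_mapPearl (σ : V → W) (hσ : ∀ v, H.word (σ v) = G.word v) (v : V)
    (j : Pos (H.word (σ v))) : ∃ i, mapPearl (H := H) σ hσ ⟨v, i⟩ = ⟨σ v, j⟩ := by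
  refine ⟨j.map (Fin.cast (congrArg List.length (hσ v))), ?_⟩
  cases j <;> rfl

theorem mapPearl_surjective {σ : V → W} (h : Function.Surjective σ)
    (hσ : ∀ v, H.word (σ v) = G.word v) : Function.Surjective (mapPearl (H := H) σ hσ) := by
  rintro ⟨w, j⟩
  obtain ⟨v, rfl⟩ := h w
  obtain ⟨i, hi⟩ := exists_mapPearl σ hσ v j
  exact ⟨_, hi⟩

/-- An isomorphism of necklace graphs: a bijection between their necklaces that preserves the words
and the edges between pearls. -/
structure Iso (G : Graph V) (H : Graph W) where
  toEquiv : V ≃ W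
  word_eq : ∀ v, H.word (toEquiv v) = G.word v
  map_mate : ∀ p, mapPearl toEquiv word_eq (G.mate p) = H.mate (mapPearl toEquiv word_eq p)

namespace Iso

/-- The bijection between pearls induced by an isomorphism. -/
noncomputable def pearl (f : G.Iso H) : Pearl G.word ≃ Pearl H.word :=
  Equiv.ofBijective (mapPearl f.toEquiv f.word_eq)
    ⟨mapPearl_injective f.toEquiv.injective _, mapPearl_surjective f.toEquiv.surjective _⟩

@[simp]
theorem fst_pearl (f : G.Iso H) (p : Pearl G.word) : (f.pearl p).1 = f.toEquiv p.1 := rfl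

@[simp]
theorem mate_pearl (f : G.Iso H) (p : Pearl G.word) :
    H.mate (f.pearl p) = f.pearl (G.mate p) :=
  (f.map_mate p).symm

@[simp]
theorem kind_pearl (f : G.Iso H) (p : Pearl G.word) : H.kind (f.pearl p) = G.kind p :=
  kind_mapPearl _ f.word_eq _

@[simp]
theorem free_pearl (f : G.Iso H) (p : Pearl G.word) : H.Free (f.pearl p) ↔ G.Free p := by
  simp [Free]

/-- The induced isomorphism of incidence graphs. -/
noncomputable def incidence (f : G.Iso H) : G.incidence ≃g H.incidence where
  toEquiv := Equiv.sumCongr f.toEquiv f.pearl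
  map_rel_iff' := by
    rintro (v | p) (w | q) <;> simp

theorem isTree_iff (f : G.Iso H) : G.incidence.IsTree ↔ H.incidence.IsTree :=
  f.incidence.isTree_iff

theorem word_mem_iff (f : G.Iso H) (Q : Set (List Letter)) :
    (∀ w, H.word w ∈ Q) ↔ ∀ v, G.word v ∈ Q := by
  simp [f.toEquiv.surjective.forall, f.word_eq]

theorem mem_subtree (f : G.Iso H) (r x y : Pearl G.word) :
    f.pearl y ∈ H.subtree (f.pearl r) (f.pearl x) ↔ y ∈ G.subtree r x := by
  constructor
  · intro h w
    obtain ⟨z, hz, e⟩ := List.mem_map.1 ((congrArg (Sum.inr (f.pearl x) ∈ ·)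
      (SimpleGraph.Walk.support_map f.incidence.toHom w)).mp (h (w.map f.incidence.toHom)))
    obtain rfl : z = .inr x := f.incidence.injective e
    exact hz
  · intro h w
    have preimage_mem := h ((w.map f.incidence.symm.toHom).copy
      (f.incidence.symm_apply_apply (.inr r)) (f.incidence.symm_apply_apply (.inr y)))
    obtain ⟨z, hz, e⟩ := List.mem_map.1 ((congrArg (Sum.inr x ∈ ·)
      ((SimpleGraph.Walk.support_copy _ _ _).trans
        (SimpleGraph.Walk.support_map f.incidence.symm.toHom w))).mp preimage_mem)
    obtain rfl : z = .inr (f.pearl x) := f.incidence.symm.injective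
      (e.trans (f.incidence.symm_apply_apply (.inr x)).symm)
    exact hz

theorem excess_eq (f : G.Iso H) (r x : Pearl G.word) :
    H.excess (f.pearl r) (f.pearl x) = G.excess r x := by
  have ncard_kind : ∀ k, {y ∈ H.subtree (f.pearl r) (f.pearl x) | H.kind y = k}.ncard =
      {y ∈ G.subtree r x | G.kind y = k}.ncard := fun k => by
    rw [← Set.ncard_image_of_injective _ f.pearl.injective]
    congr 1
    ext y
    obtain ⟨y, rfl⟩ := f.pearl.surjective y
    simp [mem_subtree]
  simp only [excess, ncard_kind]

theorem edgesOfType_iff (f : G.Iso H) (l : List (Kind × Kind)) :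
    H.EdgesOfType l ↔ G.EdgesOfType l := by
  simp [EdgesOfType, f.pearl.surjective.forall]

theorem isQTree_iff (f : G.Iso H) (Q : Set (List Letter)) (r : Pearl G.word) :
    H.IsQTree Q (f.pearl r) ↔ G.IsQTree Q r where
  mp h :=
    { tree := f.isTree_iff.2 h.tree
      word_mem := (f.word_mem_iff Q).1 h.word_mem
      edges := (f.edgesOfType_iff _).1 h.edges
      root_kind := by simpa using h.root_kind
      free_iff := fun p => by simpa using h.free_iff (f.pearl p) }
  mpr h :=
    { tree := f.isTree_iff.1 h.tree
      word_mem := (f.word_mem_iff Q).2 h.word_mem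
      edges := (f.edgesOfType_iff _).2 h.edges
      root_kind := by simpa using h.root_kind
      free_iff := f.pearl.surjective.forall.2 fun p => by simpa using h.free_iff p }

theorem isNonnegQTree_iff (f : G.Iso H) (Q : Set (List Letter)) (r : Pearl G.word) :
    H.IsNonnegQTree Q (f.pearl r) ↔ G.IsNonnegQTree Q r := by
  simp [IsNonnegQTree, f.isQTree_iff, f.pearl.surjective.forall, f.excess_eq]

theorem isCompanion_iff (f : G.Iso H) (Q : Set (List Letter)) :
    H.IsCompanion Q ↔ G.IsCompanion Q where
  mp h := ⟨f.isTree_iff.2 h.tree, (f.word_mem_iff Q).1 h.word_mem, (f.edgesOfType_iff _).1 h.edges⟩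
  mpr h := ⟨f.isTree_iff.1 h.tree, (f.word_mem_iff Q).2 h.word_mem, (f.edgesOfType_iff _).2 h.edges⟩

theorem isRootedCompanion_iff (f : G.Iso H) (Q : Set (List Letter)) (r : Pearl G.word) :
    H.IsRootedCompanion Q (f.pearl r) ↔ G.IsRootedCompanion Q r where
  mp h :=
    { toIsCompanion := (f.isCompanion_iff Q).1 h.toIsCompanion
      root_free := by simpa using h.root_free
      free_kind := fun p => by simpa using h.free_kind (f.pearl p) }
  mpr h :=
    { toIsCompanion := (f.isCompanion_iff Q).2 h.toIsCompanion
      root_free := by simpa using h.root_free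
      free_kind := f.pearl.surjective.forall.2 fun p => by simpa using h.free_kind p }

theorem isUnrootedCompanion_iff (f : G.Iso H) (Q : Set (List Letter)) :
    H.IsUnrootedCompanion Q ↔ G.IsUnrootedCompanion Q where
  mp h :=
    { toIsCompanion := (f.isCompanion_iff Q).1 h.toIsCompanion
      free_kind := fun p => by simpa using h.free_kind (f.pearl p) }
  mpr h :=
    { toIsCompanion := (f.isCompanion_iff Q).2 h.toIsCompanion
      free_kind := f.pearl.surjective.forall.2 fun p => by simpa using h.free_kind p }

theorem isDefect_iff (f : G.Iso H) (r : Option (Pearl G.word)) (p : Pearl G.word) :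
    H.IsDefect (r.map f.pearl) (f.pearl p) ↔ G.IsDefect r p := by
  cases r <;> simp [IsDefect]

end Iso

end Graph

theorem eq_of_adj_of_dist_lt {X : Type*} {Γ : SimpleGraph X} (hΓ : Γ.IsTree) (o : X) {x a b : X}
    (ha : Γ.Adj x a) (hb : Γ.Adj x b) (da : Γ.dist o a < Γ.dist o x)
    (db : Γ.dist o b < Γ.dist o x) : a = b := by
  obtain ⟨p, hp, length_p⟩ := hΓ.connected.exists_path_of_dist o x
  have eq_penultimate : ∀ c, Γ.Adj x c → Γ.dist o c < Γ.dist o x → c = p.penultimate := by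
    intro c hc dc
    refine hΓ.isAcyclic.eq_penultimate_of_adj_end hp hc ?_
    obtain ⟨q, hq, length_q⟩ := hΓ.connected.exists_path_of_dist o c
    refine hΓ.isAcyclic.mem_support_of_ne_mem_support_of_adj_of_isPath hp hq hc fun hx => ?_
    have length_eq := congrArg SimpleGraph.Walk.length (hΓ.isAcyclic.path_concat hp hq hc hx)
    rw [SimpleGraph.Walk.length_concat] at length_eq
    omega
  rw [eq_penultimate a ha da, eq_penultimate b hb db]

namespace Graph

variable {V W : Type} {G : Graph V} {H : Graph W}

theorem surjective_of_map_mate [Nonempty V] (hH : H.incidence.Preconnected) (φ : V → W)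
    (hφ : ∀ v, H.word (φ v) = G.word v)
    (hm : ∀ p, mapPearl φ hφ (G.mate p) = H.mate (mapPearl φ hφ p)) : Function.Surjective φ := by
  intro w
  obtain ⟨v₀⟩ := ‹Nonempty V›
  let P : W ⊕ Pearl H.word → Prop := Sum.elim (· ∈ Set.range φ) (·.1 ∈ Set.range φ)
  have P_adj : ∀ x y, H.incidence.Adj x y → P x → P y := by
    rintro (v | ⟨v, i⟩) (w | ⟨w, j⟩) hxy hx
    · exact absurd hxy (Graph.incidence_inl_inl _ _ _)
    · rw [incidence_inl_inr] at hxy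
      cases hxy; exact hx
    · rw [incidence_inr_inl] at hxy
      cases hxy; exact hx
    · rw [incidence_inr_inr] at hxy
      obtain ⟨v, rfl⟩ := hx
      obtain ⟨i, hi⟩ := exists_mapPearl φ hφ v i
      rw [← hi, ← hm] at hxy
      exact ⟨_, congrArg Sigma.fst hxy.2⟩
  obtain ⟨p⟩ := hH (.inl (φ v₀)) (.inl w)
  have P_walk : ∀ x y, H.incidence.Walk x y → P x → P y := fun x y p => by
    induction p with
    | nil => exact id
    | cons h _ ih => exact fun hx => ih (P_adj _ _ h hx)
  exact P_walk _ _ p ⟨v₀, rfl⟩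

variable (G) in
/-- The pearl `y` points away from the necklace `o`: it is farther from `o` than its own
necklace. -/
def Down (o : V) (y : Pearl G.word) : Prop :=
  G.incidence.dist (.inl o) (.inl y.1) < G.incidence.dist (.inl o) (.inr y)

variable (G) in
/-- The necklaces that are reached by moving away from `o` through the edge at a pearl. In a tree,
they are the necklaces of the branch that hangs from this pearl. -/
inductive Below (o : V) : Pearl G.word → V → Prop
  | base {y} : ¬ G.Free y → Below o y (G.mate y).1
  | step {y z} : Below o y z.1 → G.Down o z → ¬ G.Free z → Below o y (G.mate z).1

section
variable (hG : G.incidence.IsTree) {o : V}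
include hG

theorem dist_lt_of_not_down {y : Pearl G.word} (h : ¬ G.Down o y) :
    G.incidence.dist (.inl o) (.inr y) < G.incidence.dist (.inl o) (.inl y.1) := by
  have := hG.dist_ne_of_adj (.inl o) ((incidence_inl_inr G (p := y)).2 rfl)
  simp only [Down] at h
  omega

theorem down_self (q : Pos (G.word o)) : G.Down o ⟨o, q⟩ := by
  have := hG.dist_ne_of_adj (.inl o) ((incidence_inl_inr G (p := ⟨o, q⟩)).2 rfl)
  rw [SimpleGraph.dist_self] at this
  simp only [Down, SimpleGraph.dist_self]
  omega

theorem Down.mate {y : Pearl G.word} (h : G.Down o y) (hy : ¬ G.Free y) :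
    ¬ G.Down o (G.mate y) ∧
      G.incidence.dist (.inl o) (.inl y.1) < G.incidence.dist (.inl o) (.inl (G.mate y).1) := by
  have adj_own : G.incidence.Adj (.inr y) (.inl y.1) := (incidence_inr_inl G).2 rfl
  have adj_mate : G.incidence.Adj (.inr y) (.inr (G.mate y)) :=
    (incidence_inr_inr G).2 ⟨fun e => hy e.symm, rfl⟩
  have adj_mate_own : G.incidence.Adj (.inr (G.mate y)) (.inl (G.mate y).1) :=
    (incidence_inr_inl G).2 rfl
  have dist_ne := hG.dist_ne_of_adj (.inl o) adj_mate
  have dist_lt :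
      G.incidence.dist (.inl o) (.inr y) < G.incidence.dist (.inl o) (.inr (G.mate y)) := by
    by_contra hl
    exact Sum.inl_ne_inr (eq_of_adj_of_dist_lt hG (.inl o) adj_own adj_mate h (by omega))
  have not_down : ¬ G.Down o (G.mate y) := fun down =>
    Sum.inl_ne_inr (eq_of_adj_of_dist_lt hG (.inl o) adj_mate_own adj_mate.symm down dist_lt)
  have dist_mate_lt := dist_lt_of_not_down hG not_down
  simp only [Down] at h
  exact ⟨not_down, by omega⟩

theorem eq_of_not_down {y z : Pearl G.word} (hy : ¬ G.Down o y) (hz : ¬ G.Down o z)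
    (h : y.1 = z.1) : y = z := by
  refine Sum.inr_injective (eq_of_adj_of_dist_lt hG (.inl o) (x := .inl y.1)
    ((incidence_inl_inr G).2 rfl) ((incidence_inl_inr G).2 h.symm) (dist_lt_of_not_down hG hy) ?_)
  rw [h]
  exact dist_lt_of_not_down hG hz

theorem down_of_ne {m : Pearl G.word} (hm : ¬ G.Down o m) {q : Pos (G.word m.1)}
    (hq : q ≠ m.2) : G.Down o ⟨m.1, q⟩ := by
  obtain ⟨w, i⟩ := m
  by_contra not_down
  cases eq_of_not_down hG hm not_down rfl
  exact hq rfl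

theorem eq_of_mate_fst_eq {y z : Pearl G.word} (hy : G.Down o y) (hz : G.Down o z)
    (fy : ¬ G.Free y) (fz : ¬ G.Free z) (h : (G.mate y).1 = (G.mate z).1) : y = z := by
  rw [← G.mate_mate y, ← G.mate_mate z,
    eq_of_not_down hG (hy.mate hG fy).1 (hz.mate hG fz).1 h]

theorem Below.dist_lt {y : Pearl G.word} {w : V} (h : G.Below o y w) (hy : G.Down o y) :
    G.incidence.dist (.inl o) (.inl y.1) < G.incidence.dist (.inl o) (.inl w) := by
  induction h with
  | base f => exact (hy.mate hG f).2
  | step _ hz f ih => exact ih.trans (hz.mate hG f).2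

omit hG in
theorem Below.cases_last {y : Pearl G.word} {w : V} (h : G.Below o y w) (hy : G.Down o y) :
    ∃ z, G.Down o z ∧ ¬ G.Free z ∧ w = (G.mate z).1 ∧ (z = y ∨ G.Below o y z.1) := by
  cases h with
  | base f => exact ⟨y, hy, f, rfl, .inl rfl⟩
  | step h hz f => exact ⟨_, hz, f, rfl, .inr h⟩

theorem Below.eq {y z : Pearl G.word} {w : V} (h : G.Below o y w) (h' : G.Below o z w)
    (hy : G.Down o y) (hz : G.Down o z) (hyz : y.1 = z.1) : y = z := by
  induction h with
  | base f =>
    obtain ⟨x, hx, fx, e, hxz⟩ := h'.cases_last hz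
    obtain rfl := eq_of_mate_fst_eq hG hy hx f fx e
    rcases hxz with rfl | hb
    · rfl
    · exact absurd (hyz ▸ hb.dist_lt hG hz) (lt_irrefl _)
  | step hb hz' f ih =>
    obtain ⟨x, hx, fx, e, hxz⟩ := h'.cases_last hz
    obtain rfl := eq_of_mate_fst_eq hG hz' hx f fx e
    rcases hxz with rfl | hb'
    · exact absurd (hyz ▸ hb.dist_lt hG hy) (lt_irrefl _)
    · exact ih hb'

end

theorem Below.trans {o : V} {y z : Pearl G.word} {w : V} (h : G.Below o y z.1) (hz : G.Down o z)
    (h' : G.Below o z w) : G.Below o y w := by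
  induction h' with
  | base f => exact h.step hz f
  | step _ hz' f ih => exact ih.step hz' f

end Graph
end Necklace

/-! ### Necklace graphs described by recursive trees -/

namespace Necklace

open Necklace.Graph

namespace Tree

variable {V : Type} {G : Graph V}

section
variable {s : List Letter} {p : Option (Pos s)} {ch : Pos s → Tree}

/-- The map on the necklaces of a tree that is given by the image of the top necklace and by maps
on the attached trees. -/
def glue (v : V) (φ : ∀ q, (ch q).Vtx → V) : (node s p ch).Vtx → V
  | none => v
  | some x => φ x.1 x.2

theorem word_glue {v : V} {φ : ∀ q, (ch q).Vtx → V} (hv : G.word v = s)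
    (hφ : ∀ q y, G.word (φ q y) = (ch q).word y) :
    ∀ x, G.word (glue (p := p) v φ x) = (node s p ch).word x
  | none => hv
  | some x => hφ x.1 x.2

theorem injective_glue {v : V} {φ : ∀ q, (ch q).Vtx → V} (ne_top : ∀ q x, φ q x ≠ v)
    (disjoint : ∀ q q' x x', φ q x = φ q' x' → q = q') (hφ : ∀ q, Function.Injective (φ q)) :
    Function.Injective (glue (p := p) v φ)
  | none, none, _ => rfl
  | none, some _, e => absurd e.symm (ne_top _ _)
  | some _, none, e => absurd e (ne_top _ _)
  | some ⟨q, x⟩, some ⟨q', x'⟩, e => by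
    obtain rfl := disjoint _ _ _ _ e
    exact congrArg (fun x => some (Sigma.mk q x)) (hφ q e)

theorem mapPearl_lift (h : (node s p ch).WF) (φ : (node s p ch).Vtx → V)
    (hφ : ∀ x, G.word (φ x) = (node s p ch).word x) (q : Pos s) (y : Pearl (ch q).word) :
    mapPearl (G := (node s p ch).graph h) φ hφ (lift q y) =
      mapPearl (G := (ch q).graph (h.child q)) (fun x => φ (some ⟨q, x⟩)) (fun _ => hφ _) y := by
  rcases y with ⟨v, _ | i⟩ <;> rfl

theorem root_ne_top {q : Pos s} (hq : p ≠ some q) : (node s p ch).root ≠ some (top q) := by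
  cases p with
  | none => exact nofun
  | some q' => exact fun e => hq (congrArg some (top_inj.1 (Option.some.inj e)))

theorem root_ne_lift (q : Pos s) (y : Pearl (ch q).word) :
    (node s p ch).root ≠ some (lift q y) := by
  cases p with
  | none => exact nofun
  | some q' => exact fun e => lift_ne_top _ _ _ (Option.some.inj e).symm

theorem WF.rootNode_child (h : (node s p ch).WF) (q : Pos s) :
    (ch q).rootNode = (ch q).root.map .inr := by
  rcases h.2 q with hl | ⟨hr, -⟩
  · rw [hl]; rfl
  · obtain ⟨y, hy⟩ := Option.ne_none_iff_exists'.1 hr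
    rw [hy, rootNode_eq hy, Option.map_some]

end

/-- A map from the tree `t` to `G` that preserves words, and edges except at the root pearl: the
latter may be joined in `G` to a pearl outside the image. -/
structure Immersion (t : Tree) (h : t.WF) (G : Graph V) where
  toFun : t.Vtx → V
  word_eq : ∀ x, G.word (toFun x) = t.word x
  map_mate : ∀ y, t.root ≠ some y →
    mapPearl (G := t.graph h) toFun word_eq (t.mate y) =
      G.mate (mapPearl (G := t.graph h) toFun word_eq y)

namespace Immersion

/-- The image of a pearl under an immersion. -/
noncomputable def pearl {t : Tree} {h : t.WF} (f : t.Immersion h G) (y : Pearl t.word) :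
    Pearl G.word :=
  mapPearl (G := t.graph h) f.toFun f.word_eq y

theorem pearl_injective {t : Tree} {h : t.WF} {f : t.Immersion h G}
    (hf : Function.Injective f.toFun) : Function.Injective f.pearl :=
  mapPearl_injective (G := t.graph h) hf f.word_eq

theorem pearl_top {v : V} {p : Option (Pos (G.word v))} {ch : Pos (G.word v) → Tree}
    {h : (node (G.word v) p ch).WF} (f : (node (G.word v) p ch).Immersion h G)
    (hf : f.toFun none = v) (q : Pos (G.word v)) : f.pearl (top q) = ⟨v, q⟩ :=
  mapPearl_ext hf HEq.rfl

/-- The immersion of the empty tree. -/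
noncomputable def leaf : Tree.leaf.Immersion trivial G :=
  ⟨Empty.elim, Empty.rec, fun y => y.1.elim⟩

/-- The immersion that sends the top necklace of a tree to `v` and is given on the attached
trees. -/
noncomputable def glue {v : V} {p : Option (Pos (G.word v))} {ch : Pos (G.word v) → Tree}
    (h : (node (G.word v) p ch).WF) (f : ∀ q, (ch q).Immersion (h.child q) G)
    (hf : ∀ q, p ≠ some q → (ch q).root.elim ⟨v, q⟩ (f q).pearl = G.mate ⟨v, q⟩) :
    (node (G.word v) p ch).Immersion h G where
  toFun := Tree.glue v fun q => (f q).toFun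
  word_eq := word_glue rfl fun q => (f q).word_eq
  map_mate y hy := by
    set φ := mapPearl (G := (node (G.word v) p ch).graph h) (H := G)
      (Tree.glue v fun q => (f q).toFun) (word_glue rfl fun q => (f q).word_eq)
    have φ_top : ∀ q, φ (top q) = ⟨v, q⟩ := by
      rintro (_ | i) <;> rfl
    have φ_lift : ∀ q y, φ (lift q y) = (f q).pearl y := fun q y => mapPearl_lift _ _ _ _ _
    induction y using pearl_cases with
    | top q =>
      rw [φ_top, ← hf q fun e => hy (by rw [e]; rfl), mate_top]
      cases (ch q).root with
      | none => exact φ_top q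
      | some y => exact φ_lift q y
    | lift q y =>
      by_cases hr : (ch q).root = some y
      · have hq : p ≠ some q := fun e => by
          rw [h.1 q e] at y
          exact y.1.elim
        have mate_eq := hf q hq
        rw [hr, Option.elim_some] at mate_eq
        rw [mate_lift_root hr, φ_top, φ_lift, mate_eq, G.mate_mate]
      · rw [mate_lift hr, φ_lift, φ_lift]
        exact (f q).map_mate y hr

/-- The immersion `f` covers the branch of `G` that hangs from the pearl `y`, as seen from the
necklace `o`; if `y` is free, this branch is empty. -/
structure IsBranch {t : Tree} {h : t.WF} (f : t.Immersion h G) (o : V) (y : Pearl G.word) :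
    Prop where
  injective : Function.Injective f.toFun
  below : ∀ x, G.Below o y (f.toFun x)
  eq_leaf_or : t = Tree.leaf ∨ t.root ≠ none
  mate_eq : t.root.elim y f.pearl = G.mate y

theorem injective_glue (hG : G.incidence.IsTree) {o v : V} {p : Option (Pos (G.word v))}
    {ch : Pos (G.word v) → Tree} {φ : ∀ q, (ch q).Vtx → V}
    (down : ∀ q, (ch q).Vtx → G.Down o ⟨v, q⟩) (below : ∀ q x, G.Below o ⟨v, q⟩ (φ q x))
    (hφ : ∀ q, Function.Injective (φ q)) : Function.Injective (Tree.glue (p := p) v φ) := by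
  refine Tree.injective_glue (fun q x e => ?_) (fun q q' x x' e => ?_) hφ
  · exact absurd (e ▸ (below q x).dist_lt hG (down q x)) (lt_irrefl _)
  · have below_x := below q x
    rw [e] at below_x
    injection below_x.eq hG (below q' x') (down q x) (down q' x') rfl

theorem exists_of_isBranch (hG : G.incidence.IsTree) {o v : V} (p : Option (Pos (G.word v)))
    (down : ∀ q, p ≠ some q → G.Down o ⟨v, q⟩)
    (branch : ∀ q, p ≠ some q →
      ∃ (t : Tree) (h : t.WF) (f : t.Immersion h G), f.IsBranch o ⟨v, q⟩) :
    ∃ (ch : Pos (G.word v) → Tree) (h : (node (G.word v) p ch).WF)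
      (f : (node (G.word v) p ch).Immersion h G),
      Function.Injective f.toFun ∧ f.toFun none = v ∧
      ∀ x, ∃ q, p ≠ some q ∧ G.Below o ⟨v, q⟩ (f.toFun (some x)) := by
  have branch_or_leaf : ∀ q, ∃ (t : Tree) (h : t.WF) (f : t.Immersion h G),
      (p = some q → t = Tree.leaf) ∧ (p ≠ some q → f.IsBranch o ⟨v, q⟩) := fun q => by
    by_cases hq : p = some q
    · exact ⟨_, _, leaf, fun _ => rfl, fun hq' => absurd hq hq'⟩
    · obtain ⟨t, h, f, hf⟩ := branch q hq
      exact ⟨t, h, f, fun hq' => absurd hq' hq, fun _ => hf⟩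
  choose ch hch f eq_leaf isBranch using branch_or_leaf
  have ne_root : ∀ q (_ : (ch q).Vtx), p ≠ some q := fun q x hq =>
    (eq_leaf q hq ▸ x : Tree.leaf.Vtx).elim
  have below : ∀ q x, G.Below o ⟨v, q⟩ ((f q).toFun x) := fun q x =>
    (isBranch q (ne_root q x)).below x
  have wf : (node (G.word v) p ch).WF := ⟨eq_leaf, fun q => by
    by_cases hq : p = some q
    · exact .inl (eq_leaf q hq)
    · exact (isBranch q hq).eq_leaf_or.imp_right fun hr => ⟨hr, hch q⟩⟩
  refine ⟨ch, wf, glue wf f fun q hq => (isBranch q hq).mate_eq, ?_, rfl,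
    fun x => ⟨x.1, ne_root _ x.2, below _ x.2⟩⟩
  refine injective_glue hG (fun q x => down q (ne_root q x)) below fun q x x' e => ?_
  exact (isBranch q (ne_root q x)).injective e

theorem exists_isBranch [Finite V] (hG : G.incidence.IsTree) {o : V} (y : Pearl G.word)
    (hy : G.Down o y) : ∃ (t : Tree) (h : t.WF) (f : t.Immersion h G), f.IsBranch o y := by
  let d := fun y : Pearl G.word => G.incidence.dist (.inl o) (.inl y.1)
  have wf : WellFounded fun y z => d z < d y := by
    have : IsTrans (Pearl G.word) fun y z => d z < d y := ⟨fun _ _ _ h h' => h'.trans h⟩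
    have : Std.Irrefl fun y z => d z < d y := ⟨fun _ => lt_irrefl _⟩
    exact Finite.wellFounded_of_trans_of_irrefl _
  induction y using wf.induction with
  | _ y ih =>
  by_cases free : G.Free y
  · exact ⟨_, _, leaf, fun x => x.elim, fun x => x.elim, .inl rfl, free.symm⟩
  obtain ⟨not_down, dist_lt⟩ := hy.mate hG free
  have down : ∀ q, some (G.mate y).2 ≠ some q → G.Down o ⟨(G.mate y).1, q⟩ := fun q hq =>
    down_of_ne hG not_down fun e => hq (congrArg some e.symm)
  obtain ⟨ch, h, f, injective, f_top, below⟩ := exists_of_isBranch hG (some (G.mate y).2) down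
    fun q hq => ih ⟨(G.mate y).1, q⟩ dist_lt (down q hq)
  refine ⟨_, h, f, injective, ?_, .inr nofun, f.pearl_top f_top _⟩
  rintro (_ | x)
  · rw [f_top]
    exact .base free
  · obtain ⟨q, hq, below_q⟩ := below x
    exact Below.trans (z := ⟨(G.mate y).1, q⟩) (.base free) (down q hq) below_q

end Immersion

theorem exists_iso [Finite V] (hG : G.incidence.IsTree) (v : V) (p : Option (Pos (G.word v)))
    (hp : ∀ q, p = some q → G.Free ⟨v, q⟩) :
    ∃ (ch : Pos (G.word v) → Tree) (h : (node (G.word v) p ch).WF)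
      (f : ((node (G.word v) p ch).graph h).Iso G),
      f.toEquiv none = v ∧ ∀ q, f.pearl (top q) = ⟨v, q⟩ := by
  obtain ⟨ch, h, f, injective, f_top, -⟩ := Immersion.exists_of_isBranch hG p
    (fun q _ => down_self hG q) fun q _ => Immersion.exists_isBranch hG _ (down_self hG q)
  have map_mate : ∀ y, mapPearl (G := (node (G.word v) p ch).graph h) f.toFun f.word_eq
      ((node (G.word v) p ch).mate y) = G.mate (f.pearl y) := by
    intro y
    by_cases hy : (node (G.word v) p ch).root = some y
    · rw [root_free h hy]
      cases p with
      | none => cases hy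
      | some q =>
        cases hy
        exact (f.pearl_top f_top q).trans ((hp q rfl).symm.trans
          (congrArg G.mate (f.pearl_top f_top q).symm))
    · exact f.map_mate y hy
  have : Nonempty (node (G.word v) p ch).Vtx := ⟨none⟩
  have surjective := surjective_of_map_mate (G := (node (G.word v) p ch).graph h)
    hG.connected.preconnected f.toFun f.word_eq map_mate
  exact ⟨ch, h, ⟨Equiv.ofBijective _ ⟨injective, surjective⟩, f.word_eq, map_mate⟩, f_top,
    fun q => f.pearl_top f_top q⟩

namespace Immersion
variable {s : List Letter} {p p' : Option (Pos s)} {ch ch' : Pos s → Tree}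

/-- The restriction of an immersion to an attached tree. -/
noncomputable def child {h : (node s p ch).WF} (f : (node s p ch).Immersion h G) (q : Pos s) :
    (ch q).Immersion (h.child q) G where
  toFun x := f.toFun (some ⟨q, x⟩)
  word_eq x := f.word_eq (some ⟨q, x⟩)
  map_mate y hy := by
    have map_mate_lift := f.map_mate (lift q y) (root_ne_lift q y)
    rwa [mate_lift hy, mapPearl_lift, mapPearl_lift] at map_mate_lift

theorem pearl_lift {h : (node s p ch).WF} (f : (node s p ch).Immersion h G) (q : Pos s)
    (y : Pearl (ch q).word) : f.pearl (lift q y) = (f.child q).pearl y :=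
  mapPearl_lift _ _ _ _ _

theorem child_injective {h : (node s p ch).WF} {f : (node s p ch).Immersion h G}
    (hf : Function.Injective f.toFun) (q : Pos s) : Function.Injective (f.child q).toFun := by
  intro x y e
  injection hf e with e
  injection e

theorem mate_pearl_top {h : (node s p ch).WF} (f : (node s p ch).Immersion h G) {q : Pos s}
    (hq : p ≠ some q) :
    G.mate (f.pearl (top q)) = (ch q).root.elim (f.pearl (top q)) (f.child q).pearl := by
  refine (f.map_mate _ (root_ne_top hq)).symm.trans ?_
  rw [mate_top]
  cases (ch q).root with
  | none => rfl
  | some y => exact f.pearl_lift q y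

variable {h : (node s p ch).WF} {h' : (node s p' ch').WF} {f : (node s p ch).Immersion h G}
  {f' : (node s p' ch').Immersion h' G}

theorem pearl_top_eq (f : (node s p ch).Immersion h G) (f' : (node s p' ch').Immersion h' G)
    (e : f.toFun none = f'.toFun none) (q : Pos s) : f.pearl (top q) = f'.pearl (top q) :=
  mapPearl_ext e (heq_map_cast _ q).symm

theorem map_root_child_eq (hf : Function.Injective f.toFun) (hf' : Function.Injective f'.toFun)
    (e : f.toFun none = f'.toFun none) {q : Pos s} (hp : p ≠ some q) (hp' : p' ≠ some q) :
    (ch q).root.map (f.child q).pearl = (ch' q).root.map (f'.child q).pearl := by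
  have top_eq := f.pearl_top_eq f' e q
  have mate_eq := (f.mate_pearl_top hp).symm.trans
    ((congrArg G.mate top_eq).trans (f'.mate_pearl_top hp'))
  have ne_top : ∀ y, (f.child q).pearl y ≠ f.pearl (top q) := fun y hy =>
    lift_ne_top _ _ _ (pearl_injective hf ((f.pearl_lift q y).trans hy))
  have ne_top' : ∀ y, (f'.child q).pearl y ≠ f'.pearl (top q) := fun y hy =>
    lift_ne_top _ _ _ (pearl_injective hf' ((f'.pearl_lift q y).trans hy))
  cases hr : (ch q).root <;> cases hr' : (ch' q).root <;> rw [hr, hr'] at mate_eq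
  · rfl
  · exact absurd (mate_eq.symm.trans top_eq) (ne_top' _)
  · exact absurd (mate_eq.trans top_eq.symm) (ne_top _)
  · exact congrArg some mate_eq

theorem map_rootNode_child_eq (hf : Function.Injective f.toFun)
    (hf' : Function.Injective f'.toFun) (e : f.toFun none = f'.toFun none) {q : Pos s}
    (hp : p ≠ some q) (hp' : p' ≠ some q) :
    (ch q).rootNode.map (Sum.map (f.child q).toFun (f.child q).pearl) =
      (ch' q).rootNode.map (Sum.map (f'.child q).toFun (f'.child q).pearl) := by
  have map_inr_eq := congrArg (Option.map (Sum.inr (α := V))) (map_root_child_eq hf hf' e hp hp')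
  rw [Option.map_map, Option.map_map] at map_inr_eq
  rw [h.rootNode_child, h'.rootNode_child, Option.map_map, Option.map_map]
  exact map_inr_eq

theorem rootPos_eq (hf' : Function.Injective f'.toFun) (e : f.toFun none = f'.toFun none)
    (hroot : (node s p ch).rootNode.map (Sum.map f.toFun f.pearl) =
      (node s p' ch').rootNode.map (Sum.map f'.toFun f'.pearl)) : p = p' := by
  cases p <;> cases p'
  · rfl
  · exact nomatch Option.some.inj hroot
  · exact nomatch Option.some.inj hroot
  · have pearl_eq := Sum.inr.inj (Option.some.inj hroot)
    rw [f.pearl_top_eq f' e] at pearl_eq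
    exact congrArg some (top_inj.1 (pearl_injective hf' pearl_eq))

theorem toFun_none_eq {s s' : List Letter} {p : Option (Pos s)} {p' : Option (Pos s')}
    {ch : Pos s → Tree} {ch' : Pos s' → Tree} {h : (node s p ch).WF} {h' : (node s' p' ch').WF}
    {f : (node s p ch).Immersion h G} {f' : (node s' p' ch').Immersion h' G}
    (hroot : (node s p ch).rootNode.map (Sum.map f.toFun f.pearl) =
      (node s' p' ch').rootNode.map (Sum.map f'.toFun f'.pearl)) :
    f.toFun none = f'.toFun none := by
  cases p <;> cases p'
  · exact Sum.inl.inj (Option.some.inj hroot)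
  · exact nomatch Option.some.inj hroot
  · exact nomatch Option.some.inj hroot
  · exact congrArg Sigma.fst (Sum.inr.inj (Option.some.inj hroot))

end Immersion

theorem eq_of_immersion : ∀ {t t' : Tree} {h : t.WF} {h' : t'.WF} (f : t.Immersion h G)
    (f' : t'.Immersion h' G), Function.Injective f.toFun → Function.Injective f'.toFun →
    t.rootNode.map (Sum.map f.toFun f.pearl) = t'.rootNode.map (Sum.map f'.toFun f'.pearl) →
    t = t'
  | leaf, leaf, _, _, _, _, _, _, _ => rfl
  | leaf, node _ _ _, _, _, _, _, _, _, e => nomatch e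
  | node _ _ _, leaf, _, _, _, _, _, _, e => nomatch e
  | node s p ch, node s' p' ch', h, h', f, f', hf, hf', e => by
    have top_eq := Immersion.toFun_none_eq e
    obtain rfl : s = s' :=
      (f.word_eq none).symm.trans ((congrArg G.word top_eq).trans (f'.word_eq none))
    obtain rfl : p = p' := Immersion.rootPos_eq hf' top_eq e
    congr 1
    funext q
    by_cases hp : p = some q
    · rw [h.1 q hp, h'.1 q hp]
    · exact eq_of_immersion (f.child q) (f'.child q) (Immersion.child_injective hf q)
        (Immersion.child_injective hf' q) (Immersion.map_rootNode_child_eq hf hf' top_eq hp hp)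

end Tree
end Necklace

namespace Necklace

open Necklace.Graph

namespace Graph

variable {V W U : Type} {G : Graph V} {H : Graph W} {K : Graph U}

namespace Iso

theorem symm_word_eq (f : G.Iso H) (w : W) : G.word (f.toEquiv.symm w) = H.word w := by
  rw [← f.word_eq, Equiv.apply_symm_apply]

theorem mapPearl_symm (f : G.Iso H) (p : Pearl H.word) :
    mapPearl f.toEquiv.symm f.symm_word_eq p = f.pearl.symm p := by
  rw [Equiv.eq_symm_apply]
  exact mapPearl_ext (hσ := f.word_eq) (f.toEquiv.apply_symm_apply p.1) (heq_map_cast _ _)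

/-- The inverse isomorphism. -/
noncomputable def symm (f : G.Iso H) : H.Iso G where
  toEquiv := f.toEquiv.symm
  word_eq := f.symm_word_eq
  map_mate p := by
    rw [mapPearl_symm, mapPearl_symm, Equiv.symm_apply_eq, ← f.mate_pearl, Equiv.apply_symm_apply]

theorem pearl_symm (f : G.Iso H) (p : Pearl H.word) : f.symm.pearl p = f.pearl.symm p :=
  f.mapPearl_symm p

/-- The composition of isomorphisms. -/
noncomputable def trans (f : G.Iso H) (g : H.Iso K) : G.Iso K where
  toEquiv := f.toEquiv.trans g.toEquiv
  word_eq v := (g.word_eq _).trans (f.word_eq v)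
  map_mate p := by
    have mapPearl_trans : ∀ p, mapPearl (f.toEquiv.trans g.toEquiv)
        (fun v => (g.word_eq _).trans (f.word_eq v)) p = g.pearl (f.pearl p) := fun p =>
      mapPearl_ext rfl ((heq_map_cast _ _).trans (heq_map_cast _ _)).symm
    rw [mapPearl_trans, mapPearl_trans, mate_pearl, mate_pearl]

theorem pearl_trans (f : G.Iso H) (g : H.Iso K) (p : Pearl G.word) :
    (f.trans g).pearl p = g.pearl (f.pearl p) :=
  mapPearl_ext (hσ := (f.trans g).word_eq) rfl
    ((heq_map_cast _ _).trans (heq_map_cast _ _)).symm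

end Iso

/-- The pearls of the graph transported along a bijection of its necklaces. -/
def transportPearl (G : Graph V) (e : W ≃ V) : Pearl (fun w => G.word (e w)) ≃ Pearl G.word :=
  Equiv.sigmaCongrLeft (β := fun v => Pos (G.word v)) e

/-- The graph transported along a bijection of its necklaces. -/
def transport (G : Graph V) (e : W ≃ V) : Graph W where
  word w := G.word (e w)
  mate p := (G.transportPearl e).symm (G.mate (G.transportPearl e p))
  mate_mate p := by simp [G.mate_mate]

/-- The isomorphism between a graph and a transported graph. -/
def transportIso (G : Graph V) (e : W ≃ V) : (G.transport e).Iso G where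
  toEquiv := e
  word_eq _ := rfl
  map_mate p := by
    have mapPearl_eq : ∀ p, mapPearl (G := G.transport e) (H := G) e (fun _ => rfl) p =
        G.transportPearl e p := fun p => mapPearl_ext rfl HEq.rfl
    rw [mapPearl_eq, mapPearl_eq]
    exact Equiv.apply_symm_apply _ _

end Graph

theorem Decorated.iso_iff {A B : Decorated} : A.Iso B ↔
    ∃ f : A.graph.Iso B.graph, A.root.map f.pearl = B.root ∧ A.mark.map f.toEquiv = B.mark :=
  ⟨fun ⟨σ, word_eq, map_mate, root_eq, mark_eq⟩ => ⟨⟨σ, word_eq, map_mate⟩, root_eq, mark_eq⟩,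
    fun ⟨f, root_eq, mark_eq⟩ => ⟨f.toEquiv, f.word_eq, f.map_mate, root_eq, mark_eq⟩⟩

/-- A decorated graph that is a tree with a distinguished place: either a free root pearl, or a
marked necklace. -/
def Decorated.Anchored (A : Decorated) : Prop :=
  A.graph.incidence.IsTree ∧ ((A.mark = none ∧ ∃ r, A.root = some r ∧ A.graph.Free r) ∨
    A.root = none ∧ A.mark ≠ none)

namespace Tree

/-- The marked necklace of a tree: the one at the top, for a tree without root pearl. -/
def mark : ∀ t : Tree, Option t.Vtx
  | leaf => none
  | node _ none _ => some none
  | node _ (some _) _ => none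

/-- The word of the marked necklace of a tree. -/
def markWord : Tree → Option (List Letter)
  | leaf => none
  | node s none _ => some s
  | node _ (some _) _ => none

theorem map_mark_word (t : Tree) : t.mark.map t.word = t.markWord := by
  rcases t with _ | ⟨s, _ | p, ch⟩ <;> rfl

theorem sum_word : ∀ (t : Tree) [Fintype t.Vtx],
    ∑ x, ({t.word x} : Multiset (List Letter)) = t.necklaces
  | leaf, _ => Finset.sum_eq_zero fun x => x.elim
  | node s p ch, I => by
    have : ∀ q, Fintype (ch q).Vtx := fun q => Fintype.ofFinite _
    rw [Subsingleton.elim I (inferInstanceAs (Fintype (Option (Σ q : Pos s, (ch q).Vtx))))]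
    refine (Fintype.sum_option (α := Σ q : Pos s, (ch q).Vtx) _).trans ?_
    rw [Fintype.sum_sigma]
    exact congrArg _ (Finset.sum_congr rfl fun q _ => sum_word (ch q))

/-- The decorated graph described by a tree. -/
noncomputable def model (t : Tree) (h : t.WF) : Decorated where
  size := Nat.card t.Vtx
  graph := (t.graph h).transport (Finite.equivFin t.Vtx).symm
  root := t.root.map ((t.graph h).transportIso (Finite.equivFin t.Vtx).symm).pearl.symm
  mark := t.mark.map (Finite.equivFin t.Vtx)

/-- The isomorphism between the model of a tree and its graph. -/
noncomputable def modelIso (t : Tree) (h : t.WF) : (t.model h).graph.Iso (t.graph h) :=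
  (t.graph h).transportIso (Finite.equivFin t.Vtx).symm

theorem modelIso_root (t : Tree) (h : t.WF) :
    (t.model h).root.map (t.modelIso h).pearl = t.root := by
  change (t.root.map (t.modelIso h).pearl.symm).map (t.modelIso h).pearl = t.root
  rw [Option.map_map, Equiv.self_comp_symm, Option.map_id]
  rfl

theorem modelIso_mark (t : Tree) (h : t.WF) :
    (t.model h).mark.map (t.modelIso h).toEquiv = t.mark := by
  change (t.mark.map (Finite.equivFin t.Vtx)).map (Finite.equivFin t.Vtx).symm = t.mark
  rw [Option.map_map, Equiv.symm_comp_self, Option.map_id]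
  rfl

theorem necklaces_model (t : Tree) (h : t.WF) : (t.model h).necklaces = t.necklaces := by
  have := Fintype.ofFinite t.Vtx
  have word_eq : ∀ x, (t.model h).graph.word x = t.word ((t.modelIso h).toEquiv x) :=
    fun x => ((t.modelIso h).word_eq x).symm
  rw [Decorated.necklaces, ← sum_word, ← Equiv.sum_comp (t.modelIso h).toEquiv,
    ← Multiset.sum_map_singleton (Multiset.map _ _), Multiset.map_map]
  exact Finset.sum_congr rfl fun x _ => by rw [← word_eq]; rfl

theorem markedNecklace_model (t : Tree) (h : t.WF) :
    (t.model h).markedNecklace = t.markWord := by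
  rw [← map_mark_word, ← t.modelIso_mark h, Option.map_map, Decorated.markedNecklace]
  exact congrArg (fun f => Option.map f _) (funext fun x => ((t.modelIso h).word_eq x).symm)

theorem model_iso {t : Tree} {h : t.WF} {A : Decorated} (f : (t.graph h).Iso A.graph)
    (root_eq : t.root.map f.pearl = A.root) (mark_eq : t.mark.map f.toEquiv = A.mark) :
    (t.model h).Iso A := by
  refine Decorated.iso_iff.2 ⟨(t.modelIso h).trans f, ?_, ?_⟩
  · rw [← root_eq, ← t.modelIso_root h, Option.map_map]
    exact congrArg (fun f => Option.map f _) (funext fun x => Iso.pearl_trans _ _ _)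
  · rw [← mark_eq, ← t.modelIso_mark h, Option.map_map]
    rfl

theorem exists_model {A : Decorated} (hA : A.Anchored) :
    ∃ (t : Tree) (h : t.WF), t ≠ leaf ∧ (t.model h).Iso A := by
  obtain ⟨tree, ⟨mark_eq, ⟨v, q⟩, root_eq, free⟩ | ⟨root_eq, hm⟩⟩ := hA
  · obtain ⟨ch, h, f, -, pearl_top⟩ := exists_iso tree v (some q) (by rintro _ ⟨⟩; exact free)
    refine ⟨_, h, nofun, model_iso f ?_ ?_⟩
    · rw [root_eq, ← pearl_top q]; rfl
    · rw [mark_eq]; rfl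
  · obtain ⟨v, mark_eq⟩ := Option.ne_none_iff_exists'.1 hm
    obtain ⟨ch, h, f, top_eq, -⟩ := exists_iso tree v none nofun
    refine ⟨_, h, nofun, model_iso f ?_ ?_⟩
    · rw [root_eq]; rfl
    · exact (congrArg some top_eq).trans mark_eq.symm

/-- An isomorphism onto the graph of a tree as an immersion. -/
noncomputable def immersionOfIso {V : Type} {G : Graph V} {t : Tree} {h : t.WF}
    (f : (t.graph h).Iso G) : t.Immersion h G :=
  ⟨f.toEquiv, f.word_eq, fun y _ => f.map_mate y⟩

theorem map_rootNode_immersionOfIso {V : Type} {G : Graph V} {t : Tree} {h : t.WF}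
    (f : (t.graph h).Iso G) :
    t.rootNode.map (Sum.map (immersionOfIso f).toFun (immersionOfIso f).pearl) =
      ((t.mark.map f.toEquiv).map Sum.inl <|> (t.root.map f.pearl).map Sum.inr) := by
  rcases t with _ | ⟨s, _ | p, ch⟩ <;> rfl

theorem map_rootNode_modelIso {t t' : Tree} {h : t.WF} {h' : t'.WF}
    (f : (t.model h).graph.Iso (t'.model h').graph)
    (hr : (t.model h).root.map f.pearl = (t'.model h').root)
    (hm : (t.model h).mark.map f.toEquiv = (t'.model h').mark) :
    t.rootNode.map (Sum.map (immersionOfIso ((t.modelIso h).symm.trans f)).toFun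
        (immersionOfIso ((t.modelIso h).symm.trans f)).pearl) =
      t'.rootNode.map (Sum.map (immersionOfIso (t'.modelIso h').symm).toFun
        (immersionOfIso (t'.modelIso h').symm).pearl) := by
  have root_eq : t.root.map ((t.modelIso h).symm.trans f).pearl =
      t'.root.map (t'.modelIso h').symm.pearl := by
    rw [← t.modelIso_root h, ← t'.modelIso_root h', Option.map_map, Option.map_map, ← hr,
      Option.map_map]
    refine congrArg (fun f => Option.map f _) (funext fun x => ?_)
    simp [Iso.pearl_trans, Iso.pearl_symm]
  have mark_eq : t.mark.map ((t.modelIso h).symm.trans f).toEquiv =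
      t'.mark.map (t'.modelIso h').symm.toEquiv := by
    rw [← t.modelIso_mark h, ← t'.modelIso_mark h', Option.map_map, Option.map_map, ← hm,
      Option.map_map]
    refine congrArg (fun f => Option.map f _) (funext fun x => ?_)
    simp [Iso.trans, Iso.symm]
  rw [map_rootNode_immersionOfIso, map_rootNode_immersionOfIso, root_eq, mark_eq]

theorem eq_of_model_iso {t t' : Tree} {h : t.WF} {h' : t'.WF}
    (hi : (t.model h).Iso (t'.model h')) : t = t' := by
  obtain ⟨f, hr, hm⟩ := Decorated.iso_iff.1 hi
  exact eq_of_immersion (immersionOfIso ((t.modelIso h).symm.trans f))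
    (immersionOfIso (t'.modelIso h').symm) (Equiv.injective _) (Equiv.injective _)
    (map_rootNode_modelIso f hr hm)

theorem Immersion.toFun_ext {V : Type} {G : Graph V} : ∀ {t : Tree} {h : t.WF}
    (f f' : t.Immersion h G),
    t.rootNode.map (Sum.map f.toFun f.pearl) = t.rootNode.map (Sum.map f'.toFun f'.pearl) →
    f.toFun = f'.toFun
  | .leaf, _, _, _, _ => funext Empty.rec
  | node s p ch, h, f, f', e => by
    have top_eq := Immersion.toFun_none_eq e
    funext x
    rcases x with _ | ⟨q, x⟩
    · exact top_eq
    refine congrFun (Immersion.toFun_ext (f.child q) (f'.child q) ?_) x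
    have hq : p ≠ some q := by
      intro hq
      rw [h.1 q hq] at x
      exact Empty.elim x
    have mate_eq := (f.mate_pearl_top hq).symm.trans
      ((congrArg G.mate (f.pearl_top_eq f' top_eq q)).trans (f'.mate_pearl_top hq))
    rw [h.rootNode_child]
    cases hr : (ch q).root with
    | none => rfl
    | some y =>
      rw [hr] at mate_eq
      exact congrArg (some ∘ Sum.inr) mate_eq

theorem toEquiv_eq_refl {t : Tree} {h : t.WF} (f : (t.model h).graph.Iso (t.model h).graph)
    (hr : (t.model h).root.map f.pearl = (t.model h).root)
    (hm : (t.model h).mark.map f.toEquiv = (t.model h).mark) : f.toEquiv = Equiv.refl _ := by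
  have toFun_eq : f.toEquiv ∘ (t.modelIso h).toEquiv.symm = (t.modelIso h).toEquiv.symm :=
    Immersion.toFun_ext (immersionOfIso ((t.modelIso h).symm.trans f))
      (immersionOfIso (t.modelIso h).symm) (map_rootNode_modelIso f hr hm)
  ext1 v
  simpa using congrFun toFun_eq ((t.modelIso h).toEquiv v)

end Tree
end Necklace

/-! ### Subtrees and excess -/

namespace Necklace

theorem Graph.mem_subtree_iff_of_isPath {V : Type} {G : Graph V} (hG : G.incidence.IsAcyclic)
    {r x y : Pearl G.word} {w : G.incidence.Walk (.inr r) (.inr y)} (hw : w.IsPath) :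
    y ∈ G.subtree r x ↔ .inr x ∈ w.support := by
  classical
  refine ⟨fun hy => hy w, fun hx w' => w'.support_bypass_subset_support ?_⟩
  have unique : w = w'.bypass :=
    congrArg Subtype.val ((hG.subsingleton_path _ _).elim ⟨w, hw⟩ w'.toPath)
  exact unique ▸ hx

namespace Tree

theorem ne_leaf_of_root {t : Tree} {y} (h : t.root = some y) : t ≠ leaf := by
  rintro rfl
  cases h

section
variable {s : List Letter} {p : Pos s} {ch : Pos s → Tree}

theorem lift_ne_lift {p : Option (Pos s)} {q q' : Pos s} (hq : q ≠ q') (y : Pearl (ch q).word)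
    (z : Pearl (ch q').word) : lift (p := p) q y ≠ lift q' z := by
  intro e
  have e := congrArg Sigma.fst e
  injection e with e
  injection e with e
  exact hq e

variable (h : (node s (some p) ch).WF)

theorem liftHom_injective (q : Pos s) : Function.Injective (liftHom h q) := by
  rintro (v | y) (w | z) e
  · have e := Sum.inl.inj e
    injection e with e
    injection e with _ e
    rw [e]
  · exact nomatch e
  · exact nomatch e
  · exact congrArg Sum.inr (lift_injective q (Sum.inr.inj e))

theorem liftHom_ne_top (q q' : Pos s) (x) : liftHom h q x ≠ .inr (top q') := by
  rcases x with v | y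
  · exact nofun
  · exact fun e => lift_ne_top _ _ _ (Sum.inr.inj e)

theorem liftHom_ne_none (q : Pos s) (x) : liftHom h q x ≠ .inl none := by
  rcases x with v | y
  · exact fun e => nomatch Sum.inl.inj e
  · exact nofun

theorem lift_mem_map_liftHom {q q' : Pos s} {x : Pearl (ch q).word}
    {l : List ((ch q').Vtx ⊕ Pearl (ch q').word)} (hx : .inr (lift q x) ∈ l.map (liftHom h q')) :
    q = q' := by
  obtain ⟨v | y, -, e⟩ := List.mem_map.1 hx
  · exact nomatch e
  · by_contra hq
    exact lift_ne_lift hq _ _ (Sum.inr.inj e).symm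

theorem exists_isPath_top {q : Pos s} (hq : p ≠ q) :
    ∃ w : ((node s (some p) ch).graph h).incidence.Walk (.inr (top p)) (.inr (top q)),
      w.IsPath ∧ w.support = [.inr (top p), .inl none, .inr (top q)] := by
  refine ⟨.cons (adj_top h p).symm (.cons (adj_top h q) .nil), ?_, rfl⟩
  simpa [SimpleGraph.Walk.cons_isPath_iff, top_inj] using hq

theorem exists_isPath_lift {q : Pos s} {r y : Pearl (ch q).word} (hr : (ch q).root = some r)
    {w : ((ch q).graph (h.child q)).incidence.Walk (.inr r) (.inr y)} (hw : w.IsPath) :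
    ∃ w' : ((node s (some p) ch).graph h).incidence.Walk (.inr (top p)) (.inr (lift q y)),
      w'.IsPath ∧ w'.support =
        .inr (top p) :: .inl none :: .inr (top q) :: w.support.map (liftHom h q) := by
  have hpq : p ≠ q := by
    rintro rfl
    exact ne_leaf_of_root hr (h.1 p rfl)
  have support_eq := congrArg (fun l : List ((node s (some p) ch).Vtx ⊕ Pearl _) =>
    .inr (top p) :: .inl none :: .inr (top q) :: l) (SimpleGraph.Walk.support_map (liftHom h q) w)
  refine ⟨.cons (adj_top h p).symm (.cons (adj_top h q)
    (.cons (adj_top_lift h hr) (w.map (liftHom h q)))), .mk' ?_, support_eq⟩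
  refine (congrArg List.Nodup support_eq).mpr ?_
  have nodup := hw.support_nodup.map (liftHom_injective h q)
  simp [nodup, liftHom_ne_top, liftHom_ne_none, top_inj, hpq]

theorem top_mem_subtree_top {q q' : Pos s} (hq : p ≠ q) :
    top q' ∈ ((node s (some p) ch).graph h).subtree (top p) (top q) ↔ q' = q := by
  by_cases hq' : p = q'
  · subst hq'
    rw [Graph.mem_subtree_iff_of_isPath (isTree h).isAcyclic SimpleGraph.Walk.IsPath.nil]
    exact ⟨fun hx => top_inj.1 (Sum.inr.inj (List.mem_singleton.1 hx).symm), fun e => absurd e hq⟩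
  · obtain ⟨w, hw, hsupport⟩ := exists_isPath_top h hq'
    rw [Graph.mem_subtree_iff_of_isPath (isTree h).isAcyclic hw, hsupport]
    simp [top_inj, hq.symm, eq_comm (a := q)]

theorem lift_mem_subtree_top {q q' : Pos s} (hq : p ≠ q) (y : Pearl (ch q').word) :
    lift q' y ∈ ((node s (some p) ch).graph h).subtree (top p) (top q) ↔ q' = q := by
  obtain ⟨r, hr⟩ := h.exists_root q' y.1
  obtain ⟨w, hw⟩ := (preconnected (h.child q') (.inr r) (.inr y)).exists_isPath
  obtain ⟨w', hw', hsupport⟩ := exists_isPath_lift h hr hw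
  rw [Graph.mem_subtree_iff_of_isPath (isTree h).isAcyclic hw', hsupport]
  have notMem_map : .inr (top q) ∉ w.support.map (liftHom h q') := fun hx => by
    obtain ⟨x, -, e⟩ := List.mem_map.1 hx
    exact liftHom_ne_top h q' q x e
  simp [-List.mem_map, notMem_map, top_inj, hq.symm, eq_comm (a := q)]

theorem top_notMem_subtree_lift {q q' : Pos s} (x : Pearl (ch q).word) :
    top q' ∉ ((node s (some p) ch).graph h).subtree (top p) (lift q x) := by
  by_cases hq' : p = q'
  · subst hq'
    rw [Graph.mem_subtree_iff_of_isPath (isTree h).isAcyclic SimpleGraph.Walk.IsPath.nil]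
    exact fun hx => lift_ne_top _ _ _ (Sum.inr.inj (List.mem_singleton.1 hx))
  · obtain ⟨w, hw, hsupport⟩ := exists_isPath_top h hq'
    rw [Graph.mem_subtree_iff_of_isPath (isTree h).isAcyclic hw, hsupport]
    simp [lift_ne_top]

theorem lift_mem_subtree_lift_iff {q q' : Pos s} {r : Pearl (ch q').word}
    (hr : (ch q').root = some r) (x : Pearl (ch q).word) {y : Pearl (ch q').word}
    {w : ((ch q').graph (h.child q')).incidence.Walk (.inr r) (.inr y)} (hw : w.IsPath) :
    lift q' y ∈ ((node s (some p) ch).graph h).subtree (top p) (lift q x) ↔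
      .inr (lift q x) ∈ w.support.map (liftHom h q') := by
  obtain ⟨w', hw', hsupport⟩ := exists_isPath_lift h hr hw
  rw [Graph.mem_subtree_iff_of_isPath (isTree h).isAcyclic hw', hsupport]
  simp [lift_ne_top]

theorem lift_mem_subtree_lift {q : Pos s} {r : Pearl (ch q).word} (hr : (ch q).root = some r)
    (x y : Pearl (ch q).word) :
    lift q y ∈ ((node s (some p) ch).graph h).subtree (top p) (lift q x) ↔
      y ∈ ((ch q).graph (h.child q)).subtree r x := by
  obtain ⟨w, hw⟩ := (preconnected (h.child q) (.inr r) (.inr y)).exists_isPath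
  rw [lift_mem_subtree_lift_iff h hr x hw, Graph.mem_subtree_iff_of_isPath _ hw]
  · exact List.mem_map_of_injective (a := .inr x) (liftHom_injective h q)
  · exact (isTree h).isAcyclic.comap (liftHom h q) (liftHom_injective h q)

theorem lift_notMem_subtree_lift {q q' : Pos s} (hq : q' ≠ q) (x : Pearl (ch q).word)
    (y : Pearl (ch q').word) :
    lift q' y ∉ ((node s (some p) ch).graph h).subtree (top p) (lift q x) := by
  obtain ⟨r, hr⟩ := h.exists_root q' y.1
  obtain ⟨w, hw⟩ := (preconnected (h.child q') (.inr r) (.inr y)).exists_isPath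
  rw [lift_mem_subtree_lift_iff h hr x hw]
  exact fun hx => hq (lift_mem_map_liftHom h hx).symm

end
end Tree

/-- The contribution of a pearl of a given kind to the excess. -/
def Kind.exc : Kind → ℤ
  | some .triangle => 1
  | some .diamond => -1
  | _ => 0

open Classical in
theorem Graph.excess_eq_sum {V : Type} (G : Graph V) [Fintype (Pearl G.word)] (r x : Pearl G.word) :
    G.excess r x = ∑ y, if y ∈ G.subtree r x then Kind.exc (G.kind y) else 0 := by
  have ncard_eq_sum : ∀ k, ({y ∈ G.subtree r x | G.kind y = k}.ncard : ℤ) =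
      ∑ y, if y ∈ G.subtree r x ∧ G.kind y = k then (1 : ℤ) else 0 := fun k => by
    rw [Set.ncard_eq_toFinset_card', Finset.sum_boole]
    congr 2
    ext
    simp
  rw [excess, ncard_eq_sum, ncard_eq_sum, ← Finset.sum_sub_distrib]
  refine Finset.sum_congr rfl fun y _ => ?_
  by_cases hy : y ∈ G.subtree r x
  · rcases G.kind y with _ | _ | _ | _ <;> simp [hy, Kind.exc]
  · simp [hy]

namespace Tree

noncomputable instance (t : Tree) : Fintype t.Vtx := Fintype.ofFinite _

/-- The pearls of a tree are those of the top necklace and those of the attached trees. -/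
noncomputable def pearlEquiv {s : List Letter} {p : Option (Pos s)} {ch : Pos s → Tree} :
    Pos s ⊕ (Σ q, Pearl (ch q).word) ≃ Pearl (node s p ch).word :=
  .ofBijective (Sum.elim top fun x => lift x.1 x.2) <| by
    constructor
    · rintro (q | ⟨q, y⟩) (q' | ⟨q', z⟩) h
      · exact congrArg Sum.inl (top_inj.1 h)
      · exact absurd h.symm (lift_ne_top _ _ _)
      · exact absurd h (lift_ne_top _ _ _)
      · obtain rfl : q = q' := by_contra fun hq => lift_ne_lift hq _ _ h
        exact congrArg (fun y => Sum.inr (Sigma.mk q y)) (lift_injective q h)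
    · intro y
      induction y using pearl_cases with
      | top q => exact ⟨.inl q, rfl⟩
      | lift q y => exact ⟨.inr ⟨q, y⟩, rfl⟩

theorem sum_pearl {M : Type*} [AddCommMonoid M] {s : List Letter} {p : Option (Pos s)}
    {ch : Pos s → Tree} (g : Pearl (node s p ch).word → M) :
    ∑ y, g y = ∑ q, (g (top q) + ∑ y : Pearl (ch q).word, g (lift q y)) := by
  rw [← Equiv.sum_comp pearlEquiv, Fintype.sum_sum_type, Fintype.sum_sigma, Finset.sum_add_distrib]
  rfl

/-- The number of `▲`-pearls minus the number of `♦`-pearls of a tree. -/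
def exc : Tree → ℤ
  | leaf => 0
  | node s _ ch => ∑ q, (Kind.exc (posKind s q) + (ch q).exc)

/-- The kind of a pearl of a tree. -/
def pearlKind (t : Tree) (y : Pearl t.word) : Kind := posKind (t.word y.1) y.2

theorem sum_exc : ∀ t : Tree, ∑ y, Kind.exc (t.pearlKind y) = t.exc
  | leaf => Finset.sum_eq_zero fun y _ => y.1.elim
  | node s p ch => by
    rw [sum_pearl]
    refine Finset.sum_congr rfl fun q _ => ?_
    rw [← sum_exc (ch q)]
    rfl

/-- All pearls of the tree have non-negative excess. -/
def Nonneg : Tree → Prop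
  | leaf => True
  | node s p ch => 0 ≤ (node s p ch).exc ∧
      ∀ q, p ≠ some q → 0 ≤ Kind.exc (posKind s q) + (ch q).exc ∧ (ch q).Nonneg

theorem excess_root {t : Tree} (h : t.WF) (r : Pearl t.word) : (t.graph h).excess r r = t.exc := by
  classical
  rw [Graph.excess_eq_sum, ← sum_exc]
  exact Finset.sum_congr rfl fun y _ => if_pos fun w => w.start_mem_support

section
variable {s : List Letter} {p : Pos s} {ch : Pos s → Tree} (h : (node s (some p) ch).WF)

theorem excess_top {q : Pos s} (hq : p ≠ q) :
    ((node s (some p) ch).graph h).excess (top p) (top q) =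
      Kind.exc (posKind s q) + (ch q).exc := by
  classical
  rw [Graph.excess_eq_sum, sum_pearl, Finset.sum_eq_single q]
  · simp only [top_mem_subtree_top h hq, lift_mem_subtree_top h hq, if_true, ← sum_exc (ch q)]
    rfl
  · intro q' _ hq'
    simp [top_mem_subtree_top h hq, lift_mem_subtree_top h hq, hq']
  · simp

theorem excess_lift {q : Pos s} {r : Pearl (ch q).word} (hr : (ch q).root = some r)
    (x : Pearl (ch q).word) : ((node s (some p) ch).graph h).excess (top p) (lift q x) =
      ((ch q).graph (h.child q)).excess r x := by
  classical
  rw [Graph.excess_eq_sum, sum_pearl, Finset.sum_eq_single q]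
  · rw [if_neg (top_notMem_subtree_lift h x), zero_add, Graph.excess_eq_sum]
    exact Finset.sum_congr rfl fun y _ => if_congr (lift_mem_subtree_lift h hr x y) rfl rfl
  · intro q' _ hq'
    simp [top_notMem_subtree_lift h, lift_notMem_subtree_lift h hq']
  · simp

end

theorem nonneg_iff : ∀ {t : Tree} (h : t.WF) {r : Pearl t.word}, t.root = some r →
    ((∀ x, 0 ≤ (t.graph h).excess r x) ↔ t.Nonneg)
  | leaf, _, r, _ => r.1.elim
  | node s none ch, _, _, hr => nomatch hr
  | node s (some p) ch, h, r, hr => by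
    obtain rfl : top p = r := Option.some.inj hr
    constructor
    · refine fun hx => ⟨excess_root h (top p) ▸ hx (top p), fun q hq => ⟨?_, ?_⟩⟩
      · exact excess_top h (fun e => hq (congrArg some e)) ▸ hx (top q)
      · cases hr : (ch q).root with
        | none =>
          rw [(h.2 q).resolve_right fun hc => hc.1 hr]
          trivial
        | some y => exact (nonneg_iff (h.child q) hr).1 fun x => excess_lift h hr x ▸ hx (lift q x)
    · rintro ⟨exc_nonneg, child_nonneg⟩ x
      induction x using pearl_cases with
      | top q =>
        by_cases hq : p = q
        · subst hq
          rwa [excess_root]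
        · rw [excess_top h hq]
          exact (child_nonneg q fun e => hq (Option.some.inj e)).1
      | lift q x =>
        obtain ⟨y, hy⟩ := h.exists_root q x.1
        rw [excess_lift h hy]
        exact (nonneg_iff (h.child q) hy).2
          (child_nonneg q fun e => ne_leaf_of_root hy (h.1 q e)).2 x

end Tree
end Necklace

/-! ### Conditions on the edges and the free pearls -/

namespace Necklace

/-- The local conditions on a necklace graph with an optional root pearl `r`: its necklaces are in
`Q`, its free pearls other than the root are of kinds in `A`, and its edges join pearls whose kinds
are related by `E`. -/
structure Graph.IsLocal {V : Type} (G : Graph V) (Q : Set (List Letter)) (A : Set Kind)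
    (E : Kind → Kind → Prop) (r : Option (Pearl G.word)) : Prop where
  word_mem : ∀ v, G.word v ∈ Q
  free : ∀ y, G.Free y → r ≠ some y → G.kind y ∈ A
  edge : ∀ y, ¬ G.Free y → E (G.kind y) (G.kind (G.mate y))

namespace Tree

theorem mark_of_root {t : Tree} {y} (h : t.root = some y) : t.mark = none := by
  rcases t with _ | ⟨s, _ | p, ch⟩
  · rfl
  · cases h
  · rfl

theorem mark_ne_none {t : Tree} (hl : t ≠ leaf) (h : t.root = none) : t.mark ≠ none := by
  rcases t with _ | ⟨s, _ | p, ch⟩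
  · exact absurd rfl hl
  · exact nofun
  · cases h

/-- The kind of the root pearl. -/
def rootKind : Tree → Option Kind
  | leaf => none
  | node s p _ => p.map (posKind s)

theorem map_pearlKind_root (t : Tree) : t.root.map t.pearlKind = t.rootKind := by
  rcases t with _ | ⟨s, _ | p, ch⟩ <;> rfl

theorem rootKind_eq_some_iff {t : Tree} {k : Kind} :
    t.rootKind = some k ↔ ∃ y, t.root = some y ∧ t.pearlKind y = k := by
  rw [← map_pearlKind_root, Option.map_eq_some_iff]

theorem rootKind_eq_none_iff {t : Tree} : t.rootKind = none ↔ t.root = none := by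
  rw [← map_pearlKind_root, Option.map_eq_none_iff]

/-- The local conditions of `Graph.IsLocal`, stated recursively. -/
def IsLocal (Q : Set (List Letter)) (A : Set Kind) (E : Kind → Kind → Prop) : Tree → Prop
  | leaf => False
  | node s p ch => s ∈ Q ∧ ∀ q, (p = some q → ch q = leaf) ∧
      (p ≠ some q → (ch q = leaf ∧ posKind s q ∈ A) ∨
        ∃ k, (ch q).rootKind = some k ∧ E (posKind s q) k ∧ (ch q).IsLocal Q A E)

variable {Q : Set (List Letter)} {A : Set Kind} {E : Kind → Kind → Prop}

theorem IsLocal.ne_leaf {t : Tree} (h : t.IsLocal Q A E) : t ≠ leaf := by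
  rintro rfl; exact h

theorem IsLocal.wf : ∀ {t : Tree}, t.IsLocal Q A E → t.WF
  | leaf, _ => trivial
  | node s p ch, h => by
    refine ⟨fun q => (h.2 q).1, fun q => ?_⟩
    by_cases hq : p = some q
    · exact .inl ((h.2 q).1 hq)
    · rcases (h.2 q).2 hq with ⟨hl, -⟩ | ⟨k, hk, -, hlocal⟩
      · exact .inl hl
      · obtain ⟨y, hy, -⟩ := rootKind_eq_some_iff.1 hk
        exact .inr ⟨Option.ne_none_iff_exists'.2 ⟨y, hy⟩, hlocal.wf⟩

section
variable {s : List Letter} {p : Option (Pos s)} {ch : Pos s → Tree}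

theorem IsLocal.child (h : (node s p ch).IsLocal Q A E) {q : Pos s} {y}
    (hy : (ch q).root = some y) :
    E (posKind s q) ((ch q).pearlKind y) ∧ (ch q).IsLocal Q A E := by
  have hl : ch q ≠ leaf := ne_leaf_of_root hy
  rcases (h.2 q).2 fun e => hl ((h.2 q).1 e) with h | ⟨k, hk, hE, hlocal⟩
  · exact absurd h.1 hl
  · rw [← map_pearlKind_root, hy] at hk
    exact ⟨Option.some.inj hk ▸ hE, hlocal⟩

theorem isLocal_graph_child {h : (node s p ch).WF}
    (hG : ((node s p ch).graph h).IsLocal Q A E (node s p ch).root) (q : Pos s) :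
    ((ch q).graph (h.child q)).IsLocal Q A E (ch q).root where
  word_mem v := hG.word_mem (some ⟨q, v⟩)
  free y hy hr := hG.free (lift q y) ((mate_lift hr).trans (congrArg _ hy)) (root_ne_lift q y)
  edge y hy := by
    have hr : (ch q).root ≠ some y := fun e => hy (root_free (h.child q) e)
    have mate_eq : ((node s p ch).graph h).mate (lift q y) = _ := mate_lift hr
    have edge := hG.edge (lift q y)
    rw [Graph.Free, mate_eq] at edge
    exact edge fun e => hy (lift_injective q e)

theorem isLocal_of_graph : ∀ {t : Tree} {h : t.WF}, t ≠ leaf →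
    (t.graph h).IsLocal Q A E t.root → t.IsLocal Q A E
  | leaf, _, hl, _ => absurd rfl hl
  | node s p ch, h, _, hG => by
    refine ⟨hG.word_mem none, fun q => ⟨h.1 q, fun hq => ?_⟩⟩
    cases hr : (ch q).root with
    | none =>
      exact .inl ⟨(h.2 q).resolve_right fun hc => hc.1 hr,
        hG.free (top q) (mate_top_none hr) (root_ne_top hq)⟩
    | some y =>
      refine .inr ⟨_, rootKind_eq_some_iff.2 ⟨y, hr, rfl⟩, ?_,
        isLocal_of_graph (ne_leaf_of_root hr) (isLocal_graph_child hG q)⟩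
      have mate_eq : ((node s p ch).graph h).mate (top q) = _ := mate_top_some hr
      have edge := hG.edge (top q)
      rw [Graph.Free, mate_eq] at edge
      exact edge (lift_ne_top _ _ _)

theorem edge_graph_node {h : (node s p ch).WF} (hlocal : (node s p ch).IsLocal Q A E)
    (hE : ∀ k k', E k k' → E k' k)
    (ih : ∀ q, (ch q).IsLocal Q A E → ((ch q).graph (h.child q)).IsLocal Q A E (ch q).root)
    (y : Pearl (node s p ch).word) (hy : ¬ ((node s p ch).graph h).Free y) :
    E (((node s p ch).graph h).kind y)
      (((node s p ch).graph h).kind (((node s p ch).graph h).mate y)) := by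
  induction y using pearl_cases with
  | top q =>
    cases hr : (ch q).root with
    | none => exact absurd (mate_top_none hr) hy
    | some y =>
      have mate_eq : ((node s p ch).graph h).mate (top q) = _ := mate_top_some hr
      rw [mate_eq]
      exact (hlocal.child hr).1
  | lift q y =>
    by_cases hr : (ch q).root = some y
    · have mate_eq : ((node s p ch).graph h).mate (lift q y) = _ := mate_lift_root hr
      rw [mate_eq]
      exact hE _ _ (hlocal.child hr).1
    · have mate_eq : ((node s p ch).graph h).mate (lift q y) = _ := mate_lift hr
      rw [Graph.Free, mate_eq] at hy
      rw [mate_eq]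
      obtain ⟨r, root_eq⟩ := h.exists_root q y.1
      exact (ih q (hlocal.child root_eq).2).edge y fun e => hy (congrArg _ e)

theorem isLocal_graph_node {h : (node s p ch).WF} (hlocal : (node s p ch).IsLocal Q A E)
    (hE : ∀ k k', E k k' → E k' k)
    (ih : ∀ q, (ch q).IsLocal Q A E → ((ch q).graph (h.child q)).IsLocal Q A E (ch q).root) :
    ((node s p ch).graph h).IsLocal Q A E (node s p ch).root := by
  refine ⟨?_, fun y => ?_, fun y => ?_⟩
  · rintro (_ | ⟨q, v⟩)
    · exact hlocal.1
    · obtain ⟨y, hy⟩ := h.exists_root q v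
      exact (ih q (hlocal.child hy).2).word_mem v
  · induction y using pearl_cases with
    | top q =>
      intro hfree hr
      rcases (hlocal.2 q).2 (by rintro rfl; exact hr rfl) with ⟨-, hA⟩ | ⟨k, hk, -, -⟩
      · exact hA
      · obtain ⟨y, hy, -⟩ := rootKind_eq_some_iff.1 hk
        exact absurd ((mate_top_some hy).symm.trans hfree) (lift_ne_top _ _ _)
    | lift q y =>
      intro hfree _
      obtain ⟨r, hr⟩ := h.exists_root q y.1
      have hy : (ch q).root ≠ some y := fun e =>
        lift_ne_top _ _ _ (hfree.symm.trans (mate_lift_root e))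
      exact (ih q (hlocal.child hr).2).free y
        (lift_injective q ((mate_lift hy).symm.trans hfree)) hy
  · exact edge_graph_node hlocal hE ih y

theorem IsLocal.graph (hE : ∀ k k', E k k' → E k' k) : ∀ {t : Tree} {h : t.WF},
    t.IsLocal Q A E → (t.graph h).IsLocal Q A E t.root
  | leaf, _, hlocal => hlocal.elim
  | node _ _ _, _, hlocal => isLocal_graph_node hlocal hE fun _ hc => hc.graph hE

theorem isLocal_graph_iff (hE : ∀ k k', E k k' → E k' k) {t : Tree} {h : t.WF} (hl : t ≠ leaf) :
    (t.graph h).IsLocal Q A E t.root ↔ t.IsLocal Q A E :=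
  ⟨isLocal_of_graph hl, fun hlocal => hlocal.graph hE⟩

theorem isTree_of_ne_leaf {t : Tree} (h : t.WF) (hl : t ≠ leaf) :
    (t.graph h).incidence.IsTree := by
  cases t with
  | leaf => exact absurd rfl hl
  | node s p ch => exact isTree h

end
end Tree
end Necklace

namespace Necklace

open Necklace.Graph

/-- A property of necklace graphs with possibly a root pearl and possibly a marked necklace. -/
abbrev GraphProp : Type 1 := ∀ ⦃V : Type⦄ (G : Graph V), Option (Pearl G.word) → Option V → Prop

/-- Invariance of a property under isomorphisms. -/
def GraphProp.Invariant (P : GraphProp) : Prop :=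
  ∀ ⦃V W : Type⦄ ⦃G : Graph V⦄ ⦃H : Graph W⦄ (f : G.Iso H) (r : Option (Pearl G.word))
    (m : Option V), P H (r.map f.pearl) (m.map f.toEquiv) ↔ P G r m

theorem IsoClass.exists_equiv_tree {P : Decorated → Prop} (P' : GraphProp)
    (hP : ∀ A : Decorated, P A ↔ P' A.graph A.root A.mark) (hinv : P'.Invariant)
    (hA : ∀ A, P A → A.Anchored) (T : Tree → Prop) (hT : ∀ t, T t → t.WF ∧ t ≠ .leaf)
    (hPT : ∀ (t : Tree) (h : t.WF), t ≠ .leaf → (P' (t.graph h) t.root t.mark ↔ T t)) :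
    ∃ e : IsoClass P ≃ {t // T t}, ∀ c, (e c).1.necklaces = c.necklaces ∧
      (e c).1.markWord = c.markedNecklace := by
  have model_iff : ∀ (t : Tree) (h : t.WF), t ≠ .leaf → (P (t.model h) ↔ T t) := fun t h hl => by
    rw [hP, ← hinv (t.modelIso h), t.modelIso_root, t.modelIso_mark, hPT t h hl]
  have of_iso : ∀ {A B : Decorated}, A.Iso B → P B → P A := fun {A B} h hB => by
    obtain ⟨f, root_eq, mark_eq⟩ := Decorated.iso_iff.1 h
    rwa [hP, ← hinv f, root_eq, mark_eq, ← hP]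
  let model : {t // T t} → IsoClass P := fun t =>
    Quotient.mk _ ⟨t.1.model (hT _ t.2).1, (model_iff _ _ (hT _ t.2).2).2 t.2⟩
  have bijective : Function.Bijective model := by
    refine ⟨fun t t' h => Subtype.ext (Tree.eq_of_model_iso (Quotient.exact h)), fun c => ?_⟩
    induction c using Quotient.ind with
    | _ A =>
      obtain ⟨t, h, hl, hi⟩ := Tree.exists_model (hA A.1 A.2)
      exact ⟨⟨t, (model_iff t h hl).1 (of_iso hi A.2)⟩, Quotient.sound hi⟩
  refine ⟨(Equiv.ofBijective model bijective).symm, fun c => ?_⟩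
  obtain ⟨t, rfl⟩ := bijective.2 c
  rw [(Equiv.ofBijective_symm_apply_apply model bijective t :)]
  exact ⟨(t.1.necklaces_model _).symm, (t.1.markedNecklace_model _).symm⟩

/-- Pearls of the two kinds can be joined by an edge of one of the listed types. -/
def EdgeRel (l : List (Kind × Kind)) (k k' : Kind) : Prop := (k, k') ∈ l ∨ (k', k) ∈ l

theorem EdgeRel.symm {l : List (Kind × Kind)} {k k' : Kind} (h : EdgeRel l k k') :
    EdgeRel l k' k := Or.symm h

/-- The relation between the ends of an edge in companion trees. -/
abbrev companionRel : Kind → Kind → Prop :=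
  EdgeRel [(some .bullet, none), (some .diamond, some .triangle)]

/-- The relation between the ends of an edge in `Q`-trees. -/
abbrev treeRel : Kind → Kind → Prop := EdgeRel [(some .bullet, none), (some .diamond, none)]

section
variable {V : Type} {G : Graph V} {Q : Set (List Letter)}

theorem eq_none_iff_ne_some {k : Kind} :
    k = none ↔ k ≠ some .triangle ∧ k ≠ some .bullet ∧ k ≠ some .diamond := by
  rcases k with _ | _ | _ | _ <;> simp

theorem Graph.isCompanion_without_defects_iff {r : Option (Pearl G.word)} :
    ((∀ p, ¬ G.IsDefect r p) ∧ G.IsCompanion Q ∧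
        ∀ p, G.Free p → r ≠ some p → G.kind p ≠ some .bullet ∧ G.kind p ≠ some .diamond) ↔
      G.incidence.IsTree ∧ G.IsLocal Q {none} companionRel r := by
  constructor
  · rintro ⟨no_defect, hc, free_kind⟩
    refine ⟨hc.tree, hc.word_mem, fun y hy hr => ?_, hc.edges⟩
    exact eq_none_iff_ne_some.2 ⟨fun hk => no_defect y ⟨hy, hk, hr⟩, free_kind y hy hr⟩
  · rintro ⟨tree, hlocal⟩
    have free_kind := fun p hp hr => eq_none_iff_ne_some.1 (hlocal.free p hp hr)
    exact ⟨fun p hp => (free_kind p hp.1 hp.2.2).1 hp.2.1,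
      ⟨tree, hlocal.word_mem, hlocal.edge⟩, fun p hp hr => (free_kind p hp hr).2⟩

theorem Graph.isRootedCompanion_without_defects_iff {y : Pearl G.word} :
    ((∀ p, ¬ G.IsDefect (some y) p) ∧ G.IsRootedCompanion Q y) ↔
      G.incidence.IsTree ∧ G.Free y ∧ G.IsLocal Q {none} companionRel (some y) := by
  rw [and_left_comm, ← isCompanion_without_defects_iff]
  constructor
  · exact fun h => ⟨h.2.root_free, h.1, h.2.toIsCompanion,
      fun p hp hne => h.2.free_kind p hp fun e => hne (e ▸ rfl)⟩
  · exact fun h => ⟨h.2.1, h.2.2.1, h.1, fun p hp hne =>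
      h.2.2.2 p hp fun e => hne (Option.some.inj e).symm⟩

theorem Graph.isUnrootedCompanion_without_defects_iff :
    ((∀ p, ¬ G.IsDefect none p) ∧ G.IsUnrootedCompanion Q) ↔
      G.incidence.IsTree ∧ G.IsLocal Q {none} companionRel none := by
  rw [← isCompanion_without_defects_iff]
  exact ⟨fun h => ⟨h.1, h.2.toIsCompanion, fun p hp _ => h.2.free_kind p hp⟩,
    fun h => ⟨h.1, h.2.1, fun p hp => h.2.2 p hp nofun⟩⟩

theorem Graph.isQTree_iff_isLocal {y : Pearl G.word} :
    G.IsQTree Q y ↔ G.incidence.IsTree ∧ G.kind y = none ∧ G.Free y ∧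
      G.IsLocal Q {some .triangle} treeRel (some y) := by
  constructor
  · intro h
    refine ⟨h.tree, h.root_kind, (h.free_iff y).2 (.inl rfl), h.word_mem, fun z hz hr => ?_,
      h.edges⟩
    exact ((h.free_iff z).1 hz).resolve_left fun e => hr (e ▸ rfl)
  · rintro ⟨tree, root_kind, root_free, hlocal⟩
    refine ⟨tree, hlocal.word_mem, hlocal.edge, root_kind, fun p => ⟨fun hp => ?_, ?_⟩⟩
    · exact or_iff_not_imp_left.2 fun hne =>
        hlocal.free p hp fun e => hne (Option.some.inj e).symm
    · rintro (rfl | hk)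
      · exact root_free
      · by_contra hfree
        have edge := hlocal.edge p hfree
        simp [hk, EdgeRel] at edge

end

namespace Tree

/-- Trees that describe companion trees without defects. -/
abbrev IsCompanion (Q : Set (List Letter)) : Tree → Prop := IsLocal Q {none} companionRel

/-- Trees that describe `Q`-trees. -/
abbrev IsQTree (Q : Set (List Letter)) (t : Tree) : Prop :=
  t.IsLocal Q {some .triangle} treeRel ∧ t.rootKind = some none

end Tree

variable (Q : Set (List Letter))

/-- `IsC` as a property of graphs with any type of necklaces. -/
def propC (x : Kind) : GraphProp := fun _ G r m => m = none ∧ (∀ p, ¬ G.IsDefect r p) ∧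
  ∃ y, r = some y ∧ G.kind y = x ∧ G.IsRootedCompanion Q y

/-- `IsMarkedC` as a property of graphs with any type of necklaces. -/
def propMarkedC : GraphProp := fun _ G r m => m ≠ none ∧ r = none ∧ (∀ p, ¬ G.IsDefect none p) ∧
  G.IsUnrootedCompanion Q

/-- `IsF0` as a property of graphs with any type of necklaces. -/
def propF0 : GraphProp := fun _ G r m => m = none ∧
  ∃ y, r = some y ∧ G.IsNonnegQTree Q y ∧ G.excess y y = 0

theorem exists_map_eq_some_and {α β : Type*} (e : α ≃ β) (r : Option α) (P : β → Prop) :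
    (∃ y, r.map e = some y ∧ P y) ↔ ∃ y, r = some y ∧ P (e y) := by
  cases r <;> simp

theorem propC_invariant (x : Kind) : (propC Q x).Invariant := by
  intro V W G H f r m
  simp only [propC, exists_map_eq_some_and, f.isRootedCompanion_iff, f.isDefect_iff,
    f.pearl.surjective.forall, f.kind_pearl, Option.map_eq_none_iff]

theorem propMarkedC_invariant : (propMarkedC Q).Invariant := by
  intro V W G H f r m
  have isDefect_iff := f.isDefect_iff none
  simp only [Option.map_none] at isDefect_iff
  simp only [propMarkedC, f.isUnrootedCompanion_iff, isDefect_iff, f.pearl.surjective.forall, ne_eq,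
    Option.map_eq_none_iff]

theorem propF0_invariant : (propF0 Q).Invariant := by
  intro V W G H f r m
  simp only [propF0, exists_map_eq_some_and, f.isNonnegQTree_iff, f.excess_eq,
    Option.map_eq_none_iff]

variable {Q}

theorem propC_graph_iff (x : Kind) (t : Tree) (h : t.WF) (hl : t ≠ .leaf) :
    propC Q x (t.graph h) t.root t.mark ↔ t.IsCompanion Q ∧ t.rootKind = some x := by
  rw [Tree.IsCompanion, ← Tree.isLocal_graph_iff (fun _ _ => EdgeRel.symm) (h := h) hl,
    Tree.rootKind_eq_some_iff]
  constructor
  · rintro ⟨-, no_defect, y, hy, hk, hc⟩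
    rw [hy] at no_defect ⊢
    exact ⟨(Graph.isRootedCompanion_without_defects_iff.1 ⟨no_defect, hc⟩).2.2, y, rfl, hk⟩
  · rintro ⟨hlocal, y, hy, hk⟩
    rw [hy] at hlocal
    obtain ⟨no_defect, hc⟩ := Graph.isRootedCompanion_without_defects_iff.2
      ⟨Tree.isTree_of_ne_leaf h hl, Tree.root_free h hy, hlocal⟩
    exact ⟨Tree.mark_of_root hy, hy ▸ no_defect, y, hy, hk, hc⟩

theorem propMarkedC_graph_iff (t : Tree) (h : t.WF) (hl : t ≠ .leaf) :
    propMarkedC Q (t.graph h) t.root t.mark ↔ t.IsCompanion Q ∧ t.rootKind = none := by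
  rw [Tree.IsCompanion, ← Tree.isLocal_graph_iff (fun _ _ => EdgeRel.symm) (h := h) hl,
    Tree.rootKind_eq_none_iff]
  constructor
  · rintro ⟨-, hr, hc⟩
    rw [hr]
    exact ⟨(Graph.isUnrootedCompanion_without_defects_iff.1 hc).2, rfl⟩
  · rintro ⟨hlocal, hr⟩
    rw [hr] at hlocal
    exact ⟨Tree.mark_ne_none hl hr, hr, Graph.isUnrootedCompanion_without_defects_iff.2
      ⟨Tree.isTree_of_ne_leaf h hl, hlocal⟩⟩

theorem propF0_graph_iff (t : Tree) (h : t.WF) (hl : t ≠ .leaf) :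
    propF0 Q (t.graph h) t.root t.mark ↔ t.IsQTree Q ∧ t.Nonneg ∧ t.exc = 0 := by
  rw [Tree.IsQTree, ← Tree.isLocal_graph_iff (fun _ _ => EdgeRel.symm) (h := h) hl,
    Tree.rootKind_eq_some_iff]
  constructor
  · rintro ⟨-, y, hy, ⟨hq, hn⟩, he⟩
    obtain ⟨-, hk, -, hlocal⟩ := Graph.isQTree_iff_isLocal.1 hq
    exact ⟨⟨hy ▸ hlocal, y, hy, hk⟩, (Tree.nonneg_iff h hy).1 hn, Tree.excess_root h y ▸ he⟩
  · rintro ⟨⟨hlocal, y, hy, hk⟩, hn, he⟩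
    rw [hy] at hlocal
    have hq := Graph.isQTree_iff_isLocal.2
      ⟨Tree.isTree_of_ne_leaf h hl, hk, Tree.root_free h hy, hlocal⟩
    exact ⟨Tree.mark_of_root hy, y, hy, ⟨hq, (Tree.nonneg_iff h hy).2 hn⟩,
      (Tree.excess_root h y).trans he⟩

variable (Q)

theorem exists_equiv_C (x : Kind) :
    ∃ e : C Q x ≃ {t : Tree // t.IsCompanion Q ∧ t.rootKind = some x}, ∀ c,
      (e c).1.necklaces = c.necklaces ∧ (e c).1.markWord = c.markedNecklace :=
  IsoClass.exists_equiv_tree (propC Q x) (fun _ => Iff.rfl) (propC_invariant Q x)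
    (fun _ ⟨mark_eq, _, r, hr, _, hc⟩ => ⟨hc.tree, .inl ⟨mark_eq, r, hr, hc.root_free⟩⟩)
    _ (fun _ h => ⟨h.1.wf, h.1.ne_leaf⟩) (propC_graph_iff x)

/-- The unrooted companion trees without defects and with a marked necklace, as recursive trees. -/
abbrev MarkedCompanionTree : Type := {t : Tree // t.IsCompanion Q ∧ t.rootKind = none}

theorem exists_equiv_markedC :
    ∃ e : IsoClass (IsMarkedC Q) ≃ MarkedCompanionTree Q, ∀ c,
      (e c).1.necklaces = c.necklaces ∧ (e c).1.markWord = c.markedNecklace :=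
  IsoClass.exists_equiv_tree (propMarkedC Q) (fun _ => Iff.rfl) (propMarkedC_invariant Q)
    (fun _ h => ⟨h.2.2.2.tree, .inr ⟨h.2.1, h.1⟩⟩)
    _ (fun _ h => ⟨h.1.wf, h.1.ne_leaf⟩) propMarkedC_graph_iff

/-- The non-negative `Q`-trees with excess `0`, as recursive trees. -/
abbrev BalancedTree : Type := {t : Tree // t.IsQTree Q ∧ t.Nonneg ∧ t.exc = 0}

theorem exists_equiv_F0 :
    ∃ e : IsoClass (IsF0 Q) ≃ BalancedTree Q, ∀ c,
      (e c).1.necklaces = c.necklaces ∧ (e c).1.markWord = c.markedNecklace :=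
  IsoClass.exists_equiv_tree (propF0 Q) (fun _ => Iff.rfl) (propF0_invariant Q)
    (fun _ ⟨mark_eq, r, hr, hc, _⟩ =>
      ⟨hc.1.tree, .inl ⟨mark_eq, r, hr, (hc.1.free_iff r).2 (.inl rfl)⟩⟩)
    _ (fun _ h => ⟨h.1.1.wf, h.1.1.ne_leaf⟩) propF0_graph_iff

end Necklace

/-! ### Weights of trees -/

namespace Necklace

section WordPolynomial

variable {R : Type*} [CommRing R]

/-- The polynomial `Q(v, w, u)` of the necklaces in `S`, refined by a weight `x s` of each
necklace `s`; the variable of a letter marks its pearls. -/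
noncomputable def wordPolynomial (S : Finset (List Letter)) (x : List Letter → R) :
    MvPolynomial Letter R :=
  ∑ s ∈ S, MvPolynomial.C (x s) * ∏ i : Fin s.length, MvPolynomial.X (s.get i)

variable (S : Finset (List Letter)) (x : List Letter → R)

theorem map_wordPolynomial {R' : Type*} [CommRing R'] (f : R →+* R') :
    MvPolynomial.map f (wordPolynomial S x) = wordPolynomial S (f ∘ x) := by
  simp only [wordPolynomial, map_sum, map_mul, map_prod, MvPolynomial.map_C, MvPolynomial.map_X,
    Function.comp_apply]

theorem eval_wordPolynomial (y : Letter → R) :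
    MvPolynomial.eval y (wordPolynomial S x) =
      ∑ s ∈ S, x s * ∏ i : Fin s.length, y (s.get i) := by
  simp only [wordPolynomial, map_sum, map_mul, map_prod, MvPolynomial.eval_C,
    MvPolynomial.eval_X]

theorem wordPolynomial_mem_map_C {I : Ideal R} (hx : ∀ s, x s ∈ I) :
    wordPolynomial S x ∈ I.map MvPolynomial.C :=
  Ideal.sum_mem _ fun s _ => Ideal.mul_mem_right _ _ (Ideal.mem_map_of_mem _ (hx s))

theorem coeffwise_wordPolynomial {k : Type*} [CommRing k] [Algebra k R] (D : Derivation k R R) :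
    KernelMethod.coeffwise D (wordPolynomial S x) = wordPolynomial S (D ∘ x) := by
  simp only [wordPolynomial, KernelMethod.coeffwise_sum, KernelMethod.coeffwise_mul_prod_X,
    KernelMethod.coeffwise_C, Function.comp_apply]

theorem leibniz_prod {A ι : Type*} [CommRing A] [Algebra R A] [DecidableEq ι]
    (D : Derivation R A A) (T : Finset ι) (a : ι → A) :
    D (∏ i ∈ T, a i) = ∑ j ∈ T, (∏ i ∈ T.erase j, a i) * D (a j) := by
  induction T using Finset.induction_on with
  | empty => simp
  | insert j T hj ih =>
    rw [Finset.prod_insert hj, D.leibniz, ih, Finset.sum_insert hj, Finset.erase_insert hj,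
      smul_eq_mul, smul_eq_mul, Finset.mul_sum, add_comm]
    refine congrArg _ (Finset.sum_congr rfl fun i hi => ?_)
    have hij : j ≠ i := fun h => hj (h ▸ hi)
    rw [Finset.erase_insert_of_ne hij, Finset.prod_insert fun h => hj (Finset.mem_of_mem_erase h),
      mul_assoc]

theorem eval_pderiv_wordPolynomial (y : Letter → R) (z : Letter) :
    MvPolynomial.eval y (MvPolynomial.pderiv z (wordPolynomial S x)) =
      ∑ s ∈ S, ∑ j : Fin s.length with s.get j = z,
        x s * ∏ i ∈ Finset.univ.erase j, y (s.get i) := by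
  classical
  simp only [wordPolynomial, map_sum, MvPolynomial.pderiv_C_mul, leibniz_prod, map_mul,
    map_prod, MvPolynomial.eval_C, MvPolynomial.eval_X, Finset.mul_sum,
    Finset.sum_filter, MvPolynomial.pderiv_X]
  refine Finset.sum_congr rfl fun s _ => Finset.sum_congr rfl fun j _ => ?_
  rcases eq_or_ne (s.get j) z with h | h
  · rw [if_pos h, ← h, Pi.single_eq_same, map_one, mul_one]
  · rw [if_neg h, Pi.single_eq_of_ne h, map_zero, mul_zero, mul_zero]

end WordPolynomial

namespace Tree

theorem finite_setOf_card_necklaces_le (S : Finset (List Letter)) (n : ℕ) :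
    {t : Tree | t.necklaces.card ≤ n ∧ ∀ s ∈ t.necklaces, s ∈ S}.Finite := by
  induction n with
  | zero =>
    refine (Set.finite_singleton leaf).subset ?_
    rintro (_ | ⟨s, p, ch⟩) ⟨card_le, -⟩
    · rfl
    · simp [necklaces] at card_le
  | succ n ih =>
    set T := {t : Tree | t.necklaces.card ≤ n ∧ ∀ s ∈ t.necklaces, s ∈ S}
    have : Finite T := ih
    let build : (Σ s : S, Option (Pos s.1) × (Pos s.1 → T)) → Tree := fun d =>
      node d.1.1 d.2.1 fun q => d.2.2 q
    refine ((Set.finite_range build).union (Set.finite_singleton leaf)).subset ?_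
    rintro (_ | ⟨s, p, ch⟩) ⟨card_le, mem_S⟩
    · exact .inr rfl
    left
    simp only [necklaces, Multiset.card_cons, Nat.add_le_add_iff_right, Multiset.mem_cons,
      Multiset.card_sum] at card_le mem_S
    refine ⟨⟨⟨s, mem_S s (.inl rfl)⟩, p, fun q => ⟨ch q, ?_, fun s' hs' => mem_S s' (.inr ?_)⟩⟩,
      rfl⟩
    · exact (Finset.single_le_sum (f := fun q => (ch q).necklaces.card)
        (fun _ _ => Nat.zero_le _) (Finset.mem_univ q)).trans card_le
    · exact Multiset.mem_sum.2 ⟨q, Finset.mem_univ q, hs'⟩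

theorem finite_setOf_necklaces_eq (M : Multiset (List Letter)) :
    {t : Tree | t.necklaces = M}.Finite := by
  classical
  refine (finite_setOf_card_necklaces_le M.toFinset M.card).subset ?_
  rintro t rfl
  exact ⟨le_rfl, fun s hs => Multiset.mem_toFinset.2 hs⟩

section Weight

variable {R : Type*} [CommRing R] (x : List Letter → R)

/-- The monomial of a tree in the weights of its necklaces. -/
def weight (t : Tree) : R := (t.necklaces.map x).prod

@[simp]
theorem weight_leaf : leaf.weight x = 1 := by simp [weight, necklaces]

theorem weight_node (s : List Letter) (p : Option (Pos s)) (ch : Pos s → Tree) :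
    (node s p ch).weight x = x s * ∏ q, (ch q).weight x := by
  have map_necklaces :=
    map_sum (Multiset.mapAddMonoidHom x) (fun q => (ch q).necklaces) Finset.univ
  simp only [Multiset.coe_mapAddMonoidHom] at map_necklaces
  simp only [weight, necklaces, Multiset.map_cons, Multiset.prod_cons, map_necklaces,
    Multiset.prod_sum]

theorem prod_map_mem_pow_card {α : Type*} {x : α → R} {I : Ideal R} (hx : ∀ s, x s ∈ I)
    (M : Multiset α) : (M.map x).prod ∈ I ^ M.card := by
  induction M using Multiset.induction with
  | empty => simp
  | cons a M ih =>
    rw [Multiset.map_cons, Multiset.prod_cons, Multiset.card_cons, pow_succ']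
    exact Ideal.mul_mem_mul (hx a) ih

theorem finite_setOf_weight_ne_zero {x : List Letter → R} {I : Ideal R} (hI : IsNilpotent I)
    (hx : ∀ s, x s ∈ I) {S : Finset (List Letter)} (hS : ∀ s ∉ S, x s = 0) :
    {t : Tree | t.weight x ≠ 0}.Finite := by
  obtain ⟨N, hN⟩ := hI
  refine (finite_setOf_card_necklaces_le S N).subset fun t ht => ⟨?_, fun s hs => ?_⟩
  · by_contra! card_gt
    have mem_pow := Ideal.pow_le_pow_right card_gt.le (prod_map_mem_pow_card hx t.necklaces)
    rw [hN] at mem_pow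
    exact ht mem_pow
  · by_contra hs'
    exact ht (Multiset.prod_eq_zero (Multiset.mem_map.2 ⟨s, hs, hS s hs'⟩))

end Weight

section Decomposition

variable {B : Type*}

theorem prod_finsum_mem_eq_finsum_mem_pi [CommSemiring B] {ι α : Type*} [Fintype ι]
    (A : ι → Set α) (w : ι → α → B) (hfin : ∀ i, (A i ∩ Function.support (w i)).Finite) :
    ∏ i, ∑ᶠ a ∈ A i, w i a = ∑ᶠ f ∈ Set.univ.pi A, ∏ i, w i (f i) := by
  classical
  simp only [finsum_mem_eq_sum _ (hfin _), Finset.prod_univ_sum]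
  refine (finsum_mem_eq_sum_of_inter_support_eq _ ?_).symm
  ext f
  simp only [Set.mem_inter_iff, Function.mem_support, Fintype.coe_piFinset,
    Set.mem_pi, Set.mem_univ, true_implies, Set.Finite.coe_toFinset]
  refine and_congr_left fun prod_ne_zero => forall_congr' fun i => (and_iff_left ?_).symm
  exact fun h => prod_ne_zero (Finset.prod_eq_zero (Finset.mem_univ i) h)

theorem node_injective {s : List Letter} {p : Option (Pos s)} :
    Function.Injective (node s p) := fun _ _ h => by
  cases h; rfl

theorem finsum_mem_eq_sum_node [AddCommMonoid B] {S : Finset (List Letter)} {T : Set Tree}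
    {w : Tree → B} (hleaf : leaf ∉ T) (hS : ∀ s ∉ S, ∀ p ch, w (node s p ch) = 0)
    (hfin : (Function.support w).Finite) :
    ∑ᶠ t ∈ T, w t =
      ∑ s ∈ S, ∑ p, ∑ᶠ ch ∈ {ch | node s p ch ∈ T}, w (node s p ch) := by
  let part : (Σ s : List Letter, Option (Pos s)) → Set Tree := fun d =>
    node d.1 d.2 '' {ch | node d.1 d.2 ch ∈ T ∩ Function.support w}
  have cover : T ∩ Function.support w =
      ⋃ d ∈ (S.sigma fun _ => Finset.univ : Finset _), part d := by
    ext t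
    simp only [Set.mem_iUnion, Finset.mem_sigma, Finset.mem_univ, and_true]
    constructor
    · rintro ⟨ht, hw⟩
      rcases t with _ | ⟨s, p, ch⟩
      · exact absurd ht hleaf
      · exact ⟨⟨s, p⟩, by_contra fun hs => hw (hS s hs p ch), ch, ⟨ht, hw⟩, rfl⟩
    · rintro ⟨d, -, ch, h, rfl⟩
      exact h
  have disjoint : (Set.univ : Set (Σ s : List Letter, Option (Pos s))).PairwiseDisjoint part := by
    rintro ⟨s, p⟩ - ⟨s', p'⟩ - hne
    refine Set.disjoint_left.2 ?_
    rintro _ ⟨ch, -, rfl⟩ ⟨ch', -, h⟩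
    cases h
    exact hne rfl
  have part_finite : ∀ d, (part d).Finite := fun d =>
    hfin.subset (by rintro _ ⟨ch, h, rfl⟩; exact h.2)
  have finsum_part : ∀ d, ∑ᶠ t ∈ part d, w t =
      ∑ᶠ ch ∈ {ch | node d.1 d.2 ch ∈ T}, w (node d.1 d.2 ch) := fun d => by
    rw [finsum_mem_image node_injective.injOn]
    exact finsum_mem_inter_support (w ∘ node d.1 d.2) {ch | node d.1 d.2 ch ∈ T}
  rw [Finset.sum_sigma', ← finsum_mem_inter_support, cover]
  refine (finsum_mem_biUnion (disjoint.subset (Set.subset_univ _)) (Finset.finite_toSet _)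
    fun d _ => part_finite d).trans ?_
  simp only [finsum_part]
  exact finsum_mem_coe_finset _ _

/-- The trees that may be attached to the pearl `q` of a word whose mark is `p`, if a pearl of kind
`k` may carry the trees of `slot k`: the root pearl carries nothing. -/
def attachable (slot : Kind → Set Tree) {s : List Letter} (p : Option (Pos s)) (q : Pos s) :
    Set Tree :=
  {t | (p = some q → t = leaf) ∧ (p ≠ some q → t ∈ slot (posKind s q))}

theorem finsum_mem_attachable_root [AddCommMonoid B] (slot : Kind → Set Tree) {s : List Letter}
    (q : Pos s) (w : Tree → B) : ∑ᶠ t ∈ attachable slot (some q) q, w t = w leaf := by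
  have attachable_eq : attachable slot (some q) q = {leaf} := by
    ext t; simp [attachable]
  rw [attachable_eq, finsum_mem_singleton]

theorem attachable_of_ne (slot : Kind → Set Tree) {s : List Letter} {p : Option (Pos s)}
    {q : Pos s} (h : p ≠ some q) : attachable slot p q = slot (posKind s q) := by
  ext t; simp [attachable, h]

theorem finsum_mem_eq_sum_mul_prod [CommRing B] {S : Finset (List Letter)} {T : Set Tree}
    {w : Tree → B} {w' : Kind → Tree → B} {c : List Letter → B} {slot : Kind → Set Tree}
    {marks : ∀ s : List Letter, Finset (Option (Pos s))} (hleaf : leaf ∉ T)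
    (hT : ∀ s ∈ S, ∀ p ch, node s p ch ∈ T ↔ p ∈ marks s ∧ ∀ q, ch q ∈ attachable slot p q)
    (hw : ∀ s p ch, node s p ch ∈ T → w (node s p ch) = c s * ∏ q, w' (posKind s q) (ch q))
    (hS : ∀ s ∉ S, ∀ p ch, w (node s p ch) = 0) (hfin : (Function.support w).Finite)
    (hfin' : ∀ k, (Function.support (w' k)).Finite) :
    ∑ᶠ t ∈ T, w t =
      ∑ s ∈ S, ∑ p ∈ marks s, c s * ∏ q, ∑ᶠ t ∈ attachable slot p q, w' (posKind s q) t := by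
  have support_prod_finite : ∀ s : List Letter,
      (Function.support fun ch : Pos s → Tree => ∏ q, w' (posKind s q) (ch q)).Finite :=
    fun s => (Set.Finite.pi' fun q => hfin' (posKind s q)).subset
      fun ch h q hq => h (Finset.prod_eq_zero (Finset.mem_univ q) hq)
  rw [finsum_mem_eq_sum_node hleaf hS hfin]
  refine Finset.sum_congr rfl fun s hs => ?_
  rw [← Finset.sum_subset (Finset.subset_univ (marks s)) fun p _ hp => ?_]
  · refine Finset.sum_congr rfl fun p hp => ?_
    have node_mem : {ch | node s p ch ∈ T} = Set.univ.pi (attachable slot p) := by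
      ext ch; simp [hT s hs, hp]
    rw [prod_finsum_mem_eq_finsum_mem_pi _ _ fun q => (hfin' _).subset Set.inter_subset_right,
      ← node_mem]
    exact (finsum_mem_congr rfl fun ch h => hw s p ch h).trans
      ((AddMonoidHom.mulLeft (c s)).map_finsum_mem'
        ((support_prod_finite s).subset Set.inter_subset_right)).symm
  · have node_notMem : {ch | node s p ch ∈ T} = ∅ := by
      ext ch; simp [hT s hs, hp]
    rw [node_notMem, finsum_mem_empty]

end Decomposition

end Tree

end Necklace

/-! ### The companion system -/

namespace Necklace

namespace Tree

section LocalSlot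

variable {Q : Set (List Letter)} {A : Set Kind} {E : Kind → Kind → Prop}

/-- The trees that may be attached to a pearl of kind `k` of a tree satisfying `IsLocal Q A E`. -/
def localSlot (Q : Set (List Letter)) (A : Set Kind) (E : Kind → Kind → Prop) (k : Kind) :
    Set Tree :=
  {t | (t = leaf ∧ k ∈ A) ∨ ∃ k', t.rootKind = some k' ∧ E k k' ∧ t.IsLocal Q A E}

theorem isLocal_node_iff {s : List Letter} {p : Option (Pos s)} {ch : Pos s → Tree} :
    (node s p ch).IsLocal Q A E ↔ s ∈ Q ∧ ∀ q, ch q ∈ attachable (localSlot Q A E) p q :=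
  Iff.rfl

theorem leaf_mem_localSlot {k : Kind} : leaf ∈ localSlot Q A E k ↔ k ∈ A :=
  ⟨fun h => h.elim And.right fun ⟨_, _, _, hlocal⟩ => hlocal.elim, fun h => .inl ⟨rfl, h⟩⟩

theorem mem_localSlot_of_ne_leaf {k : Kind} {t : Tree} (ht : t ≠ leaf) :
    t ∈ localSlot Q A E k ↔ ∃ k', t.rootKind = some k' ∧ E k k' ∧ t.IsLocal Q A E :=
  or_iff_right fun h => ht h.1

end LocalSlot

section Companion

variable {R : Type*} [CommRing R] (Q : Set (List Letter)) (x : List Letter → R)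

/-- The trees that describe companion trees without defects with a root pearl of kind `k`. -/
def companionSet (k : Kind) : Set Tree := {t | t.IsCompanion Q ∧ t.rootKind = some k}

/-- The trees that describe companion trees without defects with the marked necklace `s`. -/
def markedCompanionSet (s : List Letter) : Set Tree :=
  {t | (t.IsCompanion Q ∧ t.rootKind = none) ∧ t.markWord = some s}

/-- The generating function of companion trees without defects with a root pearl of kind `k`. -/
noncomputable def companionGF (k : Kind) : R := ∑ᶠ t ∈ companionSet Q k, t.weight x

/-- The trees that may be attached to a pearl of kind `k` of a companion tree without defects. -/
abbrev companionSlot (k : Kind) : Set Tree := localSlot Q {none} companionRel k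

theorem companionRel_letter_iff {z : Letter} {k : Kind} :
    companionRel (some z) k ↔ k = z.partner := by
  rcases z with _ | _ | _ <;> rcases k with _ | _ | _ | _ <;>
    simp [companionRel, EdgeRel, Letter.partner]

theorem companionRel_none_iff {k : Kind} : companionRel none k ↔ k = some .bullet := by
  rcases k with _ | _ | _ | _ <;> simp [companionRel, EdgeRel]

theorem companionSlot_letter (z : Letter) :
    companionSlot Q (some z) = companionSet Q z.partner := by
  ext t
  rcases eq_or_ne t leaf with rfl | ht
  · exact iff_of_false (fun h => nomatch leaf_mem_localSlot.1 h) fun h => h.1.ne_leaf rfl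
  · simp only [mem_localSlot_of_ne_leaf ht, companionRel_letter_iff, companionSet]
    exact ⟨fun ⟨_, hk, e, h⟩ => ⟨h, e ▸ hk⟩, fun ⟨h, hk⟩ => ⟨_, hk, rfl, h⟩⟩

theorem companionSlot_none :
    companionSlot Q none = insert leaf (companionSet Q (some .bullet)) := by
  ext t
  rcases eq_or_ne t leaf with rfl | ht
  · simp [leaf_mem_localSlot]
  · simp only [mem_localSlot_of_ne_leaf ht, companionRel_none_iff, companionSet,
      Set.mem_insert_iff, ht, false_or]
    exact ⟨fun ⟨_, hk, e, h⟩ => ⟨h, e ▸ hk⟩, fun ⟨h, hk⟩ => ⟨_, hk, rfl, h⟩⟩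

variable {Q x} {s : List Letter} {p : Option (Pos s)}

theorem finsum_attachable_letter {i : Fin s.length} (hp : p ≠ some (some i)) :
    ∑ᶠ t ∈ attachable (companionSlot Q) p (some i), t.weight x =
      companionGF Q x (s.get i).partner := by
  rw [attachable_of_ne _ hp, posKind, Option.map_some, companionSlot_letter]
  rfl

theorem finsum_attachable_square (hfin : {t : Tree | t.weight x ≠ 0}.Finite)
    (hp : p ≠ some none) :
    ∑ᶠ t ∈ attachable (companionSlot Q) p none, t.weight x =
      1 + companionGF Q x (some .bullet) := by
  rw [attachable_of_ne _ hp, posKind, Option.map_none, companionSlot_none,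
    finsum_mem_insert' _ (fun h => h.1.ne_leaf rfl) (hfin.subset Set.inter_subset_right),
    weight_leaf]
  rfl

theorem finsum_weight_eq_sum_mul_prod {S : Finset (List Letter)} {T : Set Tree}
    {marks : ∀ s : List Letter, Finset (Option (Pos s))}
    (hfin : {t : Tree | t.weight x ≠ 0}.Finite) (hS : ∀ s ∉ S, x s = 0) (hQ : ∀ s ∈ S, s ∈ Q)
    (hleaf : leaf ∉ T)
    (hT : ∀ s p ch, node s p ch ∈ T ↔ (node s p ch).IsCompanion Q ∧ p ∈ marks s) :
    ∑ᶠ t ∈ T, t.weight x = ∑ s ∈ S, ∑ p ∈ marks s,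
      x s * ∏ q, ∑ᶠ t ∈ attachable (companionSlot Q) p q, t.weight x := by
  refine finsum_mem_eq_sum_mul_prod (w' := fun _ => weight x) hleaf (fun s hs p ch => ?_)
    (fun s p ch _ => weight_node x s p ch) (fun s hs p ch => ?_) hfin fun _ => hfin
  · rw [hT, IsCompanion, isLocal_node_iff, and_comm, and_iff_right (hQ s hs)]
  · rw [weight_node, hS s hs, zero_mul]

section Equations

variable {S : Finset (List Letter)} (hfin : {t : Tree | t.weight x ≠ 0}.Finite)
  (hS : ∀ s ∉ S, x s = 0) (hQ : ∀ s ∈ S, s ∈ Q)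

include hfin hS hQ

theorem companionGF_none : companionGF Q x none =
    MvPolynomial.eval (fun z => companionGF Q x z.partner) (wordPolynomial S x) := by
  have mem_iff : ∀ s p ch, node s p ch ∈ companionSet Q none ↔
      (node s p ch).IsCompanion Q ∧ p ∈ ({some none} : Finset (Option (Pos s))) := by
    simp [companionSet, rootKind, posKind]
  rw [companionGF, finsum_weight_eq_sum_mul_prod hfin hS hQ (fun h => h.1.ne_leaf rfl) mem_iff,
    eval_wordPolynomial]
  refine Finset.sum_congr rfl fun s _ => ?_
  rw [Finset.sum_singleton, Fintype.prod_option, finsum_mem_attachable_root, weight_leaf, one_mul]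
  simp only [finsum_attachable_letter (p := some none) (by simp)]

theorem companionGF_letter (z : Letter) : companionGF Q x (some z) =
    (1 + companionGF Q x (some .bullet)) * MvPolynomial.eval (fun z => companionGF Q x z.partner)
      (MvPolynomial.pderiv z (wordPolynomial S x)) := by
  let letterMarks : ∀ s : List Letter, Finset (Option (Pos s)) := fun s =>
    (Finset.univ.filter fun j => s.get j = z).map (.trans .some .some)
  have mem_iff : ∀ s p ch, node s p ch ∈ companionSet Q (some z) ↔
      (node s p ch).IsCompanion Q ∧ p ∈ letterMarks s := by
    simp [companionSet, rootKind, posKind, letterMarks, eq_comm, and_comm]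
  rw [companionGF, finsum_weight_eq_sum_mul_prod hfin hS hQ (fun h => h.1.ne_leaf rfl) mem_iff,
    eval_pderiv_wordPolynomial, Finset.mul_sum]
  refine Finset.sum_congr rfl fun s _ => ?_
  rw [Finset.sum_map, Finset.mul_sum]
  refine Finset.sum_congr rfl fun j _ => ?_
  simp only [Function.Embedding.trans_apply, Function.Embedding.some_apply]
  rw [Fintype.prod_option, finsum_attachable_square hfin (by simp),
    ← Finset.mul_prod_erase Finset.univ _ (Finset.mem_univ j), finsum_mem_attachable_root,
    weight_leaf, one_mul, mul_left_comm]
  refine congrArg _ (congrArg _ (Finset.prod_congr rfl fun i hi => finsum_attachable_letter ?_))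
  simpa [eq_comm] using Finset.ne_of_mem_erase hi

theorem isCompanionSystem_companionGF :
    KernelMethod.IsCompanionSystem (wordPolynomial S x) (1 + companionGF Q x (some .bullet))
      fun z => companionGF Q x z.partner where
  eq_P := congrArg (1 + ·) (companionGF_letter hfin hS hQ .bullet)
  eq_bullet := companionGF_none hfin hS hQ
  eq_diamond := companionGF_letter hfin hS hQ .triangle
  eq_triangle := companionGF_letter hfin hS hQ .diamond

theorem finsum_weight_markedCompanionSet {s : List Letter} (hs : s ∈ S) :
    ∑ᶠ t ∈ markedCompanionSet Q s, t.weight x =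
      x s * ((1 + companionGF Q x (some .bullet)) *
        ∏ i : Fin s.length, companionGF Q x (s.get i).partner) := by
  classical
  have mem_iff : ∀ s' p ch, node s' p ch ∈ markedCompanionSet Q s ↔
      (node s' p ch).IsCompanion Q ∧
        p ∈ if s' = s then ({none} : Finset (Option (Pos s'))) else ∅ := by
    rintro s' (_ | p) ch <;> by_cases h : s' = s <;>
      simp [markedCompanionSet, rootKind, markWord, h]
  rw [finsum_weight_eq_sum_mul_prod hfin hS hQ (fun h => h.1.1.ne_leaf rfl) mem_iff,
    Finset.sum_eq_single_of_mem s hs fun s' _ h => by rw [if_neg h, Finset.sum_empty], if_pos rfl,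
    Finset.sum_singleton, Fintype.prod_option, finsum_attachable_square hfin (by simp)]
  simp only [finsum_attachable_letter (p := none) (by simp)]

end Equations

end Companion

end Tree

end Necklace

/-! ### The catalytic equation -/

theorem finsum_mem_eq_of_subset {α M : Type*} [AddCommMonoid M] {f g : α → M} {s t : Set α}
    (hts : t ⊆ s) (hfg : ∀ a ∈ t, f a = g a) (hf : ∀ a ∈ s, a ∉ t → f a = 0) :
    ∑ᶠ a ∈ s, f a = ∑ᶠ a ∈ t, g a :=
  (finsum_mem_inter_support_eq' f s t fun a ha =>
    ⟨fun has => by_contra fun hat => ha (hf a has hat), fun hat => hts hat⟩).trans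
      (finsum_mem_congr rfl hfg)

namespace Necklace

namespace Tree

open Polynomial

variable {R : Type*} [CommRing R] (Q : Set (List Letter)) (x : List Letter → R)

/-- The trees that describe non-negative `Q`-trees. -/
def nonnegSet : Set Tree := {t | t.IsQTree Q ∧ t.Nonneg}

/-- The trees that may be attached to a non-root pearl of kind `k` of a non-negative `Q`-tree. -/
def nonnegSlot (k : Kind) : Set Tree :=
  {t ∈ localSlot Q {some .triangle} treeRel k | 0 ≤ Kind.exc k + t.exc ∧ t.Nonneg}

/-- The weight of a tree attached to a pearl of kind `k`, where the variable records the excess of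
this pearl. -/
noncomputable def excWeight (k : Kind) (t : Tree) : R[X] :=
  Polynomial.C (t.weight x) * X ^ (Kind.exc k + t.exc).toNat

/-- The generating function `F(u)` of non-negative `Q`-trees, where `u` records the excess. -/
noncomputable def nonnegGF : R[X] := ∑ᶠ t ∈ nonnegSet Q, excWeight x none t

variable {Q} {s : List Letter} {p : Option (Pos s)} {ch : Pos s → Tree}

theorem Nonneg.exc_nonneg : ∀ {t : Tree}, t.Nonneg → 0 ≤ t.exc
  | leaf, _ => le_rfl
  | node .., h => h.1

theorem node_mem_nonnegSet_iff (hs : s ∈ Q) :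
    node s p ch ∈ nonnegSet Q ↔ p = some none ∧ ∀ q, ch q ∈ attachable (nonnegSlot Q) p q := by
  constructor
  · rintro ⟨⟨hlocal, root_eq⟩, hn⟩
    refine ⟨by simpa [rootKind, posKind] using root_eq, fun q => ?_⟩
    have := (isLocal_node_iff.1 hlocal).2 q
    exact ⟨this.1, fun hq => ⟨this.2 hq, hn.2 q hq⟩⟩
  · rintro ⟨rfl, hch⟩
    refine ⟨⟨isLocal_node_iff.2 ⟨hs, fun q => ⟨(hch q).1, fun hq => ((hch q).2 hq).1⟩⟩, rfl⟩,
      Finset.sum_nonneg fun q _ => ?_, fun q hq => ((hch q).2 hq).2⟩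
    rcases q with _ | i
    · rw [(hch none).1 rfl]
      exact le_rfl
    · exact ((hch (some i)).2 (by simp)).2.1

theorem exc_nonneg_of_node_mem_nonnegSet (h : node s p ch ∈ nonnegSet Q) (q : Pos s) :
    0 ≤ Kind.exc (posKind s q) + (ch q).exc := by
  obtain ⟨rfl, hch⟩ := (node_mem_nonnegSet_iff h.1.1.1).1 h
  rcases q with _ | i
  · rw [(hch none).1 rfl]
    exact le_rfl
  · exact ((hch (some i)).2 (by simp)).2.1

theorem excWeight_node (h : node s p ch ∈ nonnegSet Q) : excWeight x none (node s p ch) =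
    Polynomial.C (x s) * ∏ q, excWeight x (posKind s q) (ch q) := by
  have toNat_exc : (Kind.exc none + (node s p ch).exc).toNat =
      ∑ q, (Kind.exc (posKind s q) + (ch q).exc).toNat := by
    zify
    rw [Int.toNat_of_nonneg (a := Kind.exc none + _) (add_nonneg le_rfl h.2.exc_nonneg)]
    simp only [Int.toNat_of_nonneg (exc_nonneg_of_node_mem_nonnegSet h _)]
    exact zero_add _
  simp only [excWeight, toNat_exc, weight_node, Finset.prod_mul_distrib,
    Finset.prod_pow_eq_pow_sum, map_mul, map_prod]
  ring

theorem treeRel_letter_iff {z : Letter} {k : Kind} :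
    treeRel (some z) k ↔ z ≠ .triangle ∧ k = none := by
  rcases z with _ | _ | _ <;> rcases k with _ | _ | _ | _ <;> simp [treeRel, EdgeRel]

theorem mem_nonnegSlot_letter_iff {z : Letter} (hz : z ≠ .triangle) {t : Tree} :
    t ∈ nonnegSlot Q (some z) ↔ t ∈ nonnegSet Q ∧ 0 ≤ Kind.exc (some z) + t.exc := by
  rcases eq_or_ne t leaf with rfl | ht
  · refine iff_of_false (fun h => hz ?_) fun h => h.1.1.1.ne_leaf rfl
    have kind_mem : some z ∈ ({some .triangle} : Set Kind) := leaf_mem_localSlot.1 h.1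
    exact Option.some.inj kind_mem
  · simp only [nonnegSlot, nonnegSet, Set.mem_ofPred_eq, mem_localSlot_of_ne_leaf ht,
      treeRel_letter_iff]
    exact ⟨fun ⟨⟨_, hk, ⟨_, rfl⟩, hlocal⟩, he, hn⟩ => ⟨⟨⟨hlocal, hk⟩, hn⟩, he⟩,
      fun ⟨⟨⟨hlocal, hk⟩, hn⟩, he⟩ => ⟨⟨_, hk, ⟨hz, rfl⟩, hlocal⟩, he, hn⟩⟩

theorem nonnegSlot_bullet : nonnegSlot Q (some .bullet) = nonnegSet Q := by
  ext t
  rw [mem_nonnegSlot_letter_iff (by simp)]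
  exact and_iff_left_of_imp fun h => add_nonneg le_rfl h.2.exc_nonneg

theorem nonnegSlot_triangle : nonnegSlot Q (some .triangle) = {leaf} := by
  ext t
  rcases eq_or_ne t leaf with rfl | ht
  · simp [nonnegSlot, leaf_mem_localSlot, Kind.exc, exc, Nonneg]
  · simp [nonnegSlot, mem_localSlot_of_ne_leaf ht, treeRel_letter_iff, ht]

variable {x}

section Finite

variable (hfin : {t : Tree | t.weight x ≠ 0}.Finite)

include hfin

theorem support_excWeight_finite (k : Kind) : (Function.support (excWeight x k)).Finite :=
  hfin.subset fun t ht weight_eq => ht (by simp [excWeight, weight_eq])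

theorem map_nonnegGF {M : Type*} [AddCommMonoid M] (φ : R[X] →+ M) :
    φ (nonnegGF Q x) = ∑ᶠ t ∈ nonnegSet Q, φ (excWeight x none t) :=
  φ.map_finsum_mem' ((support_excWeight_finite hfin none).subset Set.inter_subset_right)

theorem finsum_nonnegSlot_diamond :
    ∑ᶠ t ∈ nonnegSlot Q (some .diamond), excWeight x (some .diamond) t =
      divX (nonnegGF Q x) := by
  have mem_iff : ∀ t ∈ nonnegSet Q, t ∈ nonnegSlot Q (some .diamond) ↔ 0 < t.exc := fun t ht => by
    rw [mem_nonnegSlot_letter_iff (by simp), and_iff_right ht, Kind.exc]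
    omega
  have subset : nonnegSlot Q (some .diamond) ⊆ nonnegSet Q :=
    fun t ht => ((mem_nonnegSlot_letter_iff (by simp)).1 ht).1
  refine ((map_nonnegGF hfin divX_hom).trans ?_).symm
  refine finsum_mem_eq_of_subset subset (fun t ht => ?_) fun t ht hslot => ?_
  · have exc_pos := (mem_iff t (subset ht)).1 ht
    have toNat_exc : (Kind.exc (some .diamond) + t.exc).toNat = (0 + t.exc).toNat - 1 := by
      simp only [Kind.exc]
      omega
    rw [divX_hom_toFun, excWeight, excWeight, divX_C_mul_X_pow, toNat_exc, if_neg]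
    · rfl
    · simp only [Kind.exc]
      omega
  · have exc_nonneg := ht.2.exc_nonneg
    have exc_le := (mem_iff t ht).not.1 hslot
    rw [divX_hom_toFun, excWeight, divX_C_mul_X_pow, if_pos]
    simp only [Kind.exc]
    omega

theorem finsum_nonnegSlot_letter (z : Letter) :
    ∑ᶠ t ∈ nonnegSlot Q (some z), excWeight x (some z) t =
      KernelMethod.catalyticPoint (nonnegGF Q x) z := by
  rcases z with _ | _ | _
  · rw [nonnegSlot_bullet]
    rfl
  · exact finsum_nonnegSlot_diamond hfin
  · rw [nonnegSlot_triangle, finsum_mem_singleton]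
    simp [excWeight, Kind.exc, exc, KernelMethod.catalyticPoint]

theorem coeff_zero_nonnegGF : (nonnegGF Q x).coeff 0 =
    ∑ᶠ t ∈ {t : Tree | t.IsQTree Q ∧ t.Nonneg ∧ t.exc = 0}, t.weight x := by
  refine (map_nonnegGF hfin (lcoeff R 0).toAddMonoidHom).trans ?_
  have coeff_excWeight : ∀ t,
      (lcoeff R 0).toAddMonoidHom (excWeight x none t) =
        if 0 = (0 + t.exc).toNat then t.weight x else 0 := fun t => by
    simp [excWeight, Kind.exc, coeff_X_pow]
  refine finsum_mem_eq_of_subset (fun t ht => ⟨ht.1, ht.2.1⟩) (fun t ht => ?_) fun t ht hexc => ?_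
  · simp [coeff_excWeight, ht.2.2]
  · have exc_nonneg := ht.2.exc_nonneg
    have exc_ne : t.exc ≠ 0 := fun h => hexc ⟨ht.1, ht.2, h⟩
    rw [coeff_excWeight, if_neg (by omega)]

theorem isCatalyticSolution_nonnegGF {S : Finset (List Letter)} (hS : ∀ s ∉ S, x s = 0)
    (hQ : ∀ s ∈ S, s ∈ Q) :
    KernelMethod.IsCatalyticSolution (wordPolynomial S x) (nonnegGF Q x) := by
  have equation : nonnegGF Q x = _ := finsum_mem_eq_sum_mul_prod (S := S) (c := Polynomial.C ∘ x)
    (w' := excWeight x) (slot := nonnegSlot Q) (marks := fun _ => {some none})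
    (fun h => h.1.1)
    (fun s hs p ch => by rw [node_mem_nonnegSet_iff (hQ s hs), Finset.mem_singleton])
    (fun s p ch h => excWeight_node x h)
    (fun s hs p ch => by rw [excWeight, weight_node, hS s hs, zero_mul, map_zero, zero_mul])
    (support_excWeight_finite hfin none) (support_excWeight_finite hfin)
  rw [KernelMethod.IsCatalyticSolution, map_wordPolynomial, eval_wordPolynomial]
  refine equation.trans (Finset.sum_congr rfl fun s _ => ?_)
  have excWeight_leaf : excWeight x none leaf = 1 := by simp [excWeight, Kind.exc, exc]
  have slot_letter : ∀ i : Fin s.length,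
      ∑ᶠ t ∈ attachable (nonnegSlot Q) (some none) (some i), excWeight x (some (s.get i)) t =
        KernelMethod.catalyticPoint (nonnegGF Q x) (s.get i) := fun i => by
    rw [attachable_of_ne _ (by simp), ← finsum_nonnegSlot_letter hfin]
    rfl
  rw [Finset.sum_singleton, Fintype.prod_option, finsum_mem_attachable_root]
  simp only [posKind, Option.map_none, Option.map_some, slot_letter, excWeight_leaf, one_mul]

end Finite

end Tree

end Necklace

/-! ### Extraction of coefficients -/

theorem coeff_X_mul_pderiv {σ R : Type*} [CommRing R] (s : σ) (p : MvPolynomial σ R) (m : σ →₀ ℕ) :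
    (MvPolynomial.X s * MvPolynomial.pderiv s p).coeff m = m s * p.coeff m := by
  induction p using MvPolynomial.induction_on' with
  | monomial n a =>
    classical
    rw [MvPolynomial.X_mul_pderiv_monomial, MvPolynomial.coeff_smul, MvPolynomial.coeff_monomial,
      nsmul_eq_mul]
    split_ifs with h
    · rw [h]
    · rw [mul_zero, mul_zero]
  | add p q hp hq =>
    rw [map_add, mul_add, MvPolynomial.coeff_add, hp, hq, MvPolynomial.coeff_add, mul_add]

/-- The ring of polynomials truncated at total degree `N`, where the ideal generated by the
variables is nilpotent. -/
abbrev TruncatedPolynomial (σ R : Type*) [CommRing R] (N : ℕ) : Type _ :=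
  MvPolynomial σ R ⧸ MvPolynomial.idealOfVars σ R ^ N

namespace TruncatedPolynomial

variable {σ R : Type*} [CommRing R] {N : ℕ}

/-- The quotient map that truncates polynomials at total degree `N`. -/
noncomputable abbrev mk : MvPolynomial σ R →+* TruncatedPolynomial σ R N :=
  Ideal.Quotient.mk _

/-- The coefficient of a monomial of degree less than `N`. -/
noncomputable def coeff {m : σ →₀ ℕ} (hm : m.degree < N) : TruncatedPolynomial σ R N →+ R :=
  QuotientAddGroup.lift _ (MvPolynomial.lcoeff R m).toAddMonoidHom fun p hp =>
    (MvPolynomial.mem_pow_idealOfVars_iff' N p).1 hp m hm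

theorem coeff_mk {m : σ →₀ ℕ} (hm : m.degree < N) (p : MvPolynomial σ R) :
    coeff hm (mk p) = p.coeff m :=
  rfl

theorem mk_X_mul_pderiv_eq_zero (s : σ) (p : MvPolynomial σ R)
    (hp : (mk p : TruncatedPolynomial σ R N) = 0) :
    (mk (MvPolynomial.X s * MvPolynomial.pderiv s p) : TruncatedPolynomial σ R N) = 0 := by
  rw [Ideal.Quotient.eq_zero_iff_mem, MvPolynomial.mem_pow_idealOfVars_iff'] at hp ⊢
  intro m hm
  rw [coeff_X_mul_pderiv, hp m hm, mul_zero]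

/-- The operator `X_s ∂/∂X_s`, which preserves the degree of monomials. -/
noncomputable def euler (s : σ) :
    Derivation R (TruncatedPolynomial σ R N) (TruncatedPolynomial σ R N) :=
  Derivation.liftOfSurjective (f := Ideal.Quotient.mkₐ R (MvPolynomial.idealOfVars σ R ^ N))
    (Ideal.Quotient.mkₐ_surjective R _)
    (d := (MvPolynomial.X s : MvPolynomial σ R) • MvPolynomial.pderiv s)
    (mk_X_mul_pderiv_eq_zero s)

theorem euler_mk (s : σ) (p : MvPolynomial σ R) :
    euler s (mk p : TruncatedPolynomial σ R N) =
      mk (MvPolynomial.X s * MvPolynomial.pderiv s p) :=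
  Derivation.liftOfSurjective_apply (Ideal.Quotient.mkₐ_surjective R _)
    (mk_X_mul_pderiv_eq_zero s) p

theorem coeff_euler {m : σ →₀ ℕ} (hm : m.degree < N) (s : σ) (r : TruncatedPolynomial σ R N) :
    coeff hm (euler s r) = m s * coeff hm r := by
  obtain ⟨p, rfl⟩ := Ideal.Quotient.mk_surjective r
  rw [euler_mk, coeff_mk, coeff_X_mul_pderiv]
  rfl

open Classical in
/-- The variable `X_s` if `s` belongs to the finite set `S`, and zero otherwise. -/
noncomputable def var (S : Finset σ) (s : σ) : TruncatedPolynomial σ R N :=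
  if s ∈ S then mk (MvPolynomial.X s) else 0

theorem var_of_mem {S : Finset σ} {s : σ} (hs : s ∈ S) :
    (var S s : TruncatedPolynomial σ R N) = mk (MvPolynomial.X s) :=
  if_pos hs

theorem var_of_notMem {S : Finset σ} {s : σ} (hs : s ∉ S) :
    (var S s : TruncatedPolynomial σ R N) = 0 :=
  if_neg hs

theorem euler_var_self (S : Finset σ) (s : σ) :
    euler s (var S s : TruncatedPolynomial σ R N) = var S s := by
  by_cases hs : s ∈ S
  · rw [var_of_mem hs, euler_mk, MvPolynomial.pderiv_X_self, mul_one]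
  · rw [var_of_notMem hs, map_zero]

theorem euler_var_of_ne (S : Finset σ) {s s' : σ} (h : s' ≠ s) :
    euler s (var S s' : TruncatedPolynomial σ R N) = 0 := by
  by_cases hs : s' ∈ S
  · rw [var_of_mem hs, euler_mk, MvPolynomial.pderiv_X_of_ne h, mul_zero, map_zero]
  · rw [var_of_notMem hs, map_zero]

variable (σ R N) in
/-- The ideal of truncated polynomials generated by the variables. -/
noncomputable abbrev idealOfVars : Ideal (TruncatedPolynomial σ R N) :=
  (MvPolynomial.idealOfVars σ R).map (Ideal.Quotient.mk _)

theorem isNilpotent_idealOfVars : IsNilpotent (idealOfVars σ R N) :=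
  ⟨N, by rw [← Ideal.map_pow, Ideal.map_quotient_self, Ideal.zero_eq_bot]⟩

theorem var_mem_idealOfVars (S : Finset σ) (s : σ) :
    (var S s : TruncatedPolynomial σ R N) ∈ idealOfVars σ R N := by
  by_cases hs : s ∈ S
  · rw [var_of_mem hs]
    exact Ideal.mem_map_of_mem _ (Ideal.subset_span ⟨s, rfl⟩)
  · rw [var_of_notMem hs]
    exact zero_mem _

theorem prod_map_var [DecidableEq σ] {S : Finset σ} {K : Multiset σ} (hK : ∀ s ∈ K, s ∈ S) :
    (K.map (var S)).prod =
      (mk (MvPolynomial.monomial K.toFinsupp 1) : TruncatedPolynomial σ R N) := by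
  rw [Multiset.map_congr rfl fun s hs => var_of_mem (hK s hs), Multiset.prod_hom' K mk]
  congr 1
  clear hK
  induction K using Multiset.induction with
  | empty => simp
  | cons a K ih =>
    rw [Multiset.map_cons, Multiset.prod_cons, ih, MvPolynomial.X, MvPolynomial.monomial_mul,
      one_mul, ← Multiset.singleton_add, map_add, Multiset.toFinsupp_singleton]

theorem coeff_prod_map_var [DecidableEq σ] {M : Multiset σ} (hM : M.toFinsupp.degree < N)
    (K : Multiset σ) :
    coeff hM (K.map (var M.toFinset)).prod = if K = M then (1 : R) else 0 := by
  by_cases hK : ∀ s ∈ K, s ∈ M.toFinset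
  · rw [prod_map_var hK, coeff_mk, MvPolynomial.coeff_monomial]
    simp only [EmbeddingLike.apply_eq_iff_eq]
  · push Not at hK
    obtain ⟨s, hsK, hsM⟩ := hK
    rw [Multiset.prod_eq_zero (Multiset.mem_map.2 ⟨s, hsK, var_of_notMem hsM⟩), map_zero, if_neg]
    rintro rfl
    exact hsM (Multiset.mem_toFinset.2 hsK)

end TruncatedPolynomial

namespace Necklace

namespace Tree

theorem IsLocal.mem_of_mem_necklaces {Q : Set (List Letter)} {A : Set Kind}
    {E : Kind → Kind → Prop} : ∀ {t : Tree}, t.IsLocal Q A E → ∀ s ∈ t.necklaces, s ∈ Q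
  | leaf, h, _, _ => h.elim
  | node s p ch, h, s', hs' => by
    rcases Multiset.mem_cons.1 hs' with rfl | hs'
    · exact h.1
    obtain ⟨q, -, hq⟩ := Multiset.mem_sum.1 hs'
    have child_ne_leaf : ch q ≠ leaf := fun e => by
      rw [e] at hq
      exact Multiset.notMem_zero _ hq
    have hp : p ≠ some q := fun hp => child_ne_leaf ((h.2 q).1 hp)
    obtain ⟨_, -, -, hlocal⟩ := (mem_localSlot_of_ne_leaf child_ne_leaf).1 ((h.2 q).2 hp)
    exact hlocal.mem_of_mem_necklaces s' hq

theorem mem_necklaces_of_markWord : ∀ {t : Tree} {s}, t.markWord = some s → s ∈ t.necklaces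
  | node _ none _, _, h => Multiset.mem_cons.2 (.inl (Option.some.inj h).symm)

section Count

variable (Q : Set (List Letter)) (M : Multiset (List Letter))

/-- The trees that describe non-negative `Q`-trees with excess `0` and with the multiset `M` of
necklaces. -/
def balancedSetWith : Set Tree :=
  {t | (t.IsQTree Q ∧ t.Nonneg ∧ t.exc = 0) ∧ t.necklaces = M}

/-- The trees that describe companion trees without defects, with the multiset `M` of necklaces and
with the marked necklace `s`. -/
def markedCompanionSetWith (s : List Letter) : Set Tree :=
  {t ∈ markedCompanionSet Q s | t.necklaces = M}

variable {Q M} [DecidableEq (List Letter)] {s : List Letter}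

theorem coeff_finsum_weight {N : ℕ} (hM : M.toFinsupp.degree < N) (T : Set Tree)
    (hfin : {t : Tree |
      t.weight (TruncatedPolynomial.var (R := ℤ) (N := N) M.toFinset) ≠ 0}.Finite) :
    TruncatedPolynomial.coeff hM (∑ᶠ t ∈ T, t.weight (TruncatedPolynomial.var M.toFinset)) =
      ({t ∈ T | t.necklaces = M}.ncard : ℤ) := by
  have finite_sep : {t ∈ T | t.necklaces = M}.Finite :=
    (finite_setOf_necklaces_eq M).subset fun t ht => ht.2
  rw [AddMonoidHom.map_finsum_mem' _ (hfin.subset Set.inter_subset_right)]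
  simp only [weight, TruncatedPolynomial.coeff_prod_map_var]
  rw [finsum_mem_eq_of_subset (t := {t ∈ T | t.necklaces = M}) (g := fun _ => 1)
      (fun t ht => ht.1) (fun t ht => if_pos ht.2) fun t ht hM => if_neg fun h => hM ⟨ht, h⟩,
    finsum_mem_eq_finite_toFinset_sum _ finite_sep, Set.ncard_eq_toFinset_card _ finite_sep]
  simp

theorem count_mul_ncard_of_mem (hs : s ∈ M) (hM : ∀ s ∈ M, s ∈ Q) :
    M.count s * (balancedSetWith Q M).ncard = (markedCompanionSetWith Q M s).ncard := by
  let S := M.toFinset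
  let x : List Letter → TruncatedPolynomial (List Letter) ℤ (M.card + 1) :=
    TruncatedPolynomial.var S
  have hS : ∀ s ∉ S, x s = 0 := fun _ => TruncatedPolynomial.var_of_notMem
  have hQ : ∀ s ∈ S, s ∈ Q := fun s hs => hM s (Multiset.mem_toFinset.1 hs)
  have degree_lt : M.toFinsupp.degree < M.card + 1 := by
    rw [Nat.lt_succ_iff, ← Multiset.toFinsupp_sum_eq]
    exact le_rfl
  have hx := TruncatedPolynomial.var_mem_idealOfVars (R := ℤ) (N := M.card + 1) S
  have hI := TruncatedPolynomial.isNilpotent_idealOfVars (σ := List Letter) (R := ℤ)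
    (N := M.card + 1)
  have hfin : {t : Tree | t.weight x ≠ 0}.Finite := finite_setOf_weight_ne_zero hI hx hS
  have euler_eq : TruncatedPolynomial.euler s ((nonnegGF Q x).coeff 0) =
      ∑ᶠ t ∈ markedCompanionSet Q s, t.weight x := by
    rw [(isCompanionSystem_companionGF hfin hS hQ).derivation_coeff_zero hI
      (wordPolynomial_mem_map_C S x hx) (isCatalyticSolution_nonnegGF hfin hS hQ),
      coeffwise_wordPolynomial, eval_wordPolynomial,
      finsum_weight_markedCompanionSet hfin hS hQ (Multiset.mem_toFinset.2 hs),
      Finset.sum_eq_single_of_mem s (Multiset.mem_toFinset.2 hs) fun s' _ hne => by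
        rw [Function.comp_apply, TruncatedPolynomial.euler_var_of_ne S hne, zero_mul],
      Function.comp_apply, TruncatedPolynomial.euler_var_self, mul_left_comm]
  have coeff_eq := congrArg (TruncatedPolynomial.coeff degree_lt) euler_eq
  rw [TruncatedPolynomial.coeff_euler, coeff_zero_nonnegGF hfin, coeff_finsum_weight _ _ hfin,
    coeff_finsum_weight _ _ hfin, Multiset.toFinsupp_apply] at coeff_eq
  exact_mod_cast coeff_eq

theorem count_mul_ncard_balancedSetWith :
    M.count s * (balancedSetWith Q M).ncard = (markedCompanionSetWith Q M s).ncard := by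
  by_cases hs : s ∈ M
  · by_cases hM : ∀ s ∈ M, s ∈ Q
    · exact count_mul_ncard_of_mem hs hM
    · have balanced_eq : balancedSetWith Q M = ∅ := Set.eq_empty_of_forall_notMem
        fun t ht => hM (ht.2 ▸ ht.1.1.1.mem_of_mem_necklaces)
      have marked_eq : markedCompanionSetWith Q M s = ∅ := Set.eq_empty_of_forall_notMem
        fun t ht => hM (ht.2 ▸ ht.1.1.1.mem_of_mem_necklaces)
      rw [balanced_eq, marked_eq, Set.ncard_empty, mul_zero]
  · have marked_eq : markedCompanionSetWith Q M s = ∅ := Set.eq_empty_of_forall_notMem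
      fun t ht => hs (ht.2 ▸ mem_necklaces_of_markWord ht.1.2)
    rw [marked_eq, Set.ncard_empty, Multiset.count_eq_zero_of_notMem hs, zero_mul]

end Count

end Tree

end Necklace

namespace Necklace

/-- The decorated graph `A` with the mark replaced by `m`. -/
def Decorated.withMark (A : Decorated) (m : Option (Fin A.size)) : Decorated := { A with mark := m }

variable {Q : Set (List Letter)}

theorem isF0_model_iff {t : Tree} {h : t.WF} (hl : t ≠ .leaf) :
    IsF0 Q (t.model h) ↔ t.IsQTree Q ∧ t.Nonneg ∧ t.exc = 0 := by
  rw [← propF0_graph_iff t h hl, ← t.modelIso_root h, ← t.modelIso_mark h]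
  exact (propF0_invariant Q (t.modelIso h) _ _).symm

theorem IsF0.of_iso {A B : Decorated} (hB : IsF0 Q B) (h : A.Iso B) : IsF0 Q A := by
  obtain ⟨f, root_eq, mark_eq⟩ := Decorated.iso_iff.1 h
  refine (propF0_invariant Q f A.root A.mark).1 ?_
  rw [root_eq, mark_eq]
  exact hB

namespace BalancedTree

theorem wf (t : BalancedTree Q) : t.1.WF := t.2.1.1.wf

theorem isF0_model (t : BalancedTree Q) : IsF0 Q (t.1.model t.wf) :=
  (isF0_model_iff t.2.1.1.ne_leaf).2 t.2

/-- The decorated graph described by a tree of which the necklace `v` is marked. -/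
noncomputable def markedModel (t : BalancedTree Q) (v : t.1.Vtx) : Decorated :=
  (t.1.model t.wf).withMark (some ((t.1.modelIso t.wf).toEquiv.symm v))

theorem isMarkedF0_markedModel (t : BalancedTree Q) (v : t.1.Vtx) :
    IsMarkedF0 Q (t.markedModel v) :=
  ⟨nofun, t.isF0_model.2⟩

theorem necklaces_markedModel (t : BalancedTree Q) (v : t.1.Vtx) :
    (t.markedModel v).necklaces = t.1.necklaces :=
  t.1.necklaces_model t.wf

theorem markedNecklace_markedModel (t : BalancedTree Q) (v : t.1.Vtx) :
    (t.markedModel v).markedNecklace = some (t.1.word v) :=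
  congrArg some ((t.1.modelIso t.wf).symm.word_eq v)

theorem eq_of_markedModel_iso {t t' : BalancedTree Q} {v : t.1.Vtx} {v' : t'.1.Vtx}
    (h : (t.markedModel v).Iso (t'.markedModel v')) :
    (⟨t, v⟩ : Σ t : BalancedTree Q, t.1.Vtx) = ⟨t', v'⟩ := by
  obtain ⟨f, root_eq, mark_eq⟩ := Decorated.iso_iff.1 h
  have iso_model : (t.1.model t.wf).Iso (t'.1.model t'.wf) :=
    Decorated.iso_iff.2 ⟨f, root_eq, by rw [t.isF0_model.1, t'.isF0_model.1]; rfl⟩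
  obtain rfl : t = t' := Subtype.ext (Tree.eq_of_model_iso iso_model)
  have f_eq : f.toEquiv = Equiv.refl _ :=
    Tree.toEquiv_eq_refl (h := t.wf) f root_eq (by rw [t.isF0_model.1]; rfl)
  have symm_eq : f.toEquiv _ = _ := Option.some.inj mark_eq
  rw [f_eq] at symm_eq
  exact congrArg (Sigma.mk t) ((t.1.modelIso t.wf).toEquiv.symm.injective symm_eq)

theorem exists_markedModel_iso {A : Decorated} (hA : IsMarkedF0 Q A) :
    ∃ (t : BalancedTree Q) (v : t.1.Vtx), (t.markedModel v).Iso A := by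
  obtain ⟨m, hm⟩ := Option.ne_none_iff_exists'.1 hA.1
  have isF0 : IsF0 Q (A.withMark none) := ⟨rfl, hA.2⟩
  obtain ⟨-, r, hr, hc, -⟩ := id isF0
  obtain ⟨t, h, hl, hi⟩ := Tree.exists_model (A := A.withMark none)
    ⟨hc.1.tree, .inl ⟨rfl, r, hr, (hc.1.free_iff r).2 (.inl rfl)⟩⟩
  obtain ⟨f, root_eq, -⟩ := Decorated.iso_iff.1 hi
  refine ⟨⟨t, (isF0_model_iff hl).1 (isF0.of_iso hi)⟩, (t.modelIso h).toEquiv (f.toEquiv.symm m),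
    Decorated.iso_iff.2 ⟨f, root_eq, Eq.trans ?_ hm.symm⟩⟩
  exact congrArg some ((congrArg f.toEquiv (Equiv.symm_apply_apply _ _)).trans
    (f.toEquiv.apply_symm_apply m))

end BalancedTree

variable (Q) in
theorem exists_equiv_markedF0 :
    ∃ e : IsoClass (IsMarkedF0 Q) ≃ Σ t : BalancedTree Q, t.1.Vtx, ∀ c,
      (e c).1.1.necklaces = c.necklaces ∧ some ((e c).1.1.word (e c).2) = c.markedNecklace := by
  let g (x : Σ t : BalancedTree Q, t.1.Vtx) : IsoClass (IsMarkedF0 Q) :=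
    Quotient.mk _ ⟨x.1.markedModel x.2, x.1.isMarkedF0_markedModel x.2⟩
  have g_bijective : Function.Bijective g := by
    constructor
    · exact fun _ _ h => BalancedTree.eq_of_markedModel_iso (Quotient.exact h)
    · rintro ⟨A, hA⟩
      obtain ⟨t, v, h⟩ := BalancedTree.exists_markedModel_iso hA
      exact ⟨⟨t, v⟩, Quotient.sound h⟩
  refine ⟨(Equiv.ofBijective g g_bijective).symm, fun c => ?_⟩
  obtain ⟨x, rfl⟩ := (Equiv.ofBijective g g_bijective).surjective c
  rw [Equiv.symm_apply_apply]
  exact ⟨(x.1.necklaces_markedModel x.2).symm, (x.1.markedNecklace_markedModel x.2).symm⟩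

end Necklace

/-! ### The bijections -/

theorem exists_equiv_of_card_fiber_eq {α β γ : Type*} (f : α → γ) (g : β → γ)
    [∀ c, Finite {a // f a = c}] [∀ c, Finite {b // g b = c}]
    (h : ∀ c, Nat.card {a // f a = c} = Nat.card {b // g b = c}) :
    ∃ e : α ≃ β, ∀ a, g (e a) = f a :=
  ⟨Equiv.ofFiberEquiv fun c => (Finite.card_eq.1 (h c)).some, Equiv.ofFiberEquiv_map _⟩

namespace Necklace

open Necklace.Tree

theorem Tree.card_word_eq [DecidableEq (List Letter)] (t : Tree) (s : List Letter) :
    Nat.card {v : t.Vtx // t.word v = s} = t.necklaces.count s := by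
  have := Fintype.ofFinite t.Vtx
  rw [← sum_word, Multiset.count_sum', Nat.card_eq_fintype_card, Fintype.card_subtype,
    Finset.card_filter]
  simp only [Multiset.count_singleton, eq_comm]

section Fibers

variable {Q : Set (List Letter)}

theorem MarkedCompanionTree.isSome_markWord : ∀ t : MarkedCompanionTree Q, t.1.markWord.isSome
  | ⟨.leaf, h⟩ => absurd rfl h.1.ne_leaf
  | ⟨.node _ none _, _⟩ => rfl
  | ⟨.node _ (some _) _, h⟩ => nomatch h.2

/-- The word of the marked necklace. -/
def MarkedCompanionTree.word (t : MarkedCompanionTree Q) : List Letter :=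
  t.1.markWord.get t.isSome_markWord

theorem MarkedCompanionTree.markWord_eq_some_word (t : MarkedCompanionTree Q) :
    t.1.markWord = some t.word :=
  (Option.some_get _).symm

variable (M : Multiset (List Letter)) (s : List Letter)

/-- The balanced trees with a marked necklace, with given multiset of necklaces and given marked
necklace, as pairs. -/
def balancedFiberEquiv :
    {x : Σ t : BalancedTree Q, t.1.Vtx // (x.1.1.necklaces, x.1.1.word x.2) = (M, s)} ≃
      Σ t : balancedSetWith Q M, {v : t.1.Vtx // t.1.word v = s} where
  toFun x := ⟨⟨x.1.1.1, x.1.1.2, congrArg Prod.fst x.2⟩, x.1.2, congrArg Prod.snd x.2⟩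
  invFun x := ⟨⟨⟨x.1.1, x.1.2.1⟩, x.2.1⟩, Prod.ext x.1.2.2 x.2.2⟩

/-- The companion trees with given multiset of necklaces and given marked necklace, as a set of
trees. -/
def markedCompanionFiberEquiv :
    {t : MarkedCompanionTree Q // (t.1.necklaces, t.word) = (M, s)} ≃
      markedCompanionSetWith Q M s where
  toFun x := ⟨x.1.1, ⟨x.1.2, x.1.markWord_eq_some_word.trans (congrArg (some ·.2) x.2)⟩,
    congrArg Prod.fst x.2⟩
  invFun t := ⟨⟨t.1, t.2.1.1⟩, Prod.ext t.2.2 <| Option.some.inj <|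
    (MarkedCompanionTree.markWord_eq_some_word _).symm.trans t.2.1.2⟩

instance : Finite (balancedSetWith Q M) :=
  (finite_setOf_necklaces_eq M).subset fun _ h => h.2

instance : Finite (markedCompanionSetWith Q M s) :=
  (finite_setOf_necklaces_eq M).subset fun _ h => h.2

theorem card_sigma_balancedSetWith [DecidableEq (List Letter)] :
    Nat.card (Σ t : balancedSetWith Q M, {v : t.1.Vtx // t.1.word v = s}) =
      M.count s * (balancedSetWith Q M).ncard := by
  have := Fintype.ofFinite (balancedSetWith Q M)
  have card_eq (t : balancedSetWith Q M) : Nat.card {v // t.1.word v = s} = M.count s := by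
    rw [card_word_eq, t.2.2]
  rw [Nat.card_sigma, Finset.sum_congr rfl fun t _ => card_eq t, Finset.sum_const, smul_eq_mul,
    mul_comm, Finset.card_univ, ← Nat.card_eq_fintype_card, Nat.card_coe_set_eq]

variable (Q)

theorem exists_equiv_balanced_markedCompanion :
    ∃ e : (Σ t : BalancedTree Q, t.1.Vtx) ≃ MarkedCompanionTree Q, ∀ x,
      (e x).1.necklaces = x.1.1.necklaces ∧ (e x).1.markWord = some (x.1.1.word x.2) := by
  classical
  have (c : Multiset (List Letter) × List Letter) :
      Finite {x : Σ t : BalancedTree Q, t.1.Vtx // (x.1.1.necklaces, x.1.1.word x.2) = c} :=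
    .of_equiv _ (balancedFiberEquiv c.1 c.2).symm
  have (c : Multiset (List Letter) × List Letter) :
      Finite {t : MarkedCompanionTree Q // (t.1.necklaces, t.word) = c} :=
    .of_equiv _ (markedCompanionFiberEquiv c.1 c.2).symm
  obtain ⟨e, he⟩ := exists_equiv_of_card_fiber_eq
    (fun x : Σ t : BalancedTree Q, t.1.Vtx => (x.1.1.necklaces, x.1.1.word x.2))
    (fun t : MarkedCompanionTree Q => (t.1.necklaces, t.word)) fun ⟨M, s⟩ => by
      rw [Nat.card_congr (balancedFiberEquiv M s), Nat.card_congr (markedCompanionFiberEquiv M s),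
        card_sigma_balancedSetWith, count_mul_ncard_balancedSetWith, Nat.card_coe_set_eq]
  exact ⟨e, fun x => ⟨congrArg Prod.fst (he x),
    (e x).markWord_eq_some_word.trans (congrArg (some ·.2) (he x))⟩⟩

theorem exists_equiv_markedF0_markedC :
    ∃ e : IsoClass (IsMarkedF0 Q) ≃ IsoClass (IsMarkedC Q), ∀ c,
      (e c).necklaces = c.necklaces ∧ (e c).markedNecklace = c.markedNecklace := by
  obtain ⟨e₁, h₁⟩ := exists_equiv_markedF0 Q
  obtain ⟨e₂, h₂⟩ := exists_equiv_markedC Q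
  obtain ⟨e, he⟩ := exists_equiv_balanced_markedCompanion Q
  refine ⟨e₁.trans (e.trans e₂.symm), fun c => ?_⟩
  have hc := h₂ (e₂.symm (e (e₁ c)))
  rw [Equiv.apply_symm_apply] at hc
  exact ⟨hc.1.symm.trans ((he (e₁ c)).1.trans (h₁ c).1),
    hc.2.symm.trans ((he (e₁ c)).2.trans (h₁ c).2)⟩

end Fibers

section Cut

variable {Q : Set (List Letter)}

/-- The counterpart of `Pairs Q` for recursive trees: what remains of a companion tree when it is
cut at the pearls of the marked necklace. -/
abbrev TreePairs (Q : Set (List Letter)) : Type :=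
  Option (companionSet Q (some .bullet)) ×
    Σ s : Q, ∀ i : Fin s.1.length, companionSet Q (s.1.get i).partner

namespace TreePairs

/-- The trees attached to the pearls of the marked necklace. -/
def children (x : TreePairs Q) : Pos x.2.1.1 → Tree
  | none => x.1.elim .leaf Subtype.val
  | some i => x.2.2 i

theorem children_mem_companionSlot (x : TreePairs Q) (q : Pos x.2.1.1) :
    x.children q ∈ companionSlot Q (posKind x.2.1.1 q) := by
  rcases q with _ | i
  · rcases x with ⟨_ | t, s⟩
    · exact companionSlot_none Q ▸ .inl rfl
    · exact companionSlot_none Q ▸ .inr t.2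
  · exact companionSlot_letter Q _ ▸ (x.2.2 i).2

/-- The tree obtained by attaching the components of a pair to the marked necklace. -/
def tree (x : TreePairs Q) : MarkedCompanionTree Q :=
  ⟨.node x.2.1.1 none x.children,
    ⟨x.2.1.2, fun q => ⟨nofun, fun _ => x.children_mem_companionSlot q⟩⟩, rfl⟩

theorem tree_injective : Function.Injective (tree (Q := Q)) := by
  rintro ⟨o, ⟨s, hs⟩, a⟩ ⟨o', ⟨s', hs'⟩, a'⟩ h
  have h := Subtype.ext_iff.1 h
  injection h with s_eq _ children_eq
  obtain rfl : s = s' := s_eq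
  have children_eq := congrFun (eq_of_heq children_eq)
  obtain rfl : a = a' := funext fun i => Subtype.ext (children_eq (some i))
  rcases o with _ | t <;> rcases o' with _ | t'
  · rfl
  · exact absurd (children_eq none).symm t'.2.1.ne_leaf
  · exact absurd (children_eq none) t.2.1.ne_leaf
  · obtain rfl : t = t' := Subtype.ext (children_eq none)
    rfl

theorem tree_surjective : Function.Surjective (tree (Q := Q)) := by
  rintro ⟨_ | ⟨s, _ | p, ch⟩, h⟩
  · exact absurd rfl h.1.ne_leaf
  · have mem_slot (q : Pos s) : ch q ∈ companionSlot Q (posKind s q) := (h.1.2 q).2 nofun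
    have mem_letter (i : Fin s.length) : ch (some i) ∈ companionSet Q (s.get i).partner :=
      companionSlot_letter Q _ ▸ mem_slot (some i)
    obtain ⟨o, ho⟩ : ∃ o : Option (companionSet Q (some .bullet)),
        o.elim .leaf Subtype.val = ch none := by
      rcases (companionSlot_none Q ▸ mem_slot none :) with hl | hc
      · exact ⟨none, hl.symm⟩
      · exact ⟨some ⟨_, hc⟩, rfl⟩
    refine ⟨⟨o, ⟨s, h.1.1⟩, fun i => ⟨_, mem_letter i⟩⟩, Subtype.ext ?_⟩
    refine congrArg (Tree.node s none) (funext fun q => ?_)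
    rcases q with _ | i
    · exact ho
    · rfl
  · exact nomatch h.2

theorem necklaces_tree (x : TreePairs Q) : x.tree.1.necklaces =
    x.1.elim 0 (fun t => t.1.necklaces) + (x.2.1.1 ::ₘ ∑ i, (x.2.2 i).1.necklaces) := by
  change x.2.1.1 ::ₘ ∑ q, (x.children q).necklaces = _
  rw [Fintype.sum_option, Multiset.add_cons]
  rcases x with ⟨_ | t, s⟩ <;> rfl

end TreePairs

variable (Q)

theorem exists_equiv_pairs_treePairs : ∃ e : Pairs Q ≃ TreePairs Q, ∀ x,
    (e x).tree.1.necklaces = x.necklaces ∧ (e x).2.1 = x.2.1 := by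
  choose e he using exists_equiv_C Q
  refine ⟨(Equiv.optionCongr (e _)).prodCongr
    (Equiv.sigmaCongrRight fun _ => Equiv.piCongrRight fun _ => e _), fun x => ⟨?_, rfl⟩⟩
  rw [TreePairs.necklaces_tree, Pairs.necklaces]
  refine congrArg₂ (· + ·) ?_ (congrArg (Multiset.cons _) ?_)
  · rcases x with ⟨_ | c, s⟩
    · rfl
    · exact (he _ c).1
  · exact Finset.sum_congr rfl fun i _ => (he _ _).1

theorem exists_equiv_markedC_pairs : ∃ e : IsoClass (IsMarkedC Q) ≃ Pairs Q, ∀ c,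
    (e c).necklaces = c.necklaces ∧ some (e c).2.1.1 = c.markedNecklace := by
  obtain ⟨e₁, h₁⟩ := exists_equiv_markedC Q
  obtain ⟨e₂, h₂⟩ := exists_equiv_pairs_treePairs Q
  let treeEquiv : TreePairs Q ≃ MarkedCompanionTree Q :=
    Equiv.ofBijective _ ⟨TreePairs.tree_injective, TreePairs.tree_surjective⟩
  let e := e₂.trans (treeEquiv.trans e₁.symm)
  refine ⟨e.symm, fun c => ?_⟩
  obtain ⟨x, rfl⟩ := e.surjective c
  have hx := h₁ (e x)
  rw [show e₁ (e x) = (e₂ x).tree from e₁.apply_symm_apply _] at hx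
  rw [Equiv.symm_apply_apply, ← hx.1, ← hx.2, (h₂ x).1, ← (h₂ x).2]
  exact ⟨rfl, rfl⟩

end Cut

end Necklace

/-! ### Counting by size -/

section FiniteFibers

open Finset

variable {X Y γ ι : Type*}

/-- The condition for the elements of `X` to be counted by their size `k`: finitely many of them
have a given size. -/
abbrev FiniteFibers (k : X → ℕ) : Prop := ∀ n, Finite {x // k x = n}

/-- The generating function of `X` by the size `k`. -/
noncomputable def sizeGF (k : X → ℕ) : PowerSeries ℤ :=
  PowerSeries.mk fun n => (Nat.card {x // k x = n} : ℤ)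

variable {k : X → ℕ} {l : Y → ℕ}

theorem FiniteFibers.of_injective {e : X → Y} (he : Function.Injective e) (h : ∀ x, l (e x) = k x)
    (hl : FiniteFibers l) : FiniteFibers k := fun n => by
  have := hl n
  exact .of_injective (fun x : {x // k x = n} => (⟨e x, (h _).trans x.2⟩ : {y // l y = n}))
    fun _ _ hxy => Subtype.ext (he (congrArg Subtype.val hxy))

theorem coeff_sizeGF (k : X → ℕ) (n : ℕ) :
    PowerSeries.coeff n (sizeGF k) = (Nat.card {x // k x = n} : ℤ) :=
  PowerSeries.coeff_mk _ _

theorem sizeGF_congr (e : X ≃ Y) (h : ∀ x, l (e x) = k x) : sizeGF k = sizeGF l := by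
  ext n
  rw [coeff_sizeGF, coeff_sizeGF,
    Nat.card_congr (e.subtypeEquiv (q := (l · = n)) fun x => by rw [h])]

section Sum

variable {p : X → Prop} {f : X → γ} {s : Finset γ}

theorem finite_subtype_of_finite_fiber [∀ c, Finite {x // f x = c}]
    (hs : ∀ x, p x ↔ f x ∈ s) : Finite {x // p x} :=
  .of_equiv (Σ c : s, {x // f x = c}) (Equiv.sigmaSubtypeFiberEquivSubtype f hs)

theorem card_subtype_eq_sum_card_fiber [∀ c, Finite {x // f x = c}] (hs : ∀ x, p x ↔ f x ∈ s) :
    Nat.card {x // p x} = ∑ c ∈ s, Nat.card {x // f x = c} := by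
  rw [← Nat.card_congr (Equiv.sigmaSubtypeFiberEquivSubtype f hs), Nat.card_sigma]
  exact sum_coe_sort s fun c => Nat.card {x // f x = c}

end Sum

section Prod

theorem prodMap_mem_antidiagonal_iff {n : ℕ} (x : X × Y) :
    k x.1 + l x.2 = n ↔ Prod.map k l x ∈ antidiagonal n :=
  Iff.symm (mem_antidiagonal (a := Prod.map k l x))

/-- The pairs of given sizes. -/
def prodFiberEquiv (k : X → ℕ) (l : Y → ℕ) (c : ℕ × ℕ) :
    {x // Prod.map k l x = c} ≃ {x // k x = c.1} × {y // l y = c.2} :=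
  (Equiv.subtypeEquivRight fun _ => Prod.ext_iff).trans
    (Equiv.subtypeProdEquivProd (p := (k · = c.1)) (q := (l · = c.2)))

theorem finite_prodMap_fiber (hk : FiniteFibers k) (hl : FiniteFibers l) (c : ℕ × ℕ) :
    Finite {x // Prod.map k l x = c} :=
  have := hk c.1
  have := hl c.2
  .of_equiv _ (prodFiberEquiv k l c).symm

theorem sizeGF_prod (hk : FiniteFibers k) (hl : FiniteFibers l) :
    sizeGF (fun x : X × Y => k x.1 + l x.2) = sizeGF k * sizeGF l := by
  ext n
  have := finite_prodMap_fiber hk hl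
  rw [coeff_sizeGF, PowerSeries.coeff_mul,
    card_subtype_eq_sum_card_fiber prodMap_mem_antidiagonal_iff, Nat.cast_sum]
  refine sum_congr rfl fun c _ => ?_
  rw [Nat.card_congr (prodFiberEquiv k l c), Nat.card_prod, Nat.cast_mul, coeff_sizeGF,
    coeff_sizeGF]

end Prod

section Pi

variable [Fintype ι] {Z : ι → Type*} {m : ∀ i, Z i → ℕ}

/-- The sizes of the components of a family. -/
noncomputable def sizes (m : ∀ i, Z i → ℕ) (z : ∀ i, Z i) : ι →₀ ℕ :=
  Finsupp.equivFunOnFinite.symm fun i => m i (z i)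

theorem sizes_mem_finsuppAntidiag_iff [DecidableEq ι] {n : ℕ} (z : ∀ i, Z i) :
    ∑ i, m i (z i) = n ↔ sizes m z ∈ finsuppAntidiag univ n := by
  simp [sizes, mem_finsuppAntidiag]

/-- The families of given sizes. -/
noncomputable def sizesFiberEquiv (m : ∀ i, Z i → ℕ) (d : ι →₀ ℕ) :
    {z // sizes m z = d} ≃ ∀ i, {z // m i z = d i} :=
  (Equiv.subtypeEquivRight fun _ => DFunLike.ext_iff).trans
    (Equiv.subtypePiEquivPi (p := fun i (z : Z i) => m i z = d i))

theorem finite_sizes_fiber (hm : ∀ i, FiniteFibers (m i)) (d : ι →₀ ℕ) :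
    Finite {z // sizes m z = d} :=
  have := fun i => hm i (d i)
  .of_equiv _ (sizesFiberEquiv m d).symm

theorem FiniteFibers.pi (hm : ∀ i, FiniteFibers (m i)) :
    FiniteFibers fun z : ∀ i, Z i => ∑ i, m i (z i) := fun _ => by
  classical
  have := finite_sizes_fiber hm
  exact finite_subtype_of_finite_fiber sizes_mem_finsuppAntidiag_iff

theorem sizeGF_pi (hm : ∀ i, FiniteFibers (m i)) :
    sizeGF (fun z : ∀ i, Z i => ∑ i, m i (z i)) = ∏ i, sizeGF (m i) := by
  classical
  ext n
  have := finite_sizes_fiber hm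
  rw [coeff_sizeGF, PowerSeries.coeff_prod,
    card_subtype_eq_sum_card_fiber sizes_mem_finsuppAntidiag_iff, Nat.cast_sum]
  refine sum_congr rfl fun d _ => ?_
  rw [Nat.card_congr (sizesFiberEquiv m d), Nat.card_pi, Nat.cast_prod]
  simp only [coeff_sizeGF]

end Pi

section Sigma

variable {V : X → Type*} [∀ a, Finite (V a)]

theorem FiniteFibers.sigma (hk : FiniteFibers k) : FiniteFibers fun x : Σ a, V a => k x.1 :=
  fun n =>
  have := hk n
  .of_equiv _ (Equiv.subtypeSigmaEquiv V (k · = n)).symm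

theorem sizeGF_sigma (hk : FiniteFibers k) (hV : ∀ a, Nat.card (V a) = k a) :
    sizeGF (fun x : Σ a, V a => k x.1) = PowerSeries.X * PowerSeries.derivative ℤ (sizeGF k) := by
  have coeff_eq (n : ℕ) :
      Nat.card {x : Σ a, V a // k x.1 = n} = Nat.card {a // k a = n} * n := by
    have := hk n
    have := Fintype.ofFinite {a // k a = n}
    rw [Nat.card_congr (Equiv.subtypeSigmaEquiv V (k · = n)), Nat.card_sigma,
      Finset.sum_congr rfl fun a _ => (hV a.1).trans a.2, Finset.sum_const, smul_eq_mul,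
      Finset.card_univ, Nat.card_eq_fintype_card]
  ext n
  rw [coeff_sizeGF, coeff_eq]
  cases n with
  | zero => simp
  | succ n =>
    rw [PowerSeries.coeff_succ_X_mul, PowerSeries.coeff_derivative, coeff_sizeGF]
    push_cast
    rfl

end Sigma

section Option

/-- The options of a given size, where `none` has size `0`. -/
def optionFiberEquiv (k : X → ℕ) (n : ℕ) :
    {o : Option X // o.elim 0 k = n} ≃ {_u : Unit // 0 = n} ⊕ {x // k x = n} where
  toFun
    | ⟨none, h⟩ => .inl ⟨(), h⟩
    | ⟨some x, h⟩ => .inr ⟨x, h⟩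
  invFun
    | .inl u => ⟨none, u.2⟩
    | .inr x => ⟨some x.1, x.2⟩
  left_inv := by rintro ⟨_ | x, h⟩ <;> rfl
  right_inv := by rintro (u | x) <;> rfl

theorem FiniteFibers.option (hk : FiniteFibers k) :
    FiniteFibers fun o : Option X => o.elim 0 k := fun n =>
  have := hk n
  .of_equiv _ (optionFiberEquiv k n).symm

theorem sizeGF_option (hk : FiniteFibers k) :
    sizeGF (fun o : Option X => o.elim 0 k) = 1 + sizeGF k := by
  ext n
  have := hk n
  rw [map_add, coeff_sizeGF, coeff_sizeGF, PowerSeries.coeff_one,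
    Nat.card_congr (optionFiberEquiv k n), Nat.card_sum, Nat.cast_add]
  rcases n with _ | n <;> simp

end Option

theorem FiniteFibers.add_one (hk : FiniteFibers k) : FiniteFibers fun x => k x + 1
  | 0 =>
    have : IsEmpty {x // k x + 1 = 0} := ⟨fun x => nomatch x.2⟩
    inferInstance
  | n + 1 => by simpa only [Nat.add_right_cancel_iff] using hk n

theorem sizeGF_add_one (k : X → ℕ) : sizeGF (fun x => k x + 1) = PowerSeries.X * sizeGF k := by
  ext n
  cases n with
  | zero => simp [coeff_sizeGF]
  | succ n =>
    rw [coeff_sizeGF, PowerSeries.coeff_succ_X_mul, coeff_sizeGF]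
    simp only [Nat.add_right_cancel_iff]

end FiniteFibers

/-! ### Trees of given size -/

namespace Necklace

open Necklace.Tree

theorem IsoClass.size_eq_card {P : Decorated → Prop} (c : IsoClass P) :
    c.size = c.necklaces.card := by
  induction c using Quotient.ind with
  | _ A =>
    change A.1.size = A.1.necklaces.card
    rw [Decorated.necklaces, Multiset.card_map]
    exact (Finset.card_fin _).symm

namespace Tree

theorem card_vtx (t : Tree) : Nat.card t.Vtx = t.necklaces.card := by
  have := Fintype.ofFinite t.Vtx
  rw [← sum_word, Multiset.card_sum, Nat.card_eq_fintype_card, Fintype.card_eq_sum_ones]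
  rfl

theorem card_necklaces_node (s : List Letter) (p : Option (Pos s)) (ch : Pos s → Tree) :
    (node s p ch).necklaces.card = ∑ q, (ch q).necklaces.card + 1 := by
  rw [necklaces, Multiset.card_cons, Multiset.card_sum]

/-- The total number of letters of the necklaces of a tree. -/
def letters (t : Tree) : ℕ := (t.necklaces.map List.length).sum

theorem letters_node (s : List Letter) (p : Option (Pos s)) (ch : Pos s → Tree) :
    (node s p ch).letters = s.length + ∑ q, (ch q).letters := by
  rw [letters, necklaces, Multiset.map_cons, Multiset.sum_cons]
  exact congrArg _ (map_sum (Multiset.sumAddMonoidHom.comp (Multiset.mapAddMonoidHom List.length))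
    (fun q => (ch q).necklaces) Finset.univ)

@[simp] theorem letters_leaf : leaf.letters = 0 := rfl

@[simp] theorem card_necklaces_leaf : leaf.necklaces.card = 0 := rfl

variable {Q : Set (List Letter)}

/-- At a necklace, only the root pearl and the `□`-pearl may be free. -/
theorem IsCompanion.letters_lt : ∀ {t : Tree}, t.IsCompanion Q → t.letters < 2 * t.necklaces.card
  | .leaf, h => h.elim
  | .node s p ch, h => by
    have child_le (q : Pos s) : (ch q).letters + 1 ≤ 2 * (ch q).necklaces.card +
        ((if q = none then 1 else 0) + if p = some q then 1 else 0) := by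
      by_cases hp : p = some q
      · simp [(h.2 q).1 hp, hp]
      · rcases (h.2 q).2 hp with ⟨hleaf, hq⟩ | ⟨k, -, -, hcomp⟩
        · rcases q with _ | i
          · simp [hleaf]
          · exact nomatch hq
        · have := IsCompanion.letters_lt hcomp
          omega
    have sum_le := Finset.sum_le_sum fun q (_ : q ∈ Finset.univ) => child_le q
    have root_le : ∑ q, (if p = some q then 1 else 0) ≤ 1 := by
      rcases p with _ | p <;> simp
    rw [Finset.sum_add_distrib, Finset.sum_add_distrib, Finset.sum_add_distrib, ← Finset.mul_sum,
      Finset.sum_ite_eq', if_pos (Finset.mem_univ _), Finset.sum_const, Finset.card_univ,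
      Fintype.card_option, Fintype.card_fin] at sum_le
    rw [letters_node, card_necklaces_node]
    simp only [smul_eq_mul, mul_one] at sum_le
    omega

theorem IsQTree.letters_le : ∀ {t : Tree}, t.IsQTree Q →
    (t.letters : ℤ) + 2 ≤ 2 * t.necklaces.card + t.exc
  | .leaf, h => h.1.elim
  | .node s p ch, ⟨h, hr⟩ => by
    obtain rfl : p = some none := by
      rcases p with _ | _ | p
      · cases hr
      · rfl
      · cases hr
    have root_eq : ch none = leaf := (h.2 none).1 rfl
    have child_le (i : Fin s.length) : 1 + ((ch (some i)).letters : ℤ) ≤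
        2 * ((ch (some i)).necklaces.card : ℤ) +
          (Kind.exc (some (s.get i)) + (ch (some i)).exc) := by
      rcases (h.2 (some i)).2 nofun with ⟨hleaf, hi⟩ | ⟨k, hk, hrel, hlocal⟩
      · rw [hleaf, show some (s.get i) = some Letter.triangle from hi]
        simp [Kind.exc, exc]
      · obtain ⟨-, rfl⟩ := treeRel_letter_iff.1 hrel
        have := letters_le ⟨hlocal, hk⟩
        have : -1 ≤ Kind.exc (some (s.get i)) := by
          cases s.get i <;> simp [Kind.exc]
        omega
    have sum_le := Finset.sum_le_sum fun i (_ : i ∈ Finset.univ) => child_le i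
    have exc_eq : (node s (some none) ch).exc =
        ∑ i : Fin s.length, (Kind.exc (some (s.get i)) + (ch (some i)).exc) := by
      rw [exc, Fintype.sum_option, root_eq]
      exact zero_add _
    rw [Finset.sum_add_distrib, Finset.sum_add_distrib, ← exc_eq, ← Finset.mul_sum] at sum_le
    rw [letters_node, card_necklaces_node, Fintype.sum_option, Fintype.sum_option, root_eq]
    simp only [Finset.sum_const, Finset.card_univ, Fintype.card_fin, mul_one,
      nsmul_eq_mul, letters_leaf, card_necklaces_leaf, zero_add] at sum_le ⊢
    push_cast
    omega

theorem finite_setOf_letters_le (n : ℕ) :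
    {t : Tree | t.necklaces.card = n ∧ t.letters ≤ 2 * n}.Finite := by
  refine (finite_setOf_card_necklaces_le
    (List.finite_length_le Letter (2 * n)).toFinset n).subset ?_
  refine fun t ⟨card_eq, letters_le⟩ => ⟨card_eq.le, fun s hs => ?_⟩
  rw [Set.Finite.mem_toFinset]
  exact (Multiset.single_le_sum (fun _ _ => Nat.zero_le _) _
    (Multiset.mem_map_of_mem _ hs)).trans letters_le

end Tree

theorem finiteFibers_of_letters_le {T : Tree → Prop}
    (hT : ∀ t, T t → t.letters ≤ 2 * t.necklaces.card) :
    FiniteFibers fun t : {t // T t} => t.1.necklaces.card := fun n =>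
  have := (finite_setOf_letters_le n).to_subtype
  .of_injective (β := {t : Tree | t.necklaces.card = n ∧ t.letters ≤ 2 * n})
    (fun x => ⟨x.1.1, x.2, (hT _ x.1.2).trans_eq (congrArg _ x.2)⟩)
    fun _ _ h => Subtype.ext (Subtype.ext (congrArg Subtype.val h :))

variable (Q : Set (List Letter))

theorem finiteFibers_balancedTree : FiniteFibers fun t : BalancedTree Q => t.1.necklaces.card :=
  finiteFibers_of_letters_le fun t h => by
    have := h.1.letters_le
    rw [h.2.2] at this
    omega

theorem finite_F0 : FiniteFibers (IsoClass.size (P := IsF0 Q)) :=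
  have ⟨e, he⟩ := exists_equiv_F0 Q
  .of_injective e.injective (fun c => by rw [(he c).1, c.size_eq_card])
    (finiteFibers_balancedTree Q)

theorem finite_C (x : Kind) : FiniteFibers (IsoClass.size (P := IsC Q x)) :=
  have ⟨e, he⟩ := exists_equiv_C Q x
  .of_injective e.injective (fun c => by rw [(he c).1, c.size_eq_card])
    (finiteFibers_of_letters_le fun _ h => h.1.letters_lt.le)

theorem size_C_pos {x : Kind} (c : C Q x) : 0 < c.size := by
  obtain ⟨e, he⟩ := exists_equiv_C Q x
  have := (e c).2.1.letters_lt
  rw [c.size_eq_card, ← (he c).1]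
  omega

theorem finite_markedF0 : FiniteFibers (IsoClass.size (P := IsMarkedF0 Q)) :=
  have ⟨e, he⟩ := exists_equiv_markedF0 Q
  .of_injective e.injective (fun c => by rw [(he c).1, c.size_eq_card])
    (finiteFibers_balancedTree Q).sigma

theorem X_mul_derivative_gf : PowerSeries.X * PowerSeries.derivative ℤ (IsoClass.gf (IsF0 Q)) =
    IsoClass.gf (IsMarkedF0 Q) := by
  obtain ⟨e, he⟩ := exists_equiv_F0 Q
  obtain ⟨e', he'⟩ := exists_equiv_markedF0 Q
  have gf_eq : IsoClass.gf (IsF0 Q) = sizeGF fun t : BalancedTree Q => t.1.necklaces.card :=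
    sizeGF_congr e fun c => by rw [(he c).1, c.size_eq_card]
  have gf_marked_eq : IsoClass.gf (IsMarkedF0 Q) =
      sizeGF fun x : Σ t : BalancedTree Q, t.1.Vtx => x.1.1.necklaces.card :=
    sizeGF_congr e' fun c => by rw [(he' c).1, c.size_eq_card]
  rw [gf_eq, gf_marked_eq, sizeGF_sigma (finiteFibers_balancedTree Q) fun t => t.1.card_vtx]

end Necklace

/-! ### The derivative -/

theorem prod_get_eq_prod_toFinsupp {α B : Type*} [DecidableEq α] [CommMonoid B] (f : α → B)
    (s : List α) : ∏ i : Fin s.length, f (s.get i) =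
      (Multiset.toFinsupp (s : Multiset α)).prod fun x e => f x ^ e := by
  calc ∏ i : Fin s.length, f (s.get i) = (s.map f).prod := Fin.prod_univ_fun_getElem s f
    _ = ((s : Multiset α).map f).prod := (Multiset.prod_coe _).symm
    _ = _ := Finset.prod_multiset_map_count _ _

namespace Necklace

variable (Q : Set (List Letter))

theorem hasSubst_companionSeries : MvPowerSeries.HasSubst (companionSeries Q) := by
  refine MvPowerSeries.hasSubst_of_constantCoeff_zero fun x => ?_
  have : IsEmpty {c : C Q x.partner // c.size = 0} := ⟨fun c => (size_C_pos Q c.1).ne' c.2⟩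
  change PowerSeries.constantCoeff (sizeGF (IsoClass.size (P := IsC Q x.partner))) = 0
  rw [← PowerSeries.coeff_zero_eq_constantCoeff_apply, coeff_sizeGF, Nat.card_of_isEmpty,
    Nat.cast_zero]

/-- The numbers of occurrences of the letters in a word. -/
noncomputable abbrev letterCount (s : List Letter) : Letter →₀ ℕ :=
  Multiset.toFinsupp (s : Multiset Letter)

theorem degree_letterCount (s : List Letter) : (letterCount s).degree = s.length :=
  (Finsupp.degree_apply _).trans (Multiset.toFinsupp_sum_eq _)

theorem coeff_vertexGF (d : Letter →₀ ℕ) : MvPowerSeries.coeff d (vertexGF Q) =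
    (Nat.card {s : Q // letterCount s.1 = d} : ℤ) := by
  change (Nat.card _ : ℤ) = _
  simp only [Finsupp.ext_iff, Multiset.toFinsupp_apply, Multiset.coe_count]

instance (d : Letter →₀ ℕ) : Finite {s : Q // letterCount s.1 = d} :=
  have := (List.finite_length_eq Letter d.degree).to_subtype
  .of_injective (β := {s : List Letter | s.length = d.degree})
    (fun s => ⟨s.1.1, (degree_letterCount _).symm.trans (congrArg Finsupp.degree s.2)⟩)
    fun _ _ h => Subtype.ext (Subtype.ext (congrArg Subtype.val h :))

/-- The trees that can be attached to the letters of a word. -/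
abbrev AttachedTo (s : List Letter) : Type := ∀ i : Fin s.length, C Q (s.get i).partner

variable {Q}

/-- The total number of necklaces of the trees attached to a word. -/
def AttachedTo.size {s : List Letter} (c : AttachedTo Q s) : ℕ := ∑ i, (c i).size

theorem AttachedTo.length_le_size {s : List Letter} (c : AttachedTo Q s) : s.length ≤ c.size :=
  calc s.length = ∑ _i : Fin s.length, 1 := by simp
    _ ≤ ∑ i, (c i).size := Finset.sum_le_sum fun i _ => size_C_pos Q (c i)

theorem AttachedTo.finiteFibers_size (s : List Letter) : FiniteFibers (size (Q := Q) (s := s)) :=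
  .pi fun _ => finite_C Q _

theorem AttachedTo.sizeGF_size (s : List Letter) : sizeGF (size (Q := Q) (s := s)) =
    (letterCount s).prod fun x e => companionSeries Q x ^ e := by
  rw [← prod_get_eq_prod_toFinsupp]
  exact sizeGF_pi fun i => finite_C Q _

namespace Attached

/-- The total number of necklaces of the attached trees. -/
def size (x : Attached Q) : ℕ := AttachedTo.size x.2

/-- The size of the attached trees and the numbers of occurrences of the letters in the word. -/
noncomputable def bidegree (x : Attached Q) : ℕ × (Letter →₀ ℕ) := (x.size, letterCount x.1.1)

theorem size_eq_iff {n : ℕ} (x : Attached Q) : x.size = n ↔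
    x.bidegree ∈ {n} ×ˢ (Finsupp.finite_of_degree_le (σ := Letter) n).toFinset := by
  rw [Finset.mem_product, Finset.mem_singleton, Set.Finite.mem_toFinset]
  refine ⟨fun h => ⟨h, ?_⟩, And.left⟩
  exact (degree_letterCount _).trans_le ((AttachedTo.length_le_size x.2).trans_eq h)

/-- The attached trees of given bidegree. -/
def bidegreeFiberEquiv (n : ℕ) (d : Letter →₀ ℕ) : {x : Attached Q // x.bidegree = (n, d)} ≃
    Σ s : {s : Q // letterCount s.1 = d}, {c : AttachedTo Q s.1.1 // c.size = n} where
  toFun x := ⟨⟨x.1.1, congrArg Prod.snd x.2⟩, x.1.2, congrArg Prod.fst x.2⟩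
  invFun x := ⟨⟨x.1.1, x.2.1⟩, Prod.ext x.2.2 x.1.2⟩

instance (b : ℕ × (Letter →₀ ℕ)) : Finite {x : Attached Q // x.bidegree = b} :=
  have (s : List Letter) := AttachedTo.finiteFibers_size (Q := Q) s b.1
  .of_equiv _ (bidegreeFiberEquiv b.1 b.2).symm

theorem card_bidegree_fiber (n : ℕ) (d : Letter →₀ ℕ) :
    (Nat.card {x : Attached Q // x.bidegree = (n, d)} : ℤ) = MvPowerSeries.coeff d (vertexGF Q) *
      PowerSeries.coeff n (d.prod fun x e => companionSeries Q x ^ e) := by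
  have := Fintype.ofFinite {s : Q // letterCount s.1 = d}
  have (s : List Letter) := AttachedTo.finiteFibers_size (Q := Q) s n
  have card_eq (s : {s : Q // letterCount s.1 = d}) :
      (Nat.card {c : AttachedTo Q s.1.1 // c.size = n} : ℤ) =
        PowerSeries.coeff n (d.prod fun x e => companionSeries Q x ^ e) := by
    rw [← coeff_sizeGF, AttachedTo.sizeGF_size, s.2]
  rw [Nat.card_congr (bidegreeFiberEquiv n d), Nat.card_sigma, Nat.cast_sum,
    Finset.sum_congr rfl fun s _ => card_eq s, Finset.sum_const, nsmul_eq_mul, Finset.card_univ,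
    ← Nat.card_eq_fintype_card, coeff_vertexGF]

theorem finiteFibers_size : FiniteFibers (size (Q := Q)) := fun _ =>
  finite_subtype_of_finite_fiber size_eq_iff

theorem sizeGF_size :
    sizeGF (size (Q := Q)) = MvPowerSeries.subst (companionSeries Q) (vertexGF Q) := by
  ext n
  rw [coeff_sizeGF, card_subtype_eq_sum_card_fiber size_eq_iff, Finset.sum_product,
    Finset.sum_singleton, Nat.cast_sum, PowerSeries.coeff,
    MvPowerSeries.coeff_subst (hasSubst_companionSeries Q)]
  simp only [card_bidegree_fiber]
  refine (finsum_eq_sum_of_support_subset _ fun d hd => ?_).symm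
  have card_ne_zero : (Nat.card {x : Attached Q // x.bidegree = (n, d)} : ℤ) ≠ 0 := by
    rw [card_bidegree_fiber]
    exact hd
  obtain ⟨x, hx⟩ := (Nat.card_ne_zero.1 (Nat.cast_ne_zero.1 card_ne_zero)).1
  have mem := x.size_eq_iff.1 (congrArg Prod.fst hx)
  rw [hx] at mem
  exact (Finset.mem_product.1 mem).2

end Attached

theorem Pairs.card_necklaces (x : Pairs Q) :
    x.necklaces.card = x.1.elim 0 IsoClass.size + (x.2.size + 1) := by
  rw [Pairs.necklaces, Multiset.card_add, Multiset.card_cons, Multiset.card_sum]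
  refine congrArg₂ (· + ·) ?_ (congrArg (· + 1) ?_)
  · rcases x with ⟨_ | c, s⟩
    · rfl
    · exact c.size_eq_card.symm
  · exact Finset.sum_congr rfl fun i _ => (x.2.2 i).size_eq_card.symm

variable (Q)

theorem gf_markedF0 : IsoClass.gf (IsMarkedF0 Q) = PowerSeries.X *
    ((1 + IsoClass.gf (IsC Q (some .bullet))) *
      MvPowerSeries.subst (companionSeries Q) (vertexGF Q)) := by
  obtain ⟨e₁, h₁⟩ := exists_equiv_markedF0_markedC Q
  obtain ⟨e₂, h₂⟩ := exists_equiv_markedC_pairs Q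
  calc IsoClass.gf (IsMarkedF0 Q)
      = sizeGF fun x : Pairs Q => x.1.elim 0 IsoClass.size + (x.2.size + 1) :=
        sizeGF_congr (e₁.trans e₂) fun c => by
          rw [← Pairs.card_necklaces, Equiv.trans_apply, (h₂ _).1, (h₁ _).1, c.size_eq_card]
    _ = (1 + sizeGF IsoClass.size) * (PowerSeries.X * sizeGF Attached.size) := by
        rw [sizeGF_prod (finite_C Q _).option Attached.finiteFibers_size.add_one,
          sizeGF_option (finite_C Q _), sizeGF_add_one]
    _ = _ := by rw [Attached.sizeGF_size, mul_left_comm]; rfl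

theorem derivative_gf : PowerSeries.derivative ℤ (IsoClass.gf (IsF0 Q)) =
    (1 + IsoClass.gf (IsC Q (some .bullet))) *
      MvPowerSeries.subst (companionSeries Q) (vertexGF Q) :=
  mul_left_cancel₀ PowerSeries.X_ne_zero ((X_mul_derivative_gf Q).trans (gf_markedF0 Q))

end Necklace

theorem mainTheorem5 (Q : Set (List Necklace.Letter)) :
    -- necklace-preserving bijections
    (∃ e : Necklace.IsoClass (Necklace.IsMarkedF0 Q) ≃ Necklace.IsoClass (Necklace.IsMarkedC Q),
      ∀ τ, (e τ).necklaces = τ.necklaces ∧ (e τ).markedNecklace = τ.markedNecklace) ∧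
    (∃ e : Necklace.IsoClass (Necklace.IsMarkedC Q) ≃ Necklace.Pairs Q,
      ∀ τ, (e τ).necklaces = τ.necklaces ∧ some (e τ).2.1.1 = τ.markedNecklace) ∧
    -- the generating functions are well defined
    (∀ n, Finite {c : Necklace.IsoClass (Necklace.IsF0 Q) // c.size = n}) ∧
    (∀ n, Finite {c : Necklace.IsoClass (Necklace.IsMarkedF0 Q) // c.size = n}) ∧
    (∀ x n, Finite {c : Necklace.C Q x // c.size = n}) ∧
    MvPowerSeries.HasSubst (Necklace.companionSeries Q) ∧
    -- `df/dt` counts the non-negative trees of excess `0` with a marked necklace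
    PowerSeries.X * PowerSeries.derivative ℤ (Necklace.IsoClass.gf (Necklace.IsF0 Q)) =
      Necklace.IsoClass.gf (Necklace.IsMarkedF0 Q) ∧
    -- `df/dt = (1 + C_●) · Q(C_□, C_▲, C_♦)`
    PowerSeries.derivative ℤ (Necklace.IsoClass.gf (Necklace.IsF0 Q)) =
      (1 + Necklace.IsoClass.gf (Necklace.IsC Q (some .bullet))) *
        MvPowerSeries.subst (Necklace.companionSeries Q) (Necklace.vertexGF Q) :=
  ⟨Necklace.exists_equiv_markedF0_markedC Q, Necklace.exists_equiv_markedC_pairs Q,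
    Necklace.finite_F0 Q, Necklace.finite_markedF0 Q, Necklace.finite_C Q,
    Necklace.hasSubst_companionSeries Q, Necklace.X_mul_derivative_gf Q, Necklace.derivative_gf Q⟩
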